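/- **No primitive with deterministic evaluation is $\mu$-selectively unforgeable against quantum adversaries.** *Conventions.* For an infinite set $S\subseteq\mathbb N$ of security parameters, a function $f$ is called non-negligible (on $S$) if for some $c$ one has $f(\lambda)\ge\lambda^{-c}$ for all sufficiently large $\lambda\in S$. ($S=\mathbb N$ is allowed; a function is not negligible in the usual sense exactly when it is non-negligible on some infinite $S$.) $F(\rho,\sigma)=\big(\operatorname{Tr}\sqrt{\sqrt\rho\,\sigma\sqrt\rho}\big)^2$ is the fidelity; $\rho,\sigma$ are $\mu$-distinguishable if $F(\rho,\sigma)\le 1-\mu$. A QPT adversary is a polynomial-time uniform family of quantum circuits with oracle gates, measured at the end; the classical program that writes the circuits receives $1^\lambda$, the register sizes of the primitive (and, for quantum primitives, the number of test copies) and the first $\lambda$ binary digits of $\mu(\lambda)$. *Primitives.* A classical primitive has a setup that samples a key $k$, a deterministic evaluation $f_k:\{0,1\}^{n(\lambda)}\to\{0,1\}^{\ell(\lambda)}$ with $n\ge1$ and $n,\ell$ polynomially bounded, and a verification that accepts $(m,f_k(m))$ for every $m$. Its evaluation oracle is $|m,y\rangle\mapsto|m,y\oplus f_k(m)\rangle$.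 A quantum primitive has a setup that samples a key $k$, evaluates by a unitary $U_k$ on $n(\lambda)\ge1$ qubits, and verifies by a quantum test algorithm: a two-outcome measurement on $\kappa_1$ and $\kappa_2$ copies of two states which accepts pure states of fidelity $x$ with a probability $a(\kappa_1,\kappa_2,x)$, where $a\to1$ as $x\to1$, $a$ has a limit as $x\to0$, and $a\to x$ as $\kappa_1,\kappa_2\to\infty$. The verification uses $\kappa(\lambda)\ge1$ copies of each state, with $n,\kappa$ polynomially bounded. *The selective game.* The adversary first announces a challenge: a message $m$ (classical primitive), or a circuit preparing a pure state $|\psi\rangle$ from $|0\rangle^{\otimes n}$ (quantum primitive). It then makes $q=q(\lambda)$ queries to the evaluation oracle, possibly entangled with its internal register, and finally outputs a forgery: a string $t$, respectively a state on $\kappa$ blocks of $n$ qubits. It wins if each query is $\mu$-distinguishable from the challenge (the reduced state of the message register from $|m\rangle\langle m|$, respectively the reduced state of the query register from $|\psi\rangle\langle\psi|$) and the verification accepts (the pair $(m,t)$, respectively the forgery against $\kappa$ copies of $U_k|\psi\rangle$). The overlap probability is $P_{ov}(q,\mu)=1-\mu^q$ for a classical primitive and $P_{ov}(\mu)=a(\kappa,\kappa,1-\mu)$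 for a quantum primitive. **Theorem.** Let $S\subseteq\mathbb N$ be infinite and let $0<\mu(\lambda)\le1$ be such that $\mu-\frac14$ and $1-\mu$ are non-negligible on $S$, that is, $\frac14+\text{non-negl}\le\mu\le1-\text{non-negl}$. 1. For every classical primitive with deterministic evaluation there is a QPT adversary such that, with $q(\lambda)$ its number of queries, $$\Pr[\text{it wins the }\mu\text{-selective game}]-P_{ov}(q(\lambda),\mu(\lambda))$$ is non-negligible on $S$. 2. For every quantum primitive with unitary evaluation whose overlap probability is not overwhelming, that is, $1-P_{ov}(\mu(\lambda))$ is non-negligible on $S$, there is a QPT adversary such that $$\Pr[\text{it wins the }\mu\text{-selective game}]-P_{ov}(\mu(\lambda))$$ is non-negligible on $S$. -/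

import Mathlib

namespace QForge

open scoped MatrixOrder ComplexOrder Kronecker

noncomputable section

/-! ### Asymptotics -/

/-- `f` is at least an inverse polynomial, for all large enough security parameters in `S`.
A function fails to be negligible exactly when this holds for some infinite `S`;
`S = Set.univ` is the version "for all large security parameters". -/
def NonNegligibleOn (S : Set ℕ) (f : ℕ → ℝ) : Prop :=
  ∃ c : ℕ, ∀ᶠ s : ℕ in Filter.atTop, s ∈ S → ((s : ℝ) ^ c)⁻¹ ≤ f s

/-- `f s` is at most polynomial in `s`. -/
def PolyBounded (f : ℕ → ℕ) : Prop :=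
  ∃ p : Polynomial ℕ, ∀ s, f s ≤ p.eval s

/-! ### States of finitely many qubits -/

/-- Amplitude vectors of qubits labelled by `ι`, in the computational basis. -/
abbrev Vec (ι : Type) := (ι → Bool) → ℂ

/-- Operators on the qubits labelled by `ι`, in the computational basis. -/
abbrev Op (ι : Type) := Matrix (ι → Bool) (ι → Bool) ℂ

/-- The basis vector `|b⟩`. -/
def ket {ι : Type} [Fintype ι] (b : ι → Bool) : Vec ι := fun a => if a = b then 1 else 0

/-- The density matrix `|ψ⟩⟨ψ|`. -/
def pureState {X : Type} (ψ : X → ℂ) : Matrix X X ℂ := Matrix.vecMulVec ψ (star ψ)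

/-- Uhlmann fidelity `(Tr √(√ρ σ √ρ))²`. -/
def fidelity {X : Type} [Fintype X] [DecidableEq X] (ρ σ : Matrix X X ℂ) : ℝ :=
  (Matrix.trace (CFC.sqrt (CFC.sqrt ρ * σ * CFC.sqrt ρ))).re ^ 2

/-- Two states are `μ`-distinguishable if their fidelity is at most `1 - μ`. -/
def Distinguishable {X : Type} [Fintype X] [DecidableEq X] (μ : ℝ) (ρ σ : Matrix X X ℂ) : Prop :=
  0 ≤ fidelity ρ σ ∧ fidelity ρ σ ≤ 1 - μ

open Classical in
/-- The reduced density matrix of the qubits selected by the injection `e` when all the qubits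
labelled by `κ` are in the pure state `ψ`. -/
def reduced {ι κ : Type} [Fintype κ] (e : ι → κ) (ψ : Vec κ) : Op ι := fun x y =>
  ∑ b : κ → Bool, ∑ b' : κ → Bool,
    if b ∘ e = x ∧ b' ∘ e = y ∧ ∀ i, i ∉ Set.range e → b i = b' i then ψ b * star (ψ b') else 0

open Classical in
/-- The operator `U` applied to the qubits selected by the injection `e`, and the identity applied
to all other qubits. -/
def applyOn {ι κ : Type} [Fintype κ] (e : ι → κ) (U : Op ι) (ψ : Vec κ) : Vec κ := fun b =>
  ∑ b' : κ → Bool, if ∀ i, i ∉ Set.range e → b i = b' i then U (b ∘ e) (b' ∘ e) * ψ b' else 0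

/-! ### Quantum circuits with oracle queries -/

/-- Elementary gates: NOT, Hadamard, `T = diag(1, exp(iπ/4))`, controlled NOT and Toffoli.
The last argument of `cnot` and `ccx` is the target. -/
inductive Gate (α : Type) where
  | x (i : α)
  | h (i : α)
  | t (i : α)
  | cnot (i j : α)
  | ccx (i j k : α)

namespace Gate

/-- The wires of a gate. -/
def wires {α : Type} : Gate α → List α
  | x i => [i]
  | h i => [i]
  | t i => [i]
  | cnot i j => [i, j]
  | ccx i j k => [i, j, k]

/-- Relabelling of the wires. -/
def map {α β : Type} (f : α → β) : Gate α → Gate β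
  | x i => x (f i)
  | h i => h (f i)
  | t i => t (f i)
  | cnot i j => cnot (f i) (f j)
  | ccx i j k => ccx (f i) (f j) (f k)

end Gate

/-- Bit number `i` of a string of `W` bits (`false` out of range). -/
def getBit {W : ℕ} (b : Fin W → Bool) (i : ℕ) : Bool := if hi : i < W then b ⟨i, hi⟩ else false

/-- Overwrite bit number `i` (no effect out of range). -/
def setBit {W : ℕ} (b : Fin W → Bool) (i : ℕ) (v : Bool) : Fin W → Bool :=
  fun j => if j.val = i then v else b j

/-- Action of a gate on `W` qubits. Always unitary: gates with a wire out of range, or with the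
target among the controls, act as the identity or as a gate on the remaining wires. -/
def Gate.apply {W : ℕ} : Gate ℕ → Vec (Fin W) → Vec (Fin W)
  | .x i, ψ => fun b => ψ (setBit b i (!getBit b i))
  | .h i, ψ => fun b =>
      if i < W then
        (ψ (setBit b i false) + (if getBit b i then -1 else 1) * ψ (setBit b i true))
          / (Real.sqrt 2 : ℂ)
      else ψ b
  | .t i, ψ => fun b =>
      (if getBit b i then Complex.exp (Real.pi / 4 * Complex.I) else 1) * ψ b
  | .cnot i j, ψ => fun b =>
      if i = j then ψ b else ψ (setBit b j (xor (getBit b j) (getBit b i)))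
  | .ccx i j k, ψ => fun b =>
      if i = k ∨ j = k then ψ b
      else ψ (setBit b k (xor (getBit b k) (getBit b i && getBit b j)))

/-- One step of an oracle circuit: a gate, or a query to the evaluation oracle. -/
inductive Instr where
  | gate (g : Gate ℕ)
  | query

/-- Number of oracle queries of a circuit. -/
def numQueries : List Instr → ℕ
  | [] => 0
  | .gate _ :: c => numQueries c
  | .query :: c => numQueries c + 1

/-- A bound that exceeds every wire index that occurs in a circuit. -/
def width : List Instr → ℕ
  | [] => 0
  | .gate g :: c => (g.wires.foldr (fun i m => max (i + 1) m) 0) ⊔ width c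
  | .query :: c => width c

/-- Run a circuit with oracle `O` from `ψ`. Returns the list of the global states right before
each of the queries, and the final global state. -/
def run {W : ℕ} (O : Vec (Fin W) → Vec (Fin W)) :
    List Instr → Vec (Fin W) → List (Vec (Fin W)) × Vec (Fin W)
  | [], ψ => ([], ψ)
  | .gate g :: c, ψ => run O c (g.apply ψ)
  | .query :: c, ψ => (ψ :: (run O c (O ψ)).1, (run O c (O ψ)).2)

/-- The state prepared from `|0…0⟩` by a list of gates. -/
def prepare (W : ℕ) (gs : List (Gate ℕ)) : Vec (Fin W) :=
  gs.foldl (fun ψ g => g.apply ψ) (ket fun _ => false)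

/-! ### Polynomial-time programs that write circuits

A random access machine with logarithmic cost: memory cells hold natural numbers, addresses can be
computed, and each operation is charged for the number of binary digits it handles. -/

/-- Arithmetic expressions; `cell a` is the content of the memory cell at address `a`. -/
inductive Expr where
  | lit (n : ℕ)
  | cell (a : Expr)
  | add (a b : Expr)
  | sub (a b : Expr)
  | mul (a b : Expr)

namespace Expr

/-- Value of an expression (subtraction is truncated). -/
def eval (mem : ℕ → ℕ) : Expr → ℕ
  | lit n => n
  | cell a => mem (a.eval mem)
  | add a b => a.eval mem + b.eval mem
  | sub a b => a.eval mem - b.eval mem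
  | mul a b => a.eval mem * b.eval mem

/-- Cost of evaluating an expression: one plus the number of binary digits of the result, for each
node. -/
def cost (mem : ℕ → ℕ) : Expr → ℕ
  | lit n => 1 + n.size
  | cell a => a.cost mem + (1 + (mem (a.eval mem)).size)
  | add a b => a.cost mem + b.cost mem + (1 + (a.eval mem + b.eval mem).size)
  | sub a b => a.cost mem + b.cost mem + (1 + (a.eval mem - b.eval mem).size)
  | mul a b => a.cost mem + b.cost mem + (1 + (a.eval mem * b.eval mem).size)

end Expr

/-- Programs. The output commands append to the description of the challenge (`challengeBit` for a
classical challenge, `challengeGate` for a quantum one) or to the circuit (`gate`, `query`). -/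
inductive Prog where
  | skip
  | store (a v : Expr)
  | challengeBit (e : Expr)
  | challengeGate (g : Gate Expr)
  | gate (g : Gate Expr)
  | query
  | seq (p q : Prog)
  | ite (e : Expr) (p q : Prog)
  | loop (e : Expr) (p : Prog)

/-- Memory and output of a program. -/
structure Config where
  mem : ℕ → ℕ
  /-- Positions of the ones in the classical challenge. -/
  challengeBits : List ℕ
  /-- Gates that prepare the quantum challenge from the all-zero state. -/
  challengeGates : List (Gate ℕ)
  /-- The circuit to be run in the learning and guess phases. -/
  circuit : List Instr

/-- Initial configuration: the input in the first cells, zeros elsewhere, empty output. -/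
def Config.start (input : List ℕ) : Config := ⟨fun i => input.getD i 0, [], [], []⟩

/-- Cost of evaluating all wire indices of a gate. -/
def Gate.cost (mem : ℕ → ℕ) (g : Gate Expr) : ℕ := (g.wires.map (Expr.cost mem)).sum

/-- `Exec p s s' n`: started in `s`, the program `p` halts in `s'` at total cost `n`. -/
inductive Exec : Prog → Config → Config → ℕ → Prop
  | skip (s : Config) : Exec .skip s s 1
  | store (s : Config) (a v : Expr) :
      Exec (.store a v) s
        { s with mem := Function.update s.mem (a.eval s.mem) (v.eval s.mem) }
        (1 + a.cost s.mem + v.cost s.mem)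
  | challengeBit (s : Config) (e : Expr) :
      Exec (.challengeBit e) s { s with challengeBits := s.challengeBits ++ [e.eval s.mem] }
        (1 + e.cost s.mem)
  | challengeGate (s : Config) (g : Gate Expr) :
      Exec (.challengeGate g) s
        { s with challengeGates := s.challengeGates ++ [g.map (Expr.eval s.mem)] }
        (1 + g.cost s.mem)
  | gate (s : Config) (g : Gate Expr) :
      Exec (.gate g) s { s with circuit := s.circuit ++ [.gate (g.map (Expr.eval s.mem))] }
        (1 + g.cost s.mem)
  | query (s : Config) : Exec .query s { s with circuit := s.circuit ++ [.query] } 1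
  | seq {p q : Prog} {s s' s'' : Config} {m n : ℕ} :
      Exec p s s' m → Exec q s' s'' n → Exec (.seq p q) s s'' (m + n)
  | ite_true {e : Expr} {p q : Prog} {s s' : Config} {n : ℕ} :
      e.eval s.mem ≠ 0 → Exec p s s' n → Exec (.ite e p q) s s' (1 + e.cost s.mem + n)
  | ite_false {e : Expr} {p q : Prog} {s s' : Config} {n : ℕ} :
      e.eval s.mem = 0 → Exec q s s' n → Exec (.ite e p q) s s' (1 + e.cost s.mem + n)
  | loop_stop {e : Expr} {p : Prog} {s : Config} :
      e.eval s.mem = 0 → Exec (.loop e p) s s (1 + e.cost s.mem)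
  | loop_step {e : Expr} {p : Prog} {s s' s'' : Config} {m n : ℕ} :
      e.eval s.mem ≠ 0 → Exec p s s' m → Exec (.loop e p) s' s'' n →
        Exec (.loop e p) s s'' (1 + e.cost s.mem + m + n)

/-- A QPT adversary for the selective game: one program that, for every security parameter `s`,
turns the public parameters `input s` into a challenge and an oracle circuit, at a cost polynomial
in `s`. (Intermediate measurements can be deferred to the end, so a circuit of gates and queries
that is measured at the end is no restriction.) The challenge is written before, and independently
of, any interaction with the oracle. -/
structure QPTAdversary (input : ℕ → List ℕ) where
  prog : Prog
  /-- What the program has written at security parameter `s`. -/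
  out : ℕ → Config
  time : Polynomial ℕ
  runs : ∀ s, ∃ n ≤ time.eval s, Exec prog (Config.start (input s)) (out s) n

/-! ### Classical primitives with deterministic evaluation -/

/-- A classical primitive (setup, evaluation, verification) with a deterministic evaluation, on
messages of `msgLen s` bits with tags of `tagLen s` bits. Nothing is assumed about the functions
beyond correctness; there are at least two messages. -/
structure ClassicalPrimitive where
  msgLen : ℕ → ℕ
  tagLen : ℕ → ℕ
  msgLen_pos : ∀ s, 0 < msgLen s
  msgLen_poly : PolyBounded msgLen
  tagLen_poly : PolyBounded tagLen
  Key : ℕ → Type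
  setup : ∀ s, PMF (Key s)
  eval : ∀ s, Key s → (Fin (msgLen s) → Bool) → (Fin (tagLen s) → Bool)
  verify : ∀ s, Key s → (Fin (msgLen s) → Bool) → (Fin (tagLen s) → Bool) → Bool
  correct : ∀ s, ∀ k ∈ (setup s).support, ∀ m, verify s k m (eval s k m) = true

/-- The standard oracle `|m, y⟩ ↦ |m, y ⊕ f m⟩`. -/
def standardOracle {n l : ℕ} (f : (Fin n → Bool) → (Fin l → Bool)) : Op (Fin n ⊕ Fin l) :=
  fun b a =>
    if b = Sum.elim (fun i => a (.inl i)) (fun j => xor (a (.inr j)) (f (fun i => a (.inl i)) j))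
    then 1 else 0

/-- Wires of the query register: `n` message wires, followed by `l` ancilla wires. -/
def queryWires (n l w : ℕ) : Fin n ⊕ Fin l → Fin (n + l + w) :=
  fun i => Fin.castAdd w (finSumFinEquiv i)

/-- The challenge message with ones at the positions in `L`. -/
def challengeMsg (n : ℕ) (L : List ℕ) : Fin n → Bool := fun i => decide (i.val ∈ L)

namespace ClassicalPrimitive

variable (F : ClassicalPrimitive)

/-- The public parameters given to the adversary: the security parameter, the two lengths and the
first `s` binary digits of `μ`. -/
def publicInput (μ : ℕ → ℝ) (s : ℕ) : List ℕ :=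
  [s, F.msgLen s, F.tagLen s, ⌊2 ^ s * μ s⌋₊]

open Classical in
/-- Probability that the selective game ends with output `1`, for the key `k`. The challenge has to
be `μ`-distinguishable from the message register of each query (given the whole run, including the
entanglement with all other registers); otherwise the adversary loses. The tag is obtained by
measuring the ancilla wires at the end of the circuit. -/
def winProbKey (μ : ℝ) (s : ℕ) (k : F.Key s) (c : Config) : ℝ :=
  let e := queryWires (F.msgLen s) (F.tagLen s) (width c.circuit)
  let m := challengeMsg (F.msgLen s) c.challengeBits
  let r := run (applyOn e (standardOracle (F.eval s k))) c.circuit (ket fun _ => false)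
  if ∀ ψ ∈ r.1, Distinguishable μ (reduced (e ∘ Sum.inl) ψ) (pureState (ket m)) then
    ∑ b, if F.verify s k m (b ∘ e ∘ Sum.inr) = true then ‖r.2 b‖ ^ 2 else 0
  else 0

/-- Probability that the selective game ends with output `1`. -/
def winProb (μ : ℝ) (s : ℕ) (c : Config) : ℝ :=
  ∑' k, (F.setup s k).toReal * F.winProbKey μ s k c

end ClassicalPrimitive

/-- The overlap probability for classical primitives in a game with `q` queries. -/
def classicalOverlap (q : ℕ) (μ : ℝ) : ℝ := 1 - μ ^ q

/-! ### Quantum primitives with deterministic (unitary) evaluation -/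

/-- `k` copies of the state `ρ`. -/
def copies {X : Type} (k : ℕ) (ρ : Matrix X X ℂ) : Matrix (Fin k → X) (Fin k → X) ℂ :=
  fun a b => ∏ i, ρ (a i) (b i)

/-- A quantum test algorithm for states with basis `X`: for all numbers of copies a two-outcome
measurement whose probability of acceptance, on copies of two pure states, is a function `acc` of
their fidelity with the three limits that are asked of an equality test. -/
structure QuantumTest (X : Type) [Fintype X] [DecidableEq X] where
  effect : ∀ k₁ k₂ : ℕ, Matrix ((Fin k₁ → X) × (Fin k₂ → X)) ((Fin k₁ → X) × (Fin k₂ → X)) ℂ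
  effect_nonneg : ∀ k₁ k₂, (effect k₁ k₂).PosSemidef
  effect_le_one : ∀ k₁ k₂, (1 - effect k₁ k₂).PosSemidef
  acc : ℕ → ℕ → ℝ → ℝ
  err : ℕ → ℕ → ℝ
  accept_eq : ∀ (k₁ k₂ : ℕ) (φ ψ : X → ℂ), ∑ x, ‖φ x‖ ^ 2 = 1 → ∑ x, ‖ψ x‖ ^ 2 = 1 →
    ((effect k₁ k₂ * (copies k₁ (pureState φ) ⊗ₖ copies k₂ (pureState ψ))).trace).re =
      acc k₁ k₂ (fidelity (pureState φ) (pureState ψ))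
  acc_one : ∀ k₁ k₂, 1 ≤ k₁ → 1 ≤ k₂ →
    Filter.Tendsto (acc k₁ k₂) (nhdsWithin 1 (Set.Iio 1)) (nhds 1)
  acc_many : ∀ x, 0 ≤ x → x ≤ 1 →
    Filter.Tendsto (fun k : ℕ × ℕ => acc k.1 k.2 x) Filter.atTop (nhds x)
  acc_zero : ∀ k₁ k₂, 1 ≤ k₁ → 1 ≤ k₂ →
    Filter.Tendsto (acc k₁ k₂) (nhdsWithin 0 (Set.Ioi 0)) (nhds (err k₁ k₂))

/-- A quantum primitive with deterministic evaluation: the evaluation is a unitary on `dim s`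
qubits that depends on the key, and the verification compares `testCopies s` copies of the forgery
with as many copies of the correct output by a quantum test algorithm. -/
structure QuantumPrimitive where
  dim : ℕ → ℕ
  testCopies : ℕ → ℕ
  dim_pos : ∀ s, 0 < dim s
  testCopies_pos : ∀ s, 0 < testCopies s
  dim_poly : PolyBounded dim
  testCopies_poly : PolyBounded testCopies
  Key : ℕ → Type
  setup : ∀ s, PMF (Key s)
  eval : ∀ s, Key s → Matrix.unitaryGroup (Fin (dim s) → Bool) ℂ
  test : ∀ s, QuantumTest (Fin (dim s) → Bool)

/-- Wires of the query register of a quantum primitive. -/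
def quantumQueryWires (n k w : ℕ) : Fin n → Fin (n + k * n + w) :=
  fun i => Fin.castAdd w (Fin.castAdd (k * n) i)

/-- Wires of the forgery register: `k` blocks of `n` qubits. -/
def forgeryWires (n k w : ℕ) : Fin k × Fin n → Fin (n + k * n + w) :=
  fun i => Fin.castAdd w (Fin.natAdd n (finProdFinEquiv i))

namespace QuantumPrimitive

variable (F : QuantumPrimitive)

/-- The public parameters given to the adversary. -/
def publicInput (μ : ℕ → ℝ) (s : ℕ) : List ℕ :=
  [s, F.dim s, F.testCopies s, ⌊2 ^ s * μ s⌋₊]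

open Classical in
/-- Probability that the selective game ends with output `1`, for the key `k`. The challenge is the
state prepared by the gates that the adversary announced; it has to be `μ`-distinguishable from
each query. The test is applied to the state of the forgery register and to copies of the correct
output. -/
def winProbKey (μ : ℝ) (s : ℕ) (k : F.Key s) (c : Config) : ℝ :=
  let n := F.dim s
  let κ := F.testCopies s
  let U : Op (Fin n) := (F.eval s k : Matrix (Fin n → Bool) (Fin n → Bool) ℂ)
  let e := quantumQueryWires n κ (width c.circuit)
  let φ := prepare n c.challengeGates
  let r := run (applyOn e U) c.circuit (ket fun _ => false)
  let forgery : Matrix (Fin κ → Fin n → Bool) (Fin κ → Fin n → Bool) ℂ :=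
    (reduced (forgeryWires n κ (width c.circuit)) r.2).submatrix
      (fun a p => a p.1 p.2) (fun a p => a p.1 p.2)
  if ∀ ψ ∈ r.1, Distinguishable μ (reduced e ψ) (pureState φ) then
    (((F.test s).effect κ κ * (forgery ⊗ₖ copies κ (pureState (U.mulVec φ)))).trace).re
  else 0

/-- Probability that the selective game ends with output `1`. -/
def winProb (μ : ℝ) (s : ℕ) (c : Config) : ℝ :=
  ∑' k, (F.setup s k).toReal * F.winProbKey μ s k c

/-- The overlap probability for quantum primitives: the probability that the test accepts the output
on the query of largest overlap `1 - μ` with the challenge in place of the correct output. (The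
evaluation is unitary, so the outputs have the same fidelity as the inputs.) -/
def overlap (μ : ℝ) (s : ℕ) : ℝ :=
  (F.test s).acc (F.testCopies s) (F.testCopies s) (1 - μ)

end QuantumPrimitive

end

end QForge

/-! The rule of the game bounds the overlap of each query with the challenge, not what the adversary
learns from all queries together. Take `N = 2 ^ r` branches of equal amplitude, told apart by a
one-hot register, and let the challenge be the all-zero string. In query `i` branch `i` alone asks
for the challenge, while every other branch asks for the string `e` whose only one is its first bit.
The overlap of such a query with the challenge is at most `1 / N`, which is allowed as soon as `N (1
- μ) ≥ 1`. After `N` queries every branch has received the correct answer once. It remains to make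
the output register the same in all branches; the forgery is then exact and the adversary wins with
probability one.

For a classical primitive the answers add up modulo two in the tag register, to `f(0)` plus `N - 1`
times `f(e)`. One more query at `e` in all branches makes the number of unwanted terms even, so that
they cancel (`triple_classicalCircuit`). The adversary makes `N + 1` queries, hence its advantage is
`μ ^ (N + 1)`. With `N (1 - μ) ≤ 4` and `μ ≥ 1/4` this is at least `exp (-20)` (`exp_neg_le_pow`).

For a quantum primitive branch `i` swaps its answer into a forgery block, and the query register is
then exchanged with a fresh zero block in all branches. This is repeated for each of the `κ` copies.
In the end every branch holds `κ` copies of `U|0⟩` in the forgery register, which therefore factors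
out of the global state (`reduced_forgeryWires`). A test accepts equal states with certainty, by
continuity (`QuantumTest.acc_at_one`), so the advantage is exactly `1 - P_ov`.

The circuits also have to be written in polynomial time. The program finds `N` by doubling, from the
digits of `μ`, with a polynomial cap (`searchExp_spec`). Since it never stores a product, each step
lengthens the stored numbers by a bounded number of digits, so polynomially many steps have
polynomial cost (`Run.exec`). -/

namespace QForge

open scoped MatrixOrder ComplexOrder Kronecker

noncomputable section

set_option linter.unusedSectionVars false

/-! ### Fidelity with pure states -/

section Fidelity

variable {X : Type} [Fintype X]

lemma star_dotProduct_self_eq (w : X → ℂ) : star w ⬝ᵥ w = ((∑ x, ‖w x‖ ^ 2 : ℝ) : ℂ) := by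
  simp only [dotProduct, Pi.star_apply, RCLike.star_def, Complex.conj_mul']
  push_cast
  rfl

lemma posSemidef_pureState (w : X → ℂ) : (pureState w).PosSemidef :=
  Matrix.posSemidef_vecMulVec_self_star w

lemma trace_pureState (w : X → ℂ) : (pureState w).trace = ((∑ x, ‖w x‖ ^ 2 : ℝ) : ℂ) := by
  rw [pureState, Matrix.trace_vecMulVec, dotProduct_comm, star_dotProduct_self_eq]

lemma pureState_mul_self (w : X → ℂ) :
    pureState w * pureState w = ((∑ x, ‖w x‖ ^ 2 : ℝ) : ℂ) • pureState w := by
  rw [pureState, Matrix.vecMulVec_mul_vecMulVec, star_dotProduct_self_eq, Matrix.vecMulVec_smul]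

variable [DecidableEq X]

/-- Since `|w⟩⟨w|` squares to `‖w‖² |w⟩⟨w|`, division by `‖w‖` gives the positive root. For `w = 0`
the convention `0⁻¹ = 0` gives the right value. -/
lemma sqrt_pureState (w : X → ℂ) :
    CFC.sqrt (pureState w) = ((Real.sqrt (∑ x, ‖w x‖ ^ 2))⁻¹ : ℝ) • pureState w := by
  set a := Real.sqrt (∑ x, ‖w x‖ ^ 2) with ha
  have hs : (0 : ℝ) ≤ ∑ x, ‖w x‖ ^ 2 := by positivity
  have hsq : ∑ x, ‖w x‖ ^ 2 = a * a := by rw [ha, Real.mul_self_sqrt hs]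
  apply CFC.sqrt_unique
  · rw [smul_mul_smul_comm, pureState_mul_self, hsq]
    by_cases h0 : a = 0
    · have : w = 0 := by
        have h1 : ∑ x, ‖w x‖ ^ 2 = 0 := by rw [hsq, h0, mul_zero]
        rw [Finset.sum_eq_zero_iff_of_nonneg (fun _ _ => by positivity)] at h1
        ext x
        simpa using h1 x (Finset.mem_univ x)
      simp [this, pureState]
    · rw [← Complex.coe_smul, smul_smul, ← Complex.ofReal_mul]
      have : a⁻¹ * a⁻¹ * (a * a) = 1 := by field_simp
      rw [this]; simp
  · rw [Matrix.nonneg_iff_posSemidef]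
    exact (posSemidef_pureState w).smul (by positivity)

/-- Conjugating `|v⟩⟨v|` by `√ρ` gives the rank-one operator of `√ρ v`, whose root has trace `‖√ρ
v‖`. All fidelities of the games thus become quadratic forms. -/
lemma fidelity_pureState {ρ : Matrix X X ℂ} (hρ : ρ.PosSemidef) (v : X → ℂ) :
    fidelity ρ (pureState v) = (star v ⬝ᵥ ρ.mulVec v).re := by
  have hR0 : 0 ≤ CFC.sqrt ρ := CFC.sqrt_nonneg ρ
  have hRR : CFC.sqrt ρ * CFC.sqrt ρ = ρ :=
    CFC.sqrt_mul_sqrt_self ρ (Matrix.nonneg_iff_posSemidef.2 hρ)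
  set R := CFC.sqrt ρ with hR
  have hRh : R.conjTranspose = R := (Matrix.nonneg_iff_posSemidef.1 hR0).1
  have h1 : R * pureState v * R = pureState (R.mulVec v) := by
    rw [pureState, pureState, Matrix.mul_vecMulVec, Matrix.vecMulVec_mul, Matrix.star_mulVec, hRh]
  have h2 : star v ⬝ᵥ ρ.mulVec v = star (R.mulVec v) ⬝ᵥ R.mulVec v := by
    rw [Matrix.star_mulVec, hRh, ← Matrix.dotProduct_mulVec, Matrix.mulVec_mulVec, hRR]
  rw [fidelity, ← hR, h1, sqrt_pureState, Matrix.trace_smul, trace_pureState, h2,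
    star_dotProduct_self_eq]
  set a := ∑ x, ‖R.mulVec v x‖ ^ 2
  have ha : 0 ≤ a := by positivity
  rw [Complex.real_smul, ← Complex.ofReal_mul, Complex.ofReal_re, Complex.ofReal_re, mul_pow,
    inv_pow, Real.sq_sqrt ha]
  by_cases h0 : a = 0
  · simp [h0]
  · field_simp

lemma fidelity_nonneg (ρ σ : Matrix X X ℂ) : 0 ≤ fidelity ρ σ := sq_nonneg _

lemma fidelity_pureState_pureState (φ v : X → ℂ) :
    fidelity (pureState φ) (pureState v) = ‖star v ⬝ᵥ φ‖ ^ 2 := by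
  rw [fidelity_pureState (posSemidef_pureState φ), pureState, Matrix.vecMulVec_mulVec]
  have : star φ ⬝ᵥ v = star (star v ⬝ᵥ φ) := by
    rw [Matrix.star_dotProduct, dotProduct_comm]
  rw [op_smul_eq_smul, dotProduct_smul, smul_eq_mul, this, RCLike.star_def, Complex.conj_mul']
  norm_cast

end Fidelity

/-! ### Tests on equal states -/

section Test

variable {X : Type} [Fintype X] [DecidableEq X]

lemma sum_norm_sq_rotation {a b : X} (hab : a ≠ b) (t : ℝ) :
    ∑ x, ‖(if x = a then (Real.cos t : ℂ) else if x = b then (Real.sin t : ℂ) else 0)‖ ^ 2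
      = 1 := by
  have : ∀ x, ‖(if x = a then (Real.cos t : ℂ) else if x = b then (Real.sin t : ℂ) else 0)‖ ^ 2
      = (if x = a then Real.cos t ^ 2 else 0) + (if x = b then Real.sin t ^ 2 else 0) := by
    intro x
    by_cases h1 : x = a
    · subst h1; simp [hab, -Complex.ofReal_cos]
    · by_cases h2 : x = b
      · subst h2; simp [h1, -Complex.ofReal_sin]
      · simp [h1, h2]
  simp only [this, Finset.sum_add_distrib, Finset.sum_ite_eq', Finset.mem_univ, if_true]
  exact Real.cos_sq_add_sin_sq t

/-- The acceptance probability of a test on equal pure states is one. -/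
lemma QuantumTest.acc_at_one [Nontrivial X] (T : QuantumTest X) {k₁ k₂ : ℕ} (h₁ : 1 ≤ k₁)
    (h₂ : 1 ≤ k₂) : T.acc k₁ k₂ 1 = 1 := by
  obtain ⟨a, b, hab⟩ := exists_pair_ne X
  -- A path of unit vectors whose fidelity with its start is `cos² t`. The acceptance probability is
  -- a polynomial in the amplitudes, so it is continuous at `t = 0`, where its value is the one
  -- sought.
  let w : ℝ → X → ℂ := fun t x =>
    if x = a then (Real.cos t : ℂ) else if x = b then (Real.sin t : ℂ) else 0
  have hw : ∀ t, ∑ x, ‖w t x‖ ^ 2 = 1 := sum_norm_sq_rotation hab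
  have hfid : ∀ t, fidelity (pureState (w 0)) (pureState (w t)) = Real.cos t ^ 2 := by
    intro t
    rw [fidelity_pureState_pureState]
    have : star (w t) ⬝ᵥ w 0 = (Real.cos t : ℂ) := by
      rw [dotProduct, Finset.sum_eq_single a]
      · simp [w, -Complex.ofReal_cos]
      · intro x _ hx
        simp [w, hx]
      · simp
    rw [this, Complex.norm_real, Real.norm_eq_abs, sq_abs]
  let p : ℝ → ℝ := fun t =>
    ((T.effect k₁ k₂ * (copies k₁ (pureState (w 0)) ⊗ₖ copies k₂ (pureState (w t)))).trace).re
  have hp : ∀ t, p t = T.acc k₁ k₂ (Real.cos t ^ 2) := fun t => by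
    rw [← hfid]; exact T.accept_eq k₁ k₂ _ _ (hw 0) (hw t)
  have hwc : ∀ x, Continuous fun t => w t x := by
    intro x
    by_cases h1 : x = a
    · simp only [w, h1, if_true]; fun_prop
    · by_cases h2 : x = b
      · simp only [w, if_neg h1, if_pos h2]; fun_prop
      · simp only [w, if_neg h1, if_neg h2]; fun_prop
  have hcont : Continuous p := by
    simp only [p, Matrix.trace, Matrix.diag, Matrix.mul_apply, Matrix.kroneckerMap_apply, copies,
      pureState, Matrix.vecMulVec_apply, Pi.star_apply]
    fun_prop
  -- `acc_one` speaks only of fidelities strictly below one.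
  have hsmall : ∀ᶠ t in nhdsWithin (0 : ℝ) (Set.Ioi 0), Real.cos t ^ 2 ∈ Set.Iio (1 : ℝ) := by
    have : Set.Ioo (0 : ℝ) 1 ∈ nhdsWithin (0 : ℝ) (Set.Ioi 0) :=
      Ioo_mem_nhdsGT one_pos
    filter_upwards [this] with t ht
    have hs : 0 < Real.sin t := Real.sin_pos_of_pos_of_lt_pi ht.1
      (ht.2.trans (by linarith [Real.pi_gt_three]))
    have := Real.cos_sq_add_sin_sq t
    simp only [Set.mem_Iio]
    nlinarith
  have hlim1 : Filter.Tendsto (fun t : ℝ => Real.cos t ^ 2) (nhdsWithin 0 (Set.Ioi 0))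
      (nhdsWithin 1 (Set.Iio 1)) := by
    refine tendsto_nhdsWithin_iff.2 ⟨?_, hsmall⟩
    have : Continuous fun t : ℝ => Real.cos t ^ 2 := by fun_prop
    have h := this.tendsto 0
    simp only [Real.cos_zero, one_pow] at h
    exact h.mono_left nhdsWithin_le_nhds
  have hlim2 := (T.acc_one k₁ k₂ h₁ h₂).comp hlim1
  have hlim3 : Filter.Tendsto p (nhdsWithin 0 (Set.Ioi 0)) (nhds (p 0)) :=
    (hcont.tendsto 0).mono_left nhdsWithin_le_nhds
  have : p = T.acc k₁ k₂ ∘ fun t => Real.cos t ^ 2 := funext hp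
  rw [← this] at hlim2
  have h := tendsto_nhds_unique hlim3 hlim2
  rw [hp] at h
  simpa using h

/-- A test accepts equal pure states. -/
lemma QuantumTest.accept_self [Nontrivial X] (T : QuantumTest X) {k₁ k₂ : ℕ} (h₁ : 1 ≤ k₁)
    (h₂ : 1 ≤ k₂) {v : X → ℂ} (hv : ∑ x, ‖v x‖ ^ 2 = 1) :
    ((T.effect k₁ k₂ * (copies k₁ (pureState v) ⊗ₖ copies k₂ (pureState v))).trace).re = 1 := by
  rw [T.accept_eq k₁ k₂ v v hv hv, fidelity_pureState_pureState, star_dotProduct_self_eq, hv]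
  simpa using T.acc_at_one h₁ h₂

end Test

/-! ### Bits -/

section Bits

variable {W : ℕ}

lemma getBit_of_lt (b : Fin W → Bool) {i : ℕ} (hi : i < W) : getBit b i = b ⟨i, hi⟩ := by
  simp [getBit, hi]

@[simp] lemma getBit_val (b : Fin W → Bool) (i : Fin W) : getBit b i = b i := by
  simp [getBit]

lemma getBit_ext {b b' : Fin W → Bool} (h : ∀ i < W, getBit b i = getBit b' i) : b = b' := by
  ext i
  simpa using h i i.2

@[simp] lemma getBit_false (i : ℕ) : getBit (fun _ : Fin W => false) i = false := by
  simp [getBit]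

lemma getBit_setBit (b : Fin W → Bool) {i : ℕ} (hi : i < W) (v : Bool) (j : ℕ) :
    getBit (setBit b i v) j = if j = i then v else getBit b j := by
  by_cases hj : j < W
  · simp [getBit, hj, setBit]
  · have : j ≠ i := by omega
    simp [getBit, hj, this]

lemma setBit_setBit (b : Fin W → Bool) (i : ℕ) (v v' : Bool) :
    setBit (setBit b i v) i v' = setBit b i v' := by
  ext j
  simp only [setBit]
  split_ifs <;> rfl

lemma setBit_getBit (b : Fin W → Bool) (i : ℕ) : setBit b i (getBit b i) = b := by
  ext j
  simp only [setBit]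
  split_ifs with h
  · subst h; simp
  · rfl

end Bits

/-! ### Squared norms -/

/-- The squared norm of a vector of amplitudes. -/
def normSq {ι : Type} [Fintype ι] [DecidableEq ι] (ψ : Vec ι) : ℝ := ∑ b, ‖ψ b‖ ^ 2

lemma sum_norm_sq_ket {ι : Type} [Fintype ι] [DecidableEq ι] (b : ι → Bool) :
    ∑ a, ‖ket b a‖ ^ 2 = 1 := by
  rw [Finset.sum_eq_single b]
  · simp [ket]
  · intro a _ h
    simp [ket, h]
  · simp

lemma normSq_ket {W : ℕ} (b : Fin W → Bool) : normSq (ket b) = 1 := sum_norm_sq_ket b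

lemma normSq_comp {ι : Type} [Fintype ι] [DecidableEq ι] (ψ : Vec ι) {p : (ι → Bool) → (ι → Bool)}
    (hp : Function.Involutive p) : normSq (fun b => ψ (p b)) = normSq ψ := by
  simp only [normSq]
  exact Equiv.sum_comp hp.toPerm (fun b => ‖ψ b‖ ^ 2)

/-- Precomposition moves a basis state by the inverse of `p`; for an involution this is `p` itself,
and no inverse has to be tracked. -/
lemma ket_comp {ι : Type} [Fintype ι] (a : ι → Bool) {p : (ι → Bool) → (ι → Bool)}
    (hp : Function.Involutive p) : (fun b => ket a (p b)) = ket (p a) := by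
  ext b
  simp only [ket, hp.eq_iff]

/-! ### Gates -/

namespace Gate

variable {W : ℕ}

/-- The action on basis states of the gates that permute them. -/
def act : Gate ℕ → (Fin W → Bool) → (Fin W → Bool)
  | .x i, b => setBit b i (!getBit b i)
  | .cnot i j, b => if i = j then b else setBit b j (xor (getBit b j) (getBit b i))
  | .ccx i j k, b =>
      if i = k ∨ j = k then b else setBit b k (xor (getBit b k) (getBit b i && getBit b j))
  | .h _, b => b
  | .t _, b => b

lemma apply_x (i : ℕ) (ψ : Vec (Fin W)) : (x i).apply ψ = fun b => ψ (act (x i) b) := rfl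

lemma apply_cnot (i j : ℕ) (ψ : Vec (Fin W)) :
    (cnot i j).apply ψ = fun b => ψ (act (cnot i j) b) := by
  ext b
  simp only [Gate.apply, act, apply_ite ψ]

lemma apply_ccx (i j k : ℕ) (ψ : Vec (Fin W)) :
    (ccx i j k).apply ψ = fun b => ψ (act (ccx i j k) b) := by
  ext b
  simp only [Gate.apply, act, apply_ite ψ]

lemma getBit_act_x {i : ℕ} (hi : i < W) (b : Fin W → Bool) (w : ℕ) :
    getBit (act (x i) b) w = xor (getBit b w) (decide (w = i)) := by
  simp only [act, getBit_setBit b hi]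
  by_cases h : w = i <;> simp [h]

lemma getBit_act_cnot {i j : ℕ} (hj : j < W) (hij : i ≠ j) (b : Fin W → Bool) (w : ℕ) :
    getBit (act (cnot i j) b) w = xor (getBit b w) (decide (w = j) && getBit b i) := by
  simp only [act, if_neg hij, getBit_setBit b hj]
  by_cases h : w = j <;> simp [h]

lemma getBit_act_ccx {i j k : ℕ} (hk : k < W) (hik : i ≠ k) (hjk : j ≠ k) (b : Fin W → Bool)
    (w : ℕ) : getBit (act (ccx i j k) b) w
      = xor (getBit b w) (decide (w = k) && (getBit b i && getBit b j)) := by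
  simp only [act, hik, hjk, or_self, if_false, getBit_setBit b hk]
  by_cases h : w = k <;> simp [h]

lemma setBit_of_le (b : Fin W → Bool) {i : ℕ} (hi : W ≤ i) (v : Bool) : setBit b i v = b := by
  ext j
  have : j.val ≠ i := by omega
  simp [setBit, this]

/-- A gate leaves its controls unchanged, so its second application undoes the first. In the
degenerate cases it is the identity. -/
lemma act_involutive (g : Gate ℕ) : Function.Involutive (act g : (Fin W → Bool) → _) := by
  intro b
  cases g with
  | x i =>
    by_cases hi : i < W
    · refine getBit_ext fun w _ => ?_
      simp [getBit_act_x hi]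
    · simp [act, setBit_of_le _ (not_lt.1 hi)]
  | h i => rfl
  | t i => rfl
  | cnot i j =>
    by_cases hij : i = j
    · simp [act, hij]
    by_cases hj : j < W
    · refine getBit_ext fun w _ => ?_
      simp [getBit_act_cnot hj hij, hij]
    · simp [act, setBit_of_le _ (not_lt.1 hj)]
  | ccx i j k =>
    by_cases hijk : i = k ∨ j = k
    · simp [act, hijk]
    obtain ⟨hik, hjk⟩ := not_or.1 hijk
    by_cases hk : k < W
    · refine getBit_ext fun w _ => ?_
      simp [getBit_act_ccx hk hik hjk, hik, hjk]
    · simp [act, setBit_of_le _ (not_lt.1 hk)]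

lemma apply_add (g : Gate ℕ) (ψ φ : Vec (Fin W)) : g.apply (ψ + φ) = g.apply ψ + g.apply φ := by
  ext b
  cases g <;> simp only [Gate.apply, Pi.add_apply]
  all_goals split_ifs <;> ring

lemma apply_smul (g : Gate ℕ) (c : ℂ) (ψ : Vec (Fin W)) : g.apply (c • ψ) = c • g.apply ψ := by
  ext b
  cases g <;> simp only [Gate.apply, Pi.smul_apply, smul_eq_mul]
  all_goals split_ifs <;> ring

/-- A gate as a linear map. -/
def lin (g : Gate ℕ) : Vec (Fin W) →ₗ[ℂ] Vec (Fin W) where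
  toFun := g.apply
  map_add' := apply_add g
  map_smul' := apply_smul g

lemma lin_apply (g : Gate ℕ) (ψ : Vec (Fin W)) : g.lin ψ = g.apply ψ := rfl

lemma normSq_hadamard (i : ℕ) (ψ : Vec (Fin W)) : normSq ((h i).apply ψ) = normSq ψ := by
  by_cases hi : i < W
  swap
  · simp [Gate.apply, hi]
  have hflip : Function.Involutive (act (x i) : (Fin W → Bool) → _) := act_involutive (x i)
  -- Basis states that differ in bit `i` are paired. The parallelogram law preserves the weight of
  -- each pair, and the sum over `b` counts each pair twice.
  have key : ∀ b : Fin W → Bool,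
      ‖(h i).apply ψ b‖ ^ 2 + ‖(h i).apply ψ (act (x i) b)‖ ^ 2
        = ‖ψ b‖ ^ 2 + ‖ψ (act (x i) b)‖ ^ 2 := by
    intro b
    have hpar : ∀ u v : ℂ, ‖(u + v) / (Real.sqrt 2 : ℂ)‖ ^ 2 + ‖(u - v) / (Real.sqrt 2 : ℂ)‖ ^ 2
        = ‖u‖ ^ 2 + ‖v‖ ^ 2 := by
      intro u v
      have h := parallelogram_law_with_norm ℝ u v
      have h2 : Real.sqrt 2 ^ 2 = 2 := Real.sq_sqrt (by norm_num)
      simp only [norm_div, div_pow, Complex.norm_real, Real.norm_eq_abs, sq_abs, h2]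
      nlinarith [h]
    have hb := setBit_getBit b i
    have hg : getBit (setBit b i (!getBit b i)) i = !getBit b i := by simp [getBit_setBit b hi]
    simp only [Gate.apply, hi, if_true, act, hg, setBit_setBit]
    cases hv : getBit b i
    · rw [hv] at hb
      rw [hb]
      simpa [sub_eq_add_neg] using hpar (ψ b) (ψ (setBit b i true))
    · rw [hv] at hb
      rw [hb]
      have := hpar (ψ (setBit b i false)) (ψ b)
      simp only [Bool.not_true, if_true, Bool.false_eq_true, if_false, one_mul, neg_mul,
        ← sub_eq_add_neg]
      linarith
  have hsum := Finset.sum_congr (s₁ := Finset.univ) rfl fun b _ => key b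
  rw [Finset.sum_add_distrib, Finset.sum_add_distrib] at hsum
  have h1 := normSq_comp ψ hflip
  have h2 := normSq_comp ((h i).apply ψ) hflip
  simp only [normSq] at h1 h2 ⊢
  linarith

lemma normSq_apply (g : Gate ℕ) (ψ : Vec (Fin W)) : normSq (g.apply ψ) = normSq ψ := by
  cases g with
  | x i => rw [apply_x, normSq_comp ψ (act_involutive _)]
  | h i => exact normSq_hadamard i ψ
  | t i =>
    simp only [normSq, Gate.apply, norm_mul, mul_pow]
    refine Finset.sum_congr rfl fun b _ => ?_
    split_ifs
    · have : (Real.pi / 4 * Complex.I : ℂ) = ((Real.pi / 4 : ℝ) : ℂ) * Complex.I := by push_cast; rfl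
      rw [this, Complex.norm_exp_ofReal_mul_I]
      ring
    · simp
  | cnot i j => rw [apply_cnot, normSq_comp ψ (act_involutive _)]
  | ccx i j k => rw [apply_ccx, normSq_comp ψ (act_involutive _)]

end Gate

/-! ### Operators on some of the qubits, and reduced states -/

section Subsystem

variable {ι κ : Type} [Fintype ι] [DecidableEq ι] [Fintype κ] [DecidableEq κ] {e : ι → κ}

lemma extend_comp_self {b b' : κ → Bool} (h : ∀ i, i ∉ Set.range e → b i = b' i)
    (he : Function.Injective e) : Function.extend e (b' ∘ e) b = b' := by
  ext i
  by_cases hi : ∃ u, e u = i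
  · obtain ⟨u, rfl⟩ := hi
    simp [he.extend_apply]
  · rw [Function.extend_apply' _ _ _ hi]
    exact h i hi

lemma extend_extend (he : Function.Injective e) (x y : ι → Bool) (b : κ → Bool) :
    Function.extend e x (Function.extend e y b) = Function.extend e x b := by
  ext i
  by_cases hi : ∃ u, e u = i
  · obtain ⟨u, rfl⟩ := hi
    simp [he.extend_apply]
  · simp [Function.extend_apply' _ _ _ hi]

lemma extend_eq_self {b : κ → Bool} {x : ι → Bool} (he : Function.Injective e) (h : b ∘ e = x) :
    Function.extend e x b = b := by
  subst h
  exact extend_comp_self (fun _ _ => rfl) he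

/-- The values on the unselected qubits are represented by the full string `c` with the selected
bits cleared, so that no index type for the complement is needed. -/
lemma sum_extend {M : Type} [AddCommMonoid M] (he : Function.Injective e) (f : (κ → Bool) → M) :
    ∑ b, f b = ∑ c : κ → Bool, if c ∘ e = (fun _ => false) then
      ∑ x : ι → Bool, f (Function.extend e x c) else 0 := by
  rw [← Finset.sum_filter, ← Finset.sum_product']
  refine Finset.sum_nbij' (fun b => (Function.extend e (fun _ => false) b, b ∘ e))
    (fun p => Function.extend e p.2 p.1) ?_ ?_ ?_ ?_ ?_
  · intro b _
    simp [Function.extend_comp he]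
  · simp
  · intro b _
    simp only [extend_extend he]
    exact extend_eq_self he rfl
  · rintro ⟨c, x⟩ hc
    simp only [Finset.mem_product, Finset.mem_filter, Finset.mem_univ, true_and, and_true] at hc
    simp only [extend_extend he, Function.extend_comp he, Prod.mk.injEq, and_true]
    exact extend_eq_self he hc
  · intro b _
    simp only [extend_extend he]
    rw [extend_eq_self he rfl]

lemma applyOn_eq (he : Function.Injective e) (U : Op ι) (ψ : Vec κ) (b : κ → Bool) :
    applyOn e U ψ b = ∑ x : ι → Bool, U (b ∘ e) x * ψ (Function.extend e x b) := by
  classical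
  trans ∑ b' : κ → Bool, if ∀ i, i ∉ Set.range e → b i = b' i then U (b ∘ e) (b' ∘ e) * ψ b' else 0
  · rw [applyOn]
    congr!
  refine (Finset.sum_filter _ _).symm.trans ?_
  refine Finset.sum_nbij' (fun b' => b' ∘ e) (fun x => Function.extend e x b) ?_ ?_ ?_ ?_ ?_
  · simp
  · intro x _
    simp only [Finset.mem_filter, Finset.mem_univ, true_and]
    intro i hi
    rw [Function.extend_apply' _ _ _ hi]
  · intro b' hb'
    exact extend_comp_self (by simpa using hb') he
  · intro x _
    exact Function.extend_comp he _ _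
  · intro b' hb'
    simp only [Finset.mem_filter, Finset.mem_univ, true_and] at hb'
    rw [extend_comp_self hb' he]

lemma reduced_eq (he : Function.Injective e) (ψ : Vec κ) (x y : ι → Bool) :
    reduced e ψ x y = ∑ c : κ → Bool, if c ∘ e = (fun _ => false) then
      ψ (Function.extend e x c) * star (ψ (Function.extend e y c)) else 0 := by
  classical
  trans ∑ b : κ → Bool, ∑ b' : κ → Bool,
    if b ∘ e = x ∧ b' ∘ e = y ∧ ∀ i, i ∉ Set.range e → b i = b' i then ψ b * star (ψ b') else 0
  · rw [reduced]
    congr!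
  rw [← Finset.sum_product', ← Finset.sum_filter, ← Finset.sum_filter]
  refine Finset.sum_nbij' (fun p => Function.extend e (fun _ => false) p.1)
    (fun c => (Function.extend e x c, Function.extend e y c)) ?_ ?_ ?_ ?_ ?_
  · intro p _
    simp [Function.extend_comp he]
  · intro c _
    simp only [Finset.mem_filter, Finset.mem_product, Finset.mem_univ, true_and,
      Function.extend_comp he]
    intro i hi
    rw [Function.extend_apply' _ _ _ hi, Function.extend_apply' _ _ _ hi]
  · rintro ⟨b, b'⟩ hb
    simp only [Finset.mem_filter, Finset.mem_product, Finset.mem_univ, true_and] at hb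
    obtain ⟨rfl, rfl, h⟩ := hb
    simp only [extend_extend he, Prod.mk.injEq]
    exact ⟨extend_eq_self he rfl, extend_comp_self h he⟩
  · intro c hc
    simp only [Finset.mem_filter, Finset.mem_univ, true_and] at hc
    simp only [extend_extend he]
    exact extend_eq_self he hc
  · rintro ⟨b, b'⟩ hb
    simp only [Finset.mem_filter, Finset.mem_product, Finset.mem_univ, true_and] at hb
    obtain ⟨rfl, rfl, h⟩ := hb
    simp only [extend_extend he]
    rw [extend_eq_self he rfl, extend_comp_self h he]

lemma posSemidef_reduced (he : Function.Injective e) (ψ : Vec κ) : (reduced e ψ).PosSemidef := by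
  -- The amplitudes as a matrix between subsystem and environment; the partial trace is `A A*`.
  let A : Matrix (ι → Bool) (κ → Bool) ℂ := fun x c =>
    if c ∘ e = (fun _ => false) then ψ (Function.extend e x c) else 0
  have : reduced e ψ = A * A.conjTranspose := by
    ext x y
    rw [reduced_eq he, Matrix.mul_apply]
    refine Finset.sum_congr rfl fun c _ => ?_
    change _ = A x c * star (A y c)
    simp only [A]
    split_ifs <;> simp
  rw [this]
  exact Matrix.posSemidef_self_mul_conjTranspose A

lemma trace_reduced (he : Function.Injective e) (ψ : Vec κ) :
    (reduced e ψ).trace = ((normSq ψ : ℝ) : ℂ) := by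
  rw [normSq, sum_extend he]
  simp only [Matrix.trace, Matrix.diag, reduced_eq he, RCLike.star_def, Complex.mul_conj']
  rw [Finset.sum_comm]
  push_cast
  refine Finset.sum_congr rfl fun c _ => ?_
  split_ifs <;> simp

/-- The fidelity of a reduced state with a basis state is the probability of that basis state. -/
lemma fidelity_reduced_ket (he : Function.Injective e) (ψ : Vec κ) :
    fidelity (reduced e ψ) (pureState (ket fun _ => false))
      = ∑ b : κ → Bool, if b ∘ e = (fun _ => false) then ‖ψ b‖ ^ 2 else 0 := by
  rw [fidelity_pureState (posSemidef_reduced he ψ)]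
  have h1 : star (ket (fun _ : ι => false)) ⬝ᵥ (reduced e ψ).mulVec (ket fun _ => false)
      = reduced e ψ (fun _ => false) (fun _ => false) := by
    simp [dotProduct, Matrix.mulVec, ket]
  rw [h1, reduced_eq he, ← Complex.ofReal_re (∑ b : κ → Bool, _)]
  congr 1
  push_cast
  refine Finset.sum_congr rfl fun c _ => ?_
  split_ifs with h
  · rw [extend_eq_self he h, RCLike.star_def, Complex.mul_conj']
    norm_cast
  · simp

/-- The reduced state of a factor in a pure state. -/
lemma reduced_of_factor (he : Function.Injective e) {ψ : Vec κ} (hψ : normSq ψ = 1)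
    {Φ : Vec ι} (hΦ : normSq Φ = 1) {G : Vec κ}
    (hG : ∀ x b, G (Function.extend e x b) = G b) (h : ∀ b, ψ b = Φ (b ∘ e) * G b) :
    reduced e ψ = pureState Φ := by
  -- The squared norm of the other factor. It is not computed: comparing traces forces it to be one.
  set T : ℂ := ∑ c : κ → Bool, if c ∘ e = (fun _ => false) then G c * star (G c) else 0 with hT
  have h1 : reduced e ψ = T • pureState Φ := by
    ext x y
    rw [reduced_eq he, Matrix.smul_apply, pureState, Matrix.vecMulVec_apply, hT, smul_eq_mul,
      Finset.sum_mul]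
    refine Finset.sum_congr rfl fun c _ => ?_
    split_ifs
    · rw [h, h, hG, hG, Function.extend_comp he, Function.extend_comp he, star_mul, Pi.star_apply]
      ring
    · simp
  have h2 := trace_reduced he ψ
  rw [h1, Matrix.trace_smul, trace_pureState, hψ] at h2
  rw [normSq] at hΦ
  rw [hΦ] at h2
  have h3 : T = 1 := by simpa using h2
  rw [h1, h3, one_smul]

lemma sum_norm_sq_mulVec {X : Type} [Fintype X] [DecidableEq X] (U : Matrix.unitaryGroup X ℂ)
    (v : X → ℂ) : ∑ x, ‖(U : Matrix X X ℂ).mulVec v x‖ ^ 2 = ∑ x, ‖v x‖ ^ 2 := by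
  have h : star ((U : Matrix X X ℂ).mulVec v) ⬝ᵥ (U : Matrix X X ℂ).mulVec v = star v ⬝ᵥ v := by
    rw [Matrix.star_mulVec, ← Matrix.dotProduct_mulVec, Matrix.mulVec_mulVec,
      ← Matrix.star_eq_conjTranspose, Matrix.UnitaryGroup.star_mul_self, Matrix.one_mulVec]
  rw [star_dotProduct_self_eq, star_dotProduct_self_eq] at h
  exact_mod_cast h

/-- For fixed values of the other qubits the operator acts as `U`, which preserves the norm of that
slice. -/
lemma normSq_applyOn (he : Function.Injective e) (U : Matrix.unitaryGroup (ι → Bool) ℂ)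
    (ψ : Vec κ) : normSq (applyOn e (U : Op ι) ψ) = normSq ψ := by
  rw [normSq, normSq, sum_extend he, sum_extend he (fun b => ‖ψ b‖ ^ 2)]
  refine Finset.sum_congr rfl fun c _ => ?_
  split_ifs
  · rw [← sum_norm_sq_mulVec U (fun x => ψ (Function.extend e x c))]
    refine Finset.sum_congr rfl fun x _ => ?_
    rw [applyOn_eq he]
    simp only [Function.extend_comp he, extend_extend he, Matrix.mulVec, dotProduct]
  · rfl

lemma applyOn_add (U : Op ι) (ψ φ : Vec κ) :
    applyOn e U (ψ + φ) = applyOn e U ψ + applyOn e U φ := by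
  classical
  ext b
  simp only [applyOn, Pi.add_apply, ← Finset.sum_add_distrib]
  refine Finset.sum_congr rfl fun b' _ => ?_
  split_ifs <;> ring

lemma applyOn_smul (U : Op ι) (c : ℂ) (ψ : Vec κ) :
    applyOn e U (c • ψ) = c • applyOn e U ψ := by
  classical
  ext b
  simp only [applyOn, Pi.smul_apply, smul_eq_mul, Finset.mul_sum]
  refine Finset.sum_congr rfl fun b' _ => ?_
  split_ifs <;> ring

/-- An operator on some of the qubits as a linear map on all of them. -/
def applyOnLin (e : ι → κ) (U : Op ι) : Vec κ →ₗ[ℂ] Vec κ where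
  toFun := applyOn e U
  map_add' := applyOn_add U
  map_smul' := applyOn_smul U

end Subsystem

/-! ### Runs of circuits -/

section Run

variable {W : ℕ}

lemma run_append (O : Vec (Fin W) → Vec (Fin W)) (c c' : List Instr) (ψ : Vec (Fin W)) :
    run O (c ++ c') ψ
      = ((run O c ψ).1 ++ (run O c' (run O c ψ).2).1, (run O c' (run O c ψ).2).2) := by
  induction c generalizing ψ with
  | nil => rfl
  | cons a c ih => cases a <;> simp [run, ih]

lemma normSq_run {O : Vec (Fin W) → Vec (Fin W)} (hO : ∀ ψ, normSq (O ψ) = normSq ψ)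
    (c : List Instr) (ψ : Vec (Fin W)) : normSq (run O c ψ).2 = normSq ψ := by
  induction c generalizing ψ with
  | nil => rfl
  | cons a c ih => cases a <;> simp [run, ih, hO, Gate.normSq_apply]

/-- From states with `P` the circuit leads to states with `R`, with all query states in `Q`. -/
def Triple (O : Vec (Fin W) → Vec (Fin W)) (Q P : Vec (Fin W) → Prop) (c : List Instr)
    (R : Vec (Fin W) → Prop) : Prop :=
  ∀ ψ, P ψ → (∀ φ ∈ (run O c ψ).1, Q φ) ∧ R (run O c ψ).2

variable {O : Vec (Fin W) → Vec (Fin W)} {Q P R P' : Vec (Fin W) → Prop} {c c' : List Instr}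

lemma Triple.nil (h : ∀ ψ, P ψ → R ψ) : Triple O Q P [] R := fun ψ hψ =>
  ⟨by simp [run], h ψ hψ⟩

lemma Triple.append (h : Triple O Q P c R) (h' : Triple O Q R c' P') :
    Triple O Q P (c ++ c') P' := by
  intro ψ hψ
  rw [run_append]
  obtain ⟨h1, h2⟩ := h ψ hψ
  obtain ⟨h3, h4⟩ := h' _ h2
  refine ⟨fun φ hφ => ?_, h4⟩
  rcases List.mem_append.1 hφ with hφ | hφ
  · exact h1 φ hφ
  · exact h3 φ hφ

lemma Triple.mono_post (h : Triple O Q P c R) (hR : ∀ ψ, R ψ → P' ψ) : Triple O Q P c P' :=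
  fun ψ hψ => ⟨(h ψ hψ).1, hR _ (h ψ hψ).2⟩

lemma Triple.gate_cons {g : Gate ℕ} (hg : ∀ ψ, P ψ → R (g.apply ψ)) (h : Triple O Q R c P') :
    Triple O Q P (.gate g :: c) P' := fun ψ hψ => h _ (hg ψ hψ)

lemma Triple.query_cons (hq : ∀ ψ, P ψ → Q ψ ∧ R (O ψ)) (h : Triple O Q R c P') :
    Triple O Q P (.query :: c) P' := by
  intro ψ hψ
  obtain ⟨h1, h2⟩ := h _ (hq ψ hψ).2
  refine ⟨fun φ hφ => ?_, h2⟩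
  rcases List.mem_cons.1 hφ with rfl | hφ
  · exact (hq φ hψ).1
  · exact h1 φ hφ

/-- The loop rule, with an invariant indexed by the number of completed rounds. -/
lemma Triple.flatMap_range {I : ℕ → Vec (Fin W) → Prop} {f : ℕ → List Instr} {k : ℕ}
    (h : ∀ i < k, Triple O Q (I i) (f i) (I (i + 1))) :
    Triple O Q (I 0) ((List.range k).flatMap f) (I k) := by
  induction k with
  | zero => exact Triple.nil fun _ h => h
  | succ k ih =>
    rw [List.range_succ, List.flatMap_append, List.flatMap_cons, List.flatMap_nil, List.append_nil]
    exact (ih fun i hi => h i (hi.trans k.lt_succ_self)).append (h k k.lt_succ_self)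

/-- A superposition of `N` branches with the same amplitude `a`, the branch `j` with `B j`. -/
def Branched (N : ℕ) (a : ℂ) (B : ℕ → Vec (Fin W) → Prop) (ψ : Vec (Fin W)) : Prop :=
  ∃ φ : ℕ → Vec (Fin W), ψ = a • ∑ j ∈ Finset.range N, φ j ∧ ∀ j < N, B j (φ j)

/-- By linearity a circuit can be followed one branch at a time. Orthogonality of the branches is
never required. -/
lemma Branched.map {N : ℕ} {a : ℂ} {B B' : ℕ → Vec (Fin W) → Prop} {ψ : Vec (Fin W)}
    (h : Branched N a B ψ) (L : Vec (Fin W) →ₗ[ℂ] Vec (Fin W))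
    (hL : ∀ j < N, ∀ φ, B j φ → B' j (L φ)) : Branched N a B' (L ψ) := by
  obtain ⟨φ, rfl, hφ⟩ := h
  exact ⟨fun j => L (φ j), by simp [map_sum], fun j hj => hL j hj _ (hφ j hj)⟩

lemma Branched.mono {N : ℕ} {a : ℂ} {B B' : ℕ → Vec (Fin W) → Prop} {ψ : Vec (Fin W)}
    (h : Branched N a B ψ) (hB : ∀ j < N, ∀ φ, B j φ → B' j φ) : Branched N a B' ψ :=
  h.map LinearMap.id hB

/-- If only branch `i` has a nonzero amplitude at the basis states with `p`, then their total
probability is at most that of a branch. -/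
lemma Branched.sum_le {N : ℕ} {a : ℂ} {ψ : Vec (Fin W)} {i : ℕ} (hi : i < N)
    (p : (Fin W → Bool) → Prop) [DecidablePred p]
    (h : Branched N a (fun j φ => normSq φ = 1 ∧ (j ≠ i → ∀ b, p b → φ b = 0)) ψ) :
    ∑ b, (if p b then ‖ψ b‖ ^ 2 else 0) ≤ ‖a‖ ^ 2 := by
  obtain ⟨φ, rfl, hφ⟩ := h
  rw [← mul_one (‖a‖ ^ 2), ← (hφ i hi).1, normSq, Finset.mul_sum]
  refine Finset.sum_le_sum fun b _ => ?_
  split_ifs with hb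
  · rw [Pi.smul_apply, Finset.sum_apply, Finset.sum_eq_single i, norm_smul, mul_pow]
    · intro j hj hji
      exact (hφ j (Finset.mem_range.1 hj)).2 hji b hb
    · intro h
      exact absurd (Finset.mem_range.2 hi) h
  · positivity

end Run

/-! ### Costs of programs -/

namespace Expr

/-- A bound for the cost of an expression per binary digit of the memory cells. -/
def weight : Expr → ℕ
  | lit n => 1 + n.size
  | cell a => a.weight + 1
  | add a b => 2 * (a.weight + b.weight) + 1
  | sub a b => 2 * (a.weight + b.weight) + 1
  | mul a b => 2 * (a.weight + b.weight) + 1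

/-- Expressions without multiplications. -/
def MulFree : Expr → Prop
  | lit _ => True
  | cell _ => True
  | add a b => a.MulFree ∧ b.MulFree
  | sub a b => a.MulFree ∧ b.MulFree
  | mul _ _ => False

lemma weight_pos (e : Expr) : 1 ≤ e.weight := by
  cases e <;> simp [weight]

/-- A product has at most as many digits as its factors together. The factor 2 in `weight` pays once
for the costs of the operands and once for the size of the result. -/
lemma eval_lt_and_cost_le {mem : ℕ → ℕ} {Z : ℕ} (hmem : ∀ a, mem a < 2 ^ Z) (e : Expr) :
    e.eval mem < 2 ^ (e.weight * (Z + 1)) ∧ e.cost mem ≤ e.weight * (Z + 1) := by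
  have hbin : ∀ (a b : Expr) (r : ℕ), r < 2 ^ ((a.weight + b.weight) * (Z + 1)) →
      a.cost mem ≤ a.weight * (Z + 1) → b.cost mem ≤ b.weight * (Z + 1) →
      r < 2 ^ ((2 * (a.weight + b.weight) + 1) * (Z + 1)) ∧
      a.cost mem + b.cost mem + (1 + r.size) ≤ (2 * (a.weight + b.weight) + 1) * (Z + 1) := by
    intro a b r hr ha hb
    refine ⟨hr.trans_le (Nat.pow_le_pow_right (by norm_num) ?_), ?_⟩
    · exact Nat.mul_le_mul_right _ (by omega)
    · have := Nat.size_le.2 hr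
      nlinarith
  induction e with
  | lit n =>
    simp only [eval, cost, weight]
    refine ⟨(Nat.lt_size_self n).trans_le (Nat.pow_le_pow_right (by norm_num) ?_), ?_⟩
    · nlinarith
    · nlinarith
  | cell a ih =>
    simp only [eval, cost, weight]
    refine ⟨(hmem _).trans_le (Nat.pow_le_pow_right (by norm_num) ?_), ?_⟩
    · nlinarith
    · have := Nat.size_le.2 (hmem (a.eval mem))
      nlinarith [ih.2]
  | add a b iha ihb =>
    refine hbin a b _ ?_ iha.2 ihb.2
    rw [add_mul, pow_add]
    have h1 := iha.1
    have h2 := ihb.1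
    have h3 : 1 < 2 ^ (a.weight * (Z + 1)) :=
      Nat.one_lt_two_pow (by have := a.weight_pos; positivity)
    have h4 : 1 < 2 ^ (b.weight * (Z + 1)) :=
      Nat.one_lt_two_pow (by have := b.weight_pos; positivity)
    simp only [eval]
    nlinarith
  | sub a b iha ihb =>
    refine hbin a b _ ?_ iha.2 ihb.2
    refine (Nat.sub_le _ _).trans_lt (iha.1.trans_le (Nat.pow_le_pow_right (by norm_num) ?_))
    exact Nat.mul_le_mul_right _ (by omega)
  | mul a b iha ihb =>
    refine hbin a b _ ?_ iha.2 ihb.2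
    rw [add_mul, pow_add]
    exact Nat.mul_lt_mul'' iha.1 ihb.1

/-- Without products the number of digits grows by an additive constant, not by a factor, so it
stays under control when stores are iterated. Addresses may contain products, as reading a cell
returns a number already stored. -/
lemma MulFree.eval_lt {mem : ℕ → ℕ} {Z : ℕ} (hmem : ∀ a, mem a < 2 ^ Z) {e : Expr}
    (he : e.MulFree) : e.eval mem < 2 ^ (Z + e.weight) := by
  induction e with
  | lit n =>
    refine (Nat.lt_size_self n).trans_le (Nat.pow_le_pow_right (by norm_num) ?_)
    simp only [weight]
    omega
  | cell a _ => exact (hmem _).trans_le (Nat.pow_le_pow_right (by norm_num) (Nat.le_add_right _ _))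
  | add a b iha ihb =>
    have h1 : a.eval mem < 2 ^ (Z + a.weight + b.weight) :=
      (iha he.1).trans_le (Nat.pow_le_pow_right (by norm_num) (by omega))
    have h2 : b.eval mem < 2 ^ (Z + a.weight + b.weight) :=
      (ihb he.2).trans_le (Nat.pow_le_pow_right (by norm_num) (by omega))
    have h3 : 2 ^ (Z + a.weight + b.weight + 1) ≤ 2 ^ (Z + (add a b).weight) :=
      Nat.pow_le_pow_right (by norm_num) (by simp only [weight]; omega)
    rw [pow_succ] at h3
    simp only [eval]
    omega
  | sub a b iha _ =>
    refine (Nat.sub_le _ _).trans_lt ((iha he.1).trans_le (Nat.pow_le_pow_right (by norm_num) ?_))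
    simp only [weight]
    omega
  | mul a b _ _ => exact he.elim

end Expr

/-- A bound for the cost of a gate per binary digit of the memory cells. -/
def Gate.weight (g : Gate Expr) : ℕ := (g.wires.map Expr.weight).sum

lemma Gate.cost_le {mem : ℕ → ℕ} {Z : ℕ} (hmem : ∀ a, mem a < 2 ^ Z) (g : Gate Expr) :
    g.cost mem ≤ g.weight * (Z + 1) := by
  rw [Gate.cost, Gate.weight]
  induction g.wires with
  | nil => simp
  | cons e l ih =>
    simp only [List.map_cons, List.sum_cons, add_mul]
    exact add_le_add (Expr.eval_lt_and_cost_le hmem e).2 ih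

namespace Prog

/-- A bound for the cost of a step of a program per binary digit of the memory cells. -/
def weight : Prog → ℕ
  | skip => 1
  | store a v => 1 + a.weight + v.weight
  | challengeBit e => 1 + e.weight
  | challengeGate g => 1 + g.weight
  | gate g => 1 + g.weight
  | query => 1
  | seq p q => p.weight + q.weight
  | ite e p q => 1 + e.weight + p.weight + q.weight
  | loop e p => 1 + e.weight + p.weight

/-- Programs that store no products. -/
def MulFree : Prog → Prop
  | store _ v => v.MulFree
  | seq p q => p.MulFree ∧ q.MulFree
  | ite _ p q => p.MulFree ∧ q.MulFree
  | loop _ p => p.MulFree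
  | _ => True

end Prog

/-- `Run p s s' t`: started in `s`, the program `p` halts in `s'` after `t` steps. -/
inductive Run : Prog → Config → Config → ℕ → Prop
  | store (s : Config) (a v : Expr) :
      Run (.store a v) s
        { s with mem := Function.update s.mem (a.eval s.mem) (v.eval s.mem) } 1
  | gate (s : Config) (g : Gate Expr) :
      Run (.gate g) s { s with circuit := s.circuit ++ [.gate (g.map (Expr.eval s.mem))] } 1
  | query (s : Config) : Run .query s { s with circuit := s.circuit ++ [.query] } 1
  | seq {p q : Prog} {s s' s'' : Config} {m n : ℕ} :
      Run p s s' m → Run q s' s'' n → Run (.seq p q) s s'' (m + n)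
  | ite_true {e : Expr} {p q : Prog} {s s' : Config} {n : ℕ} :
      e.eval s.mem ≠ 0 → Run p s s' n → Run (.ite e p q) s s' (1 + n)
  | ite_false {e : Expr} {p q : Prog} {s s' : Config} {n : ℕ} :
      e.eval s.mem = 0 → Run q s s' n → Run (.ite e p q) s s' (1 + n)
  | loop_exit {e : Expr} {p : Prog} {s : Config} :
      e.eval s.mem = 0 → Run (.loop e p) s s 1
  | loop_step {e : Expr} {p : Prog} {s s' s'' : Config} {m n : ℕ} :
      e.eval s.mem ≠ 0 → Run p s s' m → Run (.loop e p) s' s'' n →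
        Run (.loop e p) s s'' (1 + m + n)

/-- The cost of `t` steps: each of them adds at most `K` digits to the numbers in memory. -/
def costBound (K Z t : ℕ) : ℕ := t * (K * (Z + K * t + 1))

/-- The first `m` steps raise the digit bound from `Z` to `Z + K * m`, and this is where the other
`n` steps start. -/
lemma costBound_add (K Z m n : ℕ) :
    costBound K Z m + costBound K (Z + K * m) n ≤ costBound K Z (m + n) := by
  have h1 : K * (Z + K * m + 1) ≤ K * (Z + K * (m + n) + 1) := by gcongr; omega
  have h2 : K * (Z + K * m + K * n + 1) = K * (Z + K * (m + n) + 1) := by ring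
  simp only [costBound, h2, add_mul m n]
  exact Nat.add_le_add_right (Nat.mul_le_mul_left _ h1) _

lemma le_costBound_one {K Z x : ℕ} (h : x ≤ K * (Z + 1)) : x ≤ costBound K Z 1 := by
  refine h.trans ?_
  simp only [costBound, one_mul]
  gcongr
  omega

/-- Digit bound and cost go through one induction: the cost of a step is at most `K` times the
current number of digits plus one, and a step adds at most `K` digits. A polynomial number of steps
thus has polynomial logarithmic cost. -/
lemma Run.exec {p : Prog} {s s' : Config} {t : ℕ} (h : Run p s s' t) {K : ℕ} :
    p.MulFree → p.weight ≤ K → ∀ {Z : ℕ}, (∀ a, s.mem a < 2 ^ Z) →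
      (∀ a, s'.mem a < 2 ^ (Z + K * t)) ∧ ∃ n ≤ costBound K Z t, Exec p s s' n := by
  have hcond : ∀ {e : Expr} {s : Config} {Z w : ℕ}, (∀ a, s.mem a < 2 ^ Z) →
      1 + e.weight + w ≤ K → 1 + e.cost s.mem ≤ costBound K Z 1 := by
    intro e s Z w hs hw
    apply le_costBound_one
    have := (e.eval_lt_and_cost_le hs).2
    nlinarith
  have hmono : ∀ {mem : ℕ → ℕ} {Z Z' : ℕ}, Z ≤ Z' → (∀ a, mem a < 2 ^ Z) → ∀ a, mem a < 2 ^ Z' :=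
    fun hZ h a => (h a).trans_le (Nat.pow_le_pow_right (by norm_num) hZ)
  induction h with
  | store s a v =>
    intro hp hK Z hs
    simp only [Prog.weight] at hK
    have ha := (a.eval_lt_and_cost_le hs).2
    have hv := (v.eval_lt_and_cost_le hs).2
    refine ⟨fun b => ?_, _, le_costBound_one ?_, Exec.store s a v⟩
    · by_cases hb : b = a.eval s.mem
      · subst hb
        simp only [Function.update_self]
        exact (Expr.MulFree.eval_lt hs hp).trans_le (Nat.pow_le_pow_right (by norm_num) (by omega))
      · simp only [Function.update_of_ne hb]
        exact hmono (Nat.le_add_right _ _) hs b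
    · nlinarith
  | gate s g =>
    intro _ hK Z hs
    simp only [Prog.weight] at hK
    have hg := g.cost_le hs
    exact ⟨hmono (Nat.le_add_right _ _) hs, _, le_costBound_one (by nlinarith), Exec.gate s g⟩
  | query s =>
    intro _ hK Z hs
    simp only [Prog.weight] at hK
    exact ⟨hmono (Nat.le_add_right _ _) hs, _, le_costBound_one (by nlinarith), Exec.query s⟩
  | @seq p q s s' s'' m n _ _ ih1 ih2 =>
    intro hp hK Z hs
    simp only [Prog.weight] at hK
    obtain ⟨h1, a, ha, e1⟩ := ih1 hp.1 (by omega) hs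
    obtain ⟨h2, b, hb, e2⟩ := ih2 hp.2 (by omega) h1
    refine ⟨hmono (by rw [mul_add, add_assoc]) h2, _, ?_, Exec.seq e1 e2⟩
    exact (add_le_add ha hb).trans (costBound_add K Z m n)
  | @ite_true e p q s s' n he _ ih =>
    intro hp hK Z hs
    simp only [Prog.weight] at hK
    have hc := hcond hs (e := e) (w := 0) (by omega)
    obtain ⟨h1, a, ha, e1⟩ := ih hp.1 (by omega) (hmono (Nat.le_add_right Z (K * 1)) hs)
    refine ⟨hmono (by rw [mul_add, add_assoc]) h1, _, ?_, Exec.ite_true he e1⟩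
    exact (add_le_add hc ha).trans (costBound_add K Z 1 n)
  | @ite_false e p q s s' n he _ ih =>
    intro hp hK Z hs
    simp only [Prog.weight] at hK
    have hc := hcond hs (e := e) (w := 0) (by omega)
    obtain ⟨h1, a, ha, e1⟩ := ih hp.2 (by omega) (hmono (Nat.le_add_right Z (K * 1)) hs)
    refine ⟨hmono (by rw [mul_add, add_assoc]) h1, _, ?_, Exec.ite_false he e1⟩
    exact (add_le_add hc ha).trans (costBound_add K Z 1 n)
  | @loop_exit e p s he =>
    intro _ hK Z hs
    simp only [Prog.weight] at hK
    exact ⟨hmono (Nat.le_add_right _ _) hs, _, hcond hs (e := e) (w := 0) (by omega),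
      Exec.loop_stop he⟩
  | @loop_step e p s s' s'' m n he _ _ ih1 ih2 =>
    intro hp hK Z hs
    have hK' := hK
    simp only [Prog.weight] at hK'
    have hc := hcond hs (e := e) (w := 0) (by omega)
    obtain ⟨h1, a, ha, e1⟩ := ih1 hp (by omega) (hmono (Nat.le_add_right Z (K * 1)) hs)
    have h1' := hmono (Z' := Z + K * (1 + m)) (by rw [mul_add, add_assoc]) h1
    obtain ⟨h2, b, hb, e2⟩ := ih2 hp hK h1'
    refine ⟨hmono (le_of_eq (by ring)) h2, _, ?_, Exec.loop_step he e1 e2⟩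
    have := costBound_add K Z 1 m
    have := costBound_add K Z (1 + m) n
    omega

/-- `p` leads from `s` to `s'` in at most `t` steps. -/
def RunLe (p : Prog) (s s' : Config) (t : ℕ) : Prop := ∃ m ≤ t, Run p s s' m

lemma RunLe.mono {p : Prog} {s s' : Config} {t t' : ℕ} (h : RunLe p s s' t) (ht : t ≤ t') :
    RunLe p s s' t' := by
  obtain ⟨m, hm, h⟩ := h
  exact ⟨m, hm.trans ht, h⟩

lemma RunLe.seq {p q : Prog} {s s' s'' : Config} {m n : ℕ} (h : RunLe p s s' m)
    (h' : RunLe q s' s'' n) : RunLe (.seq p q) s s'' (m + n) := by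
  obtain ⟨a, ha, h⟩ := h
  obtain ⟨b, hb, h'⟩ := h'
  exact ⟨a + b, add_le_add ha hb, h.seq h'⟩

lemma RunLe.ite_true {e : Expr} {p q : Prog} {s s' : Config} {n : ℕ} (he : e.eval s.mem ≠ 0)
    (h : RunLe p s s' n) : RunLe (.ite e p q) s s' (1 + n) := by
  obtain ⟨a, ha, h⟩ := h
  exact ⟨1 + a, by omega, .ite_true he h⟩

lemma RunLe.ite_false {e : Expr} {p q : Prog} {s s' : Config} {n : ℕ} (he : e.eval s.mem = 0)
    (h : RunLe q s s' n) : RunLe (.ite e p q) s s' (1 + n) := by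
  obtain ⟨a, ha, h⟩ := h
  exact ⟨1 + a, by omega, .ite_false he h⟩

lemma RunLe.loop_exit {e : Expr} {p : Prog} {s : Config} (he : e.eval s.mem = 0) :
    RunLe (.loop e p) s s 1 := ⟨1, le_rfl, .loop_exit he⟩

lemma RunLe.loop_step {e : Expr} {p : Prog} {s s' s'' : Config} {m n : ℕ}
    (he : e.eval s.mem ≠ 0) (h : RunLe p s s' m) (h' : RunLe (.loop e p) s' s'' n) :
    RunLe (.loop e p) s s'' (1 + m + n) := by
  obtain ⟨a, ha, h⟩ := h
  obtain ⟨b, hb, h'⟩ := h'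
  exact ⟨1 + a + b, by omega, .loop_step he h h'⟩

/-- What the loop does after `k` regular rounds is left open, because the search for the number of
branches can end with an exceptional round. -/
lemma RunLe.loop_prefix {e : Expr} {p : Prog} {f : ℕ → Config} {k C n : ℕ} {s : Config}
    (h : ∀ i < k, e.eval (f i).mem ≠ 0 ∧ RunLe p (f i) (f (i + 1)) C)
    (hk : RunLe (.loop e p) (f k) s n) : RunLe (.loop e p) (f 0) s (k * (C + 1) + n) := by
  induction k generalizing f with
  | zero => simpa using hk
  | succ k ih =>
    have h0 := h 0 k.succ_pos
    have := ih (f := fun i => f (i + 1)) (fun i hi => h (i + 1) (by omega)) hk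
    refine (RunLe.loop_step h0.1 h0.2 this).mono ?_
    rw [add_mul]
    omega

lemma RunLe.loop_count {e : Expr} {p : Prog} {f : ℕ → Config} {k C : ℕ}
    (h : ∀ i < k, e.eval (f i).mem ≠ 0 ∧ RunLe p (f i) (f (i + 1)) C)
    (hk : e.eval (f k).mem = 0) : RunLe (.loop e p) (f 0) (f k) (k * (C + 1) + 1) :=
  RunLe.loop_prefix h (RunLe.loop_exit hk)

/-! ### Programs on a finite list of memory cells -/

/-- The configuration with the memory cells `L` and the circuit `c`, and empty challenges. -/
def cfg (L : List ℕ) (c : List Instr) : Config := ⟨fun i => L.getD i 0, [], [], c⟩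

lemma getD_set_eq_update (L : List ℕ) {a : ℕ} (ha : a < L.length) (v : ℕ) :
    (fun i => (L.set a v).getD i 0) = Function.update (fun i => L.getD i 0) a v := by
  ext i
  by_cases h : i = a
  · subst h
    simp [ha]
  · simp [List.getD_eq_getElem?_getD, h, Ne.symm h]

lemma runLe_store (L : List ℕ) (c : List Instr) {a : ℕ} (ha : a < L.length) (v : Expr) {x : ℕ}
    (hx : v.eval (fun i => L.getD i 0) = x) :
    RunLe (.store (.lit a) v) (cfg L c) (cfg (L.set a x) c) 1 := by
  subst hx
  refine ⟨1, le_rfl, ?_⟩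
  have h := Run.store (cfg L c) (.lit a) v
  simp only [cfg, Expr.eval] at h ⊢
  rw [getD_set_eq_update L ha]
  exact h

lemma runLe_gate (L : List ℕ) (c : List Instr) (g : Gate Expr) {g' : Gate ℕ}
    (hg : g.map (Expr.eval fun i => L.getD i 0) = g') :
    RunLe (.gate g) (cfg L c) (cfg L (c ++ [.gate g'])) 1 := by
  subst hg
  exact ⟨1, le_rfl, Run.gate (cfg L c) g⟩

lemma runLe_query (L : List ℕ) (c : List Instr) :
    RunLe .query (cfg L c) (cfg L (c ++ [.query])) 1 :=
  ⟨1, le_rfl, Run.query (cfg L c)⟩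

/-! ### One-hot superpositions -/

/-- The circuit that writes a uniform superposition of the one-hot strings of length `2 ^ r` to the
wires from `base + 2 ^ r` on. The wire `base` is set to one, and the wires `base + 2 ^ t` with
`t < r` hold the random bits. -/
def oneHotLevel (base N M : ℕ) : List Instr :=
  .gate (.h (base + M)) :: (List.range M).flatMap fun i =>
    [.gate (.ccx (base + M) (base + N + i) (base + N + (M + i))),
      .gate (.cnot (base + N + (M + i)) (base + N + i))]

/-- See `oneHotLevel`. -/
def oneHotCircuit (base r : ℕ) : List Instr :=
  .gate (.x base) :: .gate (.x (base + 2 ^ r)) ::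
    (List.range r).flatMap fun t => oneHotLevel base (2 ^ r) (2 ^ t)

section OneHot

variable {W : ℕ}

lemma Branched.act {N : ℕ} {a : ℂ} {B B' : ℕ → (Fin W → Bool) → Prop} {ψ : Vec (Fin W)}
    {g : Gate ℕ} (hg : g.apply = fun (ψ : Vec (Fin W)) b => ψ (Gate.act g b))
    (hB : ∀ j < N, ∀ b, B j b → B' j (Gate.act g b))
    (h : Branched N a (fun j φ => ∃ b, φ = ket b ∧ B j b) ψ) :
    Branched N a (fun j φ => ∃ b, φ = ket b ∧ B' j b) (g.apply ψ) := by
  refine h.map g.lin ?_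
  rintro j hj _ ⟨b, rfl, hb⟩
  refine ⟨Gate.act g b, ?_, hB j hj b hb⟩
  change g.apply (ket b) = _
  rw [hg]
  exact ket_comp b (Gate.act_involutive g)

lemma apply_h_ket {i : ℕ} (hi : i < W) {b : Fin W → Bool} (hb : getBit b i = false) :
    (Gate.h i).apply (ket b) = ((Real.sqrt 2 : ℂ)⁻¹) • (ket b + ket (setBit b i true)) := by
  ext a
  have h0 : (setBit a i false = b) ↔ (setBit a i true = setBit b i true) := by
    constructor
    · rintro rfl
      rw [setBit_setBit]
    · intro h
      have := congrArg (fun c => setBit c i false) h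
      simp only [setBit_setBit] at this
      rw [this, ← hb, setBit_getBit]
  have h1 : setBit a i true ≠ b := by
    rintro rfl
    simp [getBit_setBit a hi] at hb
  have ha := setBit_getBit a i
  simp only [Gate.apply, hi, if_true, ket, Pi.smul_apply, Pi.add_apply, smul_eq_mul, h1, if_false,
    mul_zero, add_zero]
  cases hv : getBit a i
  · rw [hv] at ha
    have h2 : a ≠ setBit b i true := by
      rintro rfl
      simp [getBit_setBit b hi] at hv
    simp [ha, h2, div_eq_inv_mul]
  · rw [hv] at ha
    have h2 : a ≠ b := by
      rintro rfl
      simp [hb] at hv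
    rw [ha] at h0
    simp [h0, h2, div_eq_inv_mul]

/-- The one-hot register holds `p`, and the constant wire is one. -/
def Hot (base N p : ℕ) (b : Fin W → Bool) : Prop :=
  getBit b base = true ∧ (∀ w < base, getBit b w = false) ∧
    ∀ i < N, getBit b (base + N + i) = decide (i = p)

/-- The one-hot register holds `p`, the level `M` of the register has the random bit `v`, and the
higher random bits are zero. -/
def HotLevel (base N M p : ℕ) (v : Bool) (b : Fin W → Bool) : Prop :=
  Hot base N p b ∧ getBit b (base + M) = v ∧
    ∀ M', M < M' → M' < N → getBit b (base + M') = false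

/-- The Hadamard gate on a fresh zero bit splits each branch in two. The copy with bit one gets the
index `M + j` but still holds position `j`, whence the `j - M`. -/
lemma branched_oneHot_hadamard {base N M : ℕ} {a : ℂ} (hM0 : 0 < M) (hM : M < N)
    (hW : base + 2 * N ≤ W) {ψ : Vec (Fin W)}
    (h : Branched M a (fun j φ => ∃ b, φ = ket b ∧ HotLevel base N M j false b) ψ) :
    Branched (2 * M) (a * (Real.sqrt 2 : ℂ)⁻¹) (fun j φ => ∃ b, φ = ket b ∧
      HotLevel base N M (if M ≤ j then j - M else j) (decide (M ≤ j)) b)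
      ((Gate.h (base + M)).apply ψ) := by
  have hi : base + M < W := by omega
  obtain ⟨φ, rfl, hφ⟩ := h
  choose! b hφb hb using hφ
  refine ⟨fun j => if M ≤ j then ket (setBit (b (j - M)) (base + M) true) else ket (b j), ?_, ?_⟩
  · rw [two_mul, Finset.sum_range_add]
    rw [Finset.sum_congr rfl (fun j hj => if_neg (not_le.2 (Finset.mem_range.1 hj)))]
    simp only [Nat.le_add_right, if_true, Nat.add_sub_cancel_left]
    rw [← Finset.sum_add_distrib]
    change (Gate.h (base + M)).lin _ = _
    rw [map_smul, map_sum, mul_smul, Finset.smul_sum (r := (Real.sqrt 2 : ℂ)⁻¹)]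
    congr 1
    refine Finset.sum_congr rfl fun j hj => ?_
    rw [hφb j (Finset.mem_range.1 hj)]
    exact apply_h_ket hi (hb j (Finset.mem_range.1 hj)).2.1
  · intro j hj
    by_cases hjM : M ≤ j
    · obtain ⟨⟨h1, h2, h3⟩, h4, h5⟩ := hb (j - M) (by omega)
      simp only [hjM, if_true, decide_true]
      refine ⟨_, rfl, ⟨?_, ?_, ?_⟩, ?_, ?_⟩
      · rw [getBit_setBit _ hi, if_neg (by omega), h1]
      · intro w hw
        rw [getBit_setBit _ hi, if_neg (by omega), h2 w hw]
      · intro i hiN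
        rw [getBit_setBit _ hi, if_neg (by omega), h3 i hiN]
      · rw [getBit_setBit _ hi, if_pos rfl]
      · intro M' h6 h7
        rw [getBit_setBit _ hi, if_neg (by omega), h5 M' h6 h7]
    · simp only [hjM, if_false, decide_false]
      exact ⟨_, rfl, hb j (by omega)⟩

/-- If the random bit is one, the Toffoli gate copies a one from position `i` to `M + i` and the
controlled NOT erases the original. A branch `j ≥ M` starts at `j - M` and has reached `j` once `i`
has passed `j - M`; the conditions record this. -/
lemma hotLevel_step {base N M i j : ℕ} (hM : 2 * M ≤ N) (hi : i < M) (hj : j < 2 * M)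
    (hW : base + 2 * N ≤ W) {b : Fin W → Bool}
    (h : HotLevel base N M (if M ≤ j ∧ i ≤ j - M then j - M else j) (decide (M ≤ j)) b) :
    HotLevel base N M (if M ≤ j ∧ i + 1 ≤ j - M then j - M else j) (decide (M ≤ j))
      (Gate.act (.cnot (base + N + (M + i)) (base + N + i))
        (Gate.act (.ccx (base + M) (base + N + i) (base + N + (M + i))) b)) := by
  obtain ⟨⟨h1, h2, h3⟩, h4, h5⟩ := h
  have hbit : ∀ w, getBit (Gate.act (.cnot (base + N + (M + i)) (base + N + i))
        (Gate.act (.ccx (base + M) (base + N + i) (base + N + (M + i))) b)) w = _ := fun w => by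
    rw [Gate.getBit_act_cnot (by omega) (by omega),
      Gate.getBit_act_ccx (by omega) (by omega) (by omega),
      Gate.getBit_act_ccx (by omega) (by omega) (by omega)]
  have hother : ∀ w, w < base + N → getBit (Gate.act (.cnot (base + N + (M + i)) (base + N + i))
        (Gate.act (.ccx (base + M) (base + N + i) (base + N + (M + i))) b)) w = getBit b w := by
    intro w hw
    have e1 : w ≠ base + N + (M + i) := by omega
    have e2 : w ≠ base + N + i := by omega
    simp [hbit, e1, e2]
  refine ⟨⟨?_, ?_, ?_⟩, ?_, ?_⟩
  · rw [hother _ (by omega), h1]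
  · intro w hw
    rw [hother _ (by omega), h2 w hw]
  · intro i' hi'
    rw [hbit, h4, h3 i' hi', h3 i (by omega), h3 (M + i) (by omega)]
    have e1 : (base + N + i' = base + N + (M + i)) = (i' = M + i) := by simp
    have e2 : (base + N + i' = base + N + i) = (i' = i) := by simp
    simp only [e1, e2, decide_true, Bool.true_and]
    by_cases hMj : M ≤ j
    -- This is the only round that changes branch `j`.
    · by_cases c1 : i = j - M
      · have c2 : ¬ i + 1 ≤ j - M := by omega
        have c3 : i ≤ j - M := by omega
        have c4 : M + i = j := by omega
        have c5 : M + i ≠ i := by omega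
        have c6 : j ≠ i := by omega
        subst c4
        rw [if_pos ⟨hMj, c3⟩, if_neg (fun h => c2 h.2), ← c1]
        have c7 : M ≠ 0 := by omega
        by_cases c8 : i' = M + i
        · simp [c8, c7]
        · by_cases c9 : i' = i <;> simp [c8, c9, c7]
      · have c2 : (M ≤ j ∧ i + 1 ≤ j - M) ↔ (M ≤ j ∧ i ≤ j - M) := by omega
        simp only [c2]
        have c3 : i ≠ if M ≤ j ∧ i ≤ j - M then j - M else j := by split_ifs <;> omega
        have c4 : M + i ≠ if M ≤ j ∧ i ≤ j - M then j - M else j := by split_ifs <;> omega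
        simp [c3, c4]
    · have c4 : M + i ≠ j := by omega
      simp [hMj, c4]
  · rw [hother _ (by omega), h4]
  · intro M' h6 h7
    rw [hother _ (by omega), h5 M' h6 h7]

variable (O : Vec (Fin W) → Vec (Fin W)) (Q : Vec (Fin W) → Prop)

lemma triple_oneHotLevel {base N M : ℕ} {a : ℂ} (hM0 : 0 < M) (hM : 2 * M ≤ N)
    (hW : base + 2 * N ≤ W) :
    Triple O Q
      (Branched M a (fun j φ => ∃ b, φ = ket b ∧ HotLevel base N M j false b))
      (oneHotLevel base N M)
      (Branched (2 * M) (a * (Real.sqrt 2 : ℂ)⁻¹) (fun j φ => ∃ b, φ = ket b ∧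
        HotLevel base N M j (decide (M ≤ j)) b)) := by
  rw [oneHotLevel]
  refine Triple.gate_cons (fun ψ h => branched_oneHot_hadamard hM0 (by omega) hW h) ?_
  have h := Triple.flatMap_range (O := O) (Q := Q) (k := M)
    (f := fun i => [.gate (.ccx (base + M) (base + N + i) (base + N + (M + i))),
      .gate (.cnot (base + N + (M + i)) (base + N + i))])
    (I := fun i => Branched (2 * M) (a * (Real.sqrt 2 : ℂ)⁻¹) fun j φ => ∃ b, φ = ket b ∧
      HotLevel base N M (if M ≤ j ∧ i ≤ j - M then j - M else j) (decide (M ≤ j)) b) ?_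
  · simp only [Nat.zero_le, and_true] at h
    refine h.mono_post fun ψ hψ => hψ.mono ?_
    rintro j hj φ ⟨b, rfl, hb⟩
    rw [if_neg (by omega)] at hb
    exact ⟨b, rfl, hb⟩
  · intro i hi
    refine Triple.gate_cons (fun ψ h => h.act (Gate.apply_ccx _ _ _ |> funext)
      (B' := fun j b => ∃ b', b = Gate.act (.ccx (base + M) (base + N + i) (base + N + (M + i))) b' ∧
        HotLevel base N M (if M ≤ j ∧ i ≤ j - M then j - M else j) (decide (M ≤ j)) b')
      fun j _ b hb => ⟨b, rfl, hb⟩) ?_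
    refine Triple.gate_cons (fun ψ h => h.act (Gate.apply_cnot _ _ |> funext) ?_)
      (Triple.nil fun _ h => h)
    rintro j hj _ ⟨b, rfl, hb⟩
    exact hotLevel_step hM hi hj hW hb

lemma triple_oneHotCircuit {base r : ℕ} (hW : base + 2 * 2 ^ r ≤ W) :
    Triple O Q (fun ψ => ψ = ket fun _ => false) (oneHotCircuit base r)
      (Branched (2 ^ r) ((Real.sqrt 2 : ℂ)⁻¹ ^ r) (fun j φ => ∃ b, φ = ket b ∧
        Hot base (2 ^ r) j b)) := by
  have hr : 0 < 2 ^ r := by positivity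
  -- Besides the hot position, the invariant keeps the random bits of the remaining levels at zero,
  -- as each Hadamard gate needs a fresh bit. Used random bits are not cleaned up; they do no harm.
  set I : ℕ → Vec (Fin W) → Prop := fun t => Branched (2 ^ t) ((Real.sqrt 2 : ℂ)⁻¹ ^ t)
    fun j φ => ∃ b, φ = ket b ∧ Hot base (2 ^ r) j b ∧
      ∀ M', 2 ^ t ≤ M' → M' < 2 ^ r → getBit b (base + M') = false with hI
  rw [oneHotCircuit]
  refine Triple.gate_cons (R := fun ψ => ψ = ket (Gate.act (.x base) fun _ => false)) ?_
    (Triple.gate_cons (R := I 0) ?_ ?_)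
  · rintro _ rfl
    rw [Gate.apply_x]
    exact ket_comp _ (Gate.act_involutive _)
  · rintro _ rfl
    refine ⟨fun _ => ket (Gate.act (.x (base + 2 ^ r)) (Gate.act (.x base) fun _ => false)), ?_, ?_⟩
    · rw [Gate.apply_x]
      simpa using ket_comp _ (Gate.act_involutive _)
    · intro j hj
      have hj0 : j = 0 := by simpa using hj
      have hbit : ∀ w, getBit (Gate.act (.x (base + 2 ^ r))
          (Gate.act (.x base) fun _ : Fin W => false)) w
            = xor (decide (w = base)) (decide (w = base + 2 ^ r)) := by
        intro w
        rw [Gate.getBit_act_x (by omega), Gate.getBit_act_x (by omega)]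
        simp
      refine ⟨_, rfl, ⟨?_, ?_, ?_⟩, ?_⟩
      · rw [hbit]
        simp
      · intro w hw
        have e1 : w ≠ base := by omega
        have e2 : w ≠ base + 2 ^ r := by omega
        simp [hbit, e1, e2]
      · intro i _
        have e1 : base + 2 ^ r + i ≠ base := by omega
        simp [hbit, e1, hj0]
      · intro M' h1 h2
        have e1 : M' ≠ 0 := by
          have : 2 ^ 0 ≤ M' := h1
          omega
        have e2 : M' ≠ 2 ^ r := by omega
        simp [hbit, e1, e2]
  · have h := Triple.flatMap_range (O := O) (Q := Q) (I := I) (k := r)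
      (f := fun t => oneHotLevel base (2 ^ r) (2 ^ t)) ?_
    · refine h.mono_post fun ψ hψ => hψ.mono ?_
      rintro j _ φ ⟨b, rfl, hb, _⟩
      exact ⟨b, rfl, hb⟩
    · intro t ht
      have h2t : 2 * 2 ^ t ≤ 2 ^ r := by
        rw [← pow_succ']
        exact Nat.pow_le_pow_right (by norm_num) ht
      have hM0 : 0 < 2 ^ t := by positivity
      have hlev := triple_oneHotLevel O Q (a := (Real.sqrt 2 : ℂ)⁻¹ ^ t) hM0 h2t hW
      intro ψ hψ
      have hpre : Branched (2 ^ t) ((Real.sqrt 2 : ℂ)⁻¹ ^ t)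
          (fun j φ => ∃ b, φ = ket b ∧ HotLevel base (2 ^ r) (2 ^ t) j false b) ψ := by
        refine hψ.mono ?_
        rintro j hj φ ⟨b, rfl, hb, hb'⟩
        exact ⟨b, rfl, hb, hb' _ le_rfl (by omega), fun M' h3 h4 => hb' M' h3.le h4⟩
      obtain ⟨h1, h2⟩ := hlev ψ hpre
      refine ⟨h1, ?_⟩
      simp only [hI, pow_succ' 2 t, pow_succ (Real.sqrt 2 : ℂ)⁻¹ t]
      refine h2.mono ?_
      rintro j hj φ ⟨b, rfl, hb, _, hb'⟩
      exact ⟨b, rfl, hb, fun M' h3 h4 => hb' M' (by omega) h4⟩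

end OneHot

/-- The weight of one branch, which bounds the overlap of each query with the challenge. -/
lemma norm_inv_sqrt_two_pow (r : ℕ) :
    ‖((Real.sqrt 2 : ℂ)⁻¹ ^ r)‖ ^ 2 = ((2 ^ r : ℕ) : ℝ)⁻¹ := by
  rw [norm_pow, norm_inv, Complex.norm_real, Real.norm_eq_abs, abs_of_nonneg (Real.sqrt_nonneg 2),
    ← pow_mul, mul_comm, pow_mul, inv_pow, Real.sq_sqrt (by norm_num)]
  simp

/-! ### The attack on classical primitives -/

/-- One query of the attack: the message is zero in branch `i` and differs from it in the first bit
in the other branches. -/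
def classicalStep (base N i : ℕ) : List Instr :=
  [.gate (.x 0), .gate (.cnot (base + N + i) 0), .query,
    .gate (.cnot (base + N + i) 0), .gate (.x 0)]

/-- The circuit of the attack on a classical primitive. -/
def classicalCircuit (n l r : ℕ) : List Instr :=
  oneHotCircuit (n + l) r ++ ((List.range (2 ^ r)).flatMap (classicalStep (n + l) (2 ^ r)) ++
    [.gate (.x 0), .query])

/-! ### The standard oracle as a permutation of basis states -/

section Oracle

variable {n l w : ℕ}

lemma queryWires_injective : Function.Injective (queryWires n l w) := fun _ _ h =>
  finSumFinEquiv.injective (Fin.castAdd_injective _ _ h)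

@[simp] lemma queryWires_inl (u : Fin n) : (queryWires n l w (.inl u)).val = u := by
  simp [queryWires]

@[simp] lemma queryWires_inr (u : Fin l) : (queryWires n l w (.inr u)).val = n + u := by
  simp [queryWires]

/-- The message in the query register. -/
def message (b : Fin (n + l + w) → Bool) : Fin n → Bool := b ∘ queryWires n l w ∘ Sum.inl

/-- The action of the standard oracle on basis states of the query register. -/
def oracleAct (f : (Fin n → Bool) → (Fin l → Bool)) (x : Fin n ⊕ Fin l → Bool) :
    Fin n ⊕ Fin l → Bool :=
  Sum.elim (fun i => x (.inl i)) (fun j => xor (x (.inr j)) (f (fun i => x (.inl i)) j))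

lemma oracleAct_involutive (f : (Fin n → Bool) → (Fin l → Bool)) :
    Function.Involutive (oracleAct f) := by
  intro x
  ext i
  rcases i with i | i <;> simp [oracleAct]

/-- The action of the standard oracle on basis states. -/
def queryAct (w : ℕ) (f : (Fin n → Bool) → (Fin l → Bool)) (b : Fin (n + l + w) → Bool) :
    Fin (n + l + w) → Bool :=
  Function.extend (queryWires n l w) (oracleAct f (b ∘ queryWires n l w)) b

lemma queryAct_involutive (f : (Fin n → Bool) → (Fin l → Bool)) :
    Function.Involutive (queryAct w f) := by
  intro b
  rw [queryAct, queryAct, extend_extend queryWires_injective,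
    Function.extend_comp queryWires_injective, oracleAct_involutive f]
  exact extend_eq_self queryWires_injective rfl

lemma standardOracle_apply (f : (Fin n → Bool) → (Fin l → Bool)) (y x : Fin n ⊕ Fin l → Bool) :
    standardOracle f y x = if y = oracleAct f x then 1 else 0 := rfl

/-- Each row of the permutation matrix has one entry, at the preimage of its index, and the oracle
is its own inverse. -/
lemma applyOn_standardOracle (f : (Fin n → Bool) → (Fin l → Bool)) (ψ : Vec (Fin (n + l + w))) :
    applyOn (queryWires n l w) (standardOracle f) ψ = fun b => ψ (queryAct w f b) := by
  ext b
  rw [applyOn_eq queryWires_injective, Finset.sum_eq_single (oracleAct f (b ∘ queryWires n l w))]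
  · have : b ∘ queryWires n l w = oracleAct f (oracleAct f (b ∘ queryWires n l w)) :=
      (oracleAct_involutive f _).symm
    rw [standardOracle_apply, if_pos this, one_mul, queryAct]
  · intro x _ hx
    have : b ∘ queryWires n l w ≠ oracleAct f x := by
      intro h
      rw [h, oracleAct_involutive f] at hx
      exact hx rfl
    rw [standardOracle_apply, if_neg this, zero_mul]
  · simp

lemma getBit_queryAct_of_lt (f : (Fin n → Bool) → (Fin l → Bool)) (b : Fin (n + l + w) → Bool)
    {v : ℕ} (hv : v < n) : getBit (queryAct w f b) v = getBit b v := by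
  have h : v = (queryWires n l w (.inl ⟨v, hv⟩)).val := by simp
  rw [h, getBit_val, getBit_val, queryAct, queryWires_injective.extend_apply]
  rfl

lemma getBit_queryAct_of_le (f : (Fin n → Bool) → (Fin l → Bool)) (b : Fin (n + l + w) → Bool)
    {v : ℕ} (hv : n + l ≤ v) : getBit (queryAct w f b) v = getBit b v := by
  by_cases h : v < n + l + w
  · rw [getBit_of_lt _ h, getBit_of_lt _ h, queryAct, Function.extend_apply']
    rintro ⟨u | u, hu⟩
    · have := congrArg Fin.val hu
      simp only [queryWires_inl] at this
      omega
    · have := congrArg Fin.val hu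
      simp only [queryWires_inr] at this
      omega
  · simp [getBit, h]

lemma getBit_queryAct_tag (f : (Fin n → Bool) → (Fin l → Bool)) (b : Fin (n + l + w) → Bool)
    (u : Fin l) : getBit (queryAct w f b) (n + u) = xor (getBit b (n + u)) (f (message b) u) := by
  rw [← queryWires_inr (n := n) (w := w) u, getBit_val, getBit_val, queryAct,
    queryWires_injective.extend_apply]
  rfl

end Oracle

/-! ### The branches of the classical attack -/

section Attack

variable {n l w : ℕ}

/-- The message that is zero except for the first bit `v`. -/
def firstBit (n : ℕ) (v : Bool) : Fin n → Bool := fun u => decide (u.val = 0) && v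

/-- The one-hot register holds `p`, the message is `firstBit n v` and the tag is `T`. -/
def AttackState (r p : ℕ) (v : Bool) (T : Fin l → Bool) (b : Fin (n + l + w) → Bool) : Prop :=
  getBit b (n + l) = true ∧ (∀ i < 2 ^ r, getBit b (n + l + 2 ^ r + i) = decide (i = p)) ∧
    (∀ u < n, getBit b u = (decide (u = 0) && v)) ∧ ∀ u : Fin l, getBit b (n + u) = T u

lemma AttackState.x {r p : ℕ} {v : Bool} {T : Fin l → Bool} {b : Fin (n + l + w) → Bool}
    (hn : 0 < n) (h : AttackState r p v T b) : AttackState r p (!v) T (Gate.act (.x 0) b) := by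
  obtain ⟨h1, h2, h3, h4⟩ := h
  have hbit : ∀ u, getBit (Gate.act (.x 0) b) u = _ := Gate.getBit_act_x (by omega) b
  refine ⟨?_, ?_, ?_, ?_⟩
  · have : n + l ≠ 0 := by omega
    rw [hbit, h1, decide_eq_false this]
    simp
  · intro i hi
    have : n + l + 2 ^ r + i ≠ 0 := by omega
    rw [hbit, h2 i hi]
    rw [decide_eq_false this]
    simp
  · intro u hu
    rw [hbit, h3 u hu]
    by_cases h0 : u = 0 <;> simp [h0]
  · intro u
    have : n + u.val ≠ 0 := by omega
    rw [hbit, h4]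
    rw [decide_eq_false this]
    simp

lemma AttackState.cnot {r p i : ℕ} {v : Bool} {T : Fin l → Bool} {b : Fin (n + l + w) → Bool}
    (hn : 0 < n) (hi : i < 2 ^ r) (h : AttackState r p v T b) :
    AttackState r p (xor v (decide (i = p))) T (Gate.act (.cnot (n + l + 2 ^ r + i) 0) b) := by
  obtain ⟨h1, h2, h3, h4⟩ := h
  have hbit : ∀ u, getBit (Gate.act (.cnot (n + l + 2 ^ r + i) 0) b) u = _ :=
    Gate.getBit_act_cnot (by omega) (by omega) b
  refine ⟨?_, ?_, ?_, ?_⟩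
  · have : n + l ≠ 0 := by omega
    rw [hbit, h1, decide_eq_false this]
    simp
  · intro i' hi'
    have : n + l + 2 ^ r + i' ≠ 0 := by omega
    rw [hbit, h2 i' hi']
    rw [decide_eq_false this]
    simp
  · intro u hu
    rw [hbit, h3 u hu, h2 i hi]
    by_cases h0 : u = 0 <;> simp [h0]
  · intro u
    have : n + u.val ≠ 0 := by omega
    rw [hbit, h4]
    rw [decide_eq_false this]
    simp

lemma AttackState.message_eq {r p : ℕ} {v : Bool} {T : Fin l → Bool} {b : Fin (n + l + w) → Bool}
    (h : AttackState r p v T b) : message b = firstBit n v := by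
  ext u
  rw [firstBit, ← h.2.2.1 u u.2, ← queryWires_inl (l := l) (w := w) u, getBit_val]
  rfl

lemma AttackState.query {r p : ℕ} {v : Bool} {T : Fin l → Bool} {b : Fin (n + l + w) → Bool}
    (f : (Fin n → Bool) → (Fin l → Bool)) (h : AttackState r p v T b) :
    AttackState r p v (fun u => xor (T u) (f (firstBit n v) u)) (queryAct w f b) := by
  have hm := h.message_eq
  obtain ⟨h1, h2, h3, h4⟩ := h
  refine ⟨?_, ?_, ?_, ?_⟩
  · rw [getBit_queryAct_of_le f b le_rfl, h1]
  · intro i hi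
    rw [getBit_queryAct_of_le f b (by omega), h2 i hi]
  · intro u hu
    rw [getBit_queryAct_of_lt f b hu, h3 u hu]
  · intro u
    rw [getBit_queryAct_tag, h4, hm]

/-- A superposition of branches with different messages and tags. -/
def AttackStates (w : ℕ) (r : ℕ) (v : ℕ → Bool) (T : ℕ → Fin l → Bool)
    (ψ : Vec (Fin (n + l + w))) : Prop :=
  Branched (2 ^ r) ((Real.sqrt 2 : ℂ)⁻¹ ^ r)
    (fun j φ => ∃ b, φ = ket b ∧ AttackState r j (v j) (T j) b) ψ

/-- The message register is zero with probability at most `2 ^ (-r)`. -/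
def SmallOverlap (n l w r : ℕ) (ψ : Vec (Fin (n + l + w))) : Prop :=
  fidelity (reduced (queryWires n l w ∘ Sum.inl) ψ) (pureState (ket fun _ => false))
    ≤ ((2 ^ r : ℕ) : ℝ)⁻¹

/-- Every branch `j ≠ i` has a one in the first bit of its message, so branch `i` alone can
contribute to the zero message. -/
lemma AttackStates.smallOverlap {r i : ℕ} {v : ℕ → Bool} {T : ℕ → Fin l → Bool}
    {ψ : Vec (Fin (n + l + w))} (hn : 0 < n) (hi : i < 2 ^ r) (hv : ∀ j, j ≠ i → v j = true)
    (h : AttackStates w r v T ψ) : SmallOverlap n l w r ψ := by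
  rw [SmallOverlap, fidelity_reduced_ket (queryWires_injective.comp Sum.inl_injective),
    ← norm_inv_sqrt_two_pow]
  refine Branched.sum_le hi (fun b => b ∘ queryWires n l w ∘ Sum.inl = fun _ => false)
    (h.mono ?_)
  rintro j _ φ ⟨b, rfl, hb⟩
  refine ⟨normSq_ket b, fun hj b' hb' => ?_⟩
  have : b' ≠ b := by
    rintro rfl
    have h1 := hb.message_eq
    rw [hv j hj] at h1
    have h2 := congrFun (h1.symm.trans hb') ⟨0, hn⟩
    simp [firstBit] at h2
  simp [ket, this]

lemma AttackStates.query {r : ℕ} {v : ℕ → Bool} {T : ℕ → Fin l → Bool}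
    {ψ : Vec (Fin (n + l + w))} (f : (Fin n → Bool) → (Fin l → Bool))
    (h : AttackStates w r v T ψ) :
    AttackStates w r v (fun j u => xor (T j u) (f (firstBit n (v j)) u))
      (applyOn (queryWires n l w) (standardOracle f) ψ) := by
  refine h.map (applyOnLin (queryWires n l w) (standardOracle f)) ?_
  rintro j _ _ ⟨b, rfl, hb⟩
  refine ⟨queryAct w f b, ?_, hb.query f⟩
  change applyOn (queryWires n l w) (standardOracle f) (ket b) = _
  rw [applyOn_standardOracle]
  exact ket_comp b (queryAct_involutive f)

/-- The tag in branch `j` after the first `i` queries. -/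
def attackTag (f : (Fin n → Bool) → (Fin l → Bool)) (i j : ℕ) (u : Fin l) : Bool :=
  xor (decide (j < i) && f (firstBit n false) u)
    (decide ((if j < i then i + 1 else i) % 2 = 1) && f (firstBit n true) u)

/-- A branch `j < i` has asked for the other message `i - 1` times. Only the parity matters, so
`attackTag` has `i + 1` there and avoids truncated subtraction. -/
lemma attackTag_succ (f : (Fin n → Bool) → (Fin l → Bool)) (i j : ℕ) (u : Fin l) :
    xor (attackTag f i j u) (f (firstBit n (xor true (decide (i = j)))) u)
      = attackTag f (i + 1) j u := by
  unfold attackTag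
  rcases lt_trichotomy j i with h | h | h
  · have h1 : j < i + 1 := by omega
    have h2 : i ≠ j := by omega
    have h3 : (i + 1 + 1) % 2 = 1 ↔ ¬ (i + 1) % 2 = 1 := by omega
    simp only [h, h1, h2, h3, decide_true, decide_false, if_true, Bool.true_and, Bool.xor_false,
      decide_not]
    cases decide ((i + 1) % 2 = 1) <;> simp
  · subst h
    have h3 : (j + 1 + 1) % 2 = 1 ↔ j % 2 = 1 := by omega
    simp only [lt_irrefl, h3, decide_true, decide_false, if_true, Bool.true_and, if_false,
      Bool.false_and, Bool.false_xor, Nat.lt_succ_self, Bool.xor_true, Bool.not_true]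
    exact Bool.xor_comm _ _
  · have h0 : ¬ j < i := by omega
    have h1 : ¬ j < i + 1 := by omega
    have h2 : i ≠ j := by omega
    have h3 : (i + 1) % 2 = 1 ↔ ¬ i % 2 = 1 := by omega
    simp only [h0, h1, h2, h3, decide_false, if_false, Bool.false_and, Bool.xor_false,
      decide_not, Bool.false_xor]
    cases decide (i % 2 = 1) <;> simp

variable (f : (Fin n → Bool) → (Fin l → Bool))

lemma triple_classicalStep {r i : ℕ} (hn : 0 < n) (hi : i < 2 ^ r) :
    Triple (applyOn (queryWires n l w) (standardOracle f)) (SmallOverlap n l w r)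
      (AttackStates w r (fun _ => false) (attackTag f i)) (classicalStep (n + l) (2 ^ r) i)
      (AttackStates w r (fun _ => false) (attackTag f (i + 1))) := by
  have hcnot : ∀ (v : ℕ → Bool) (T : ℕ → Fin l → Bool) (ψ : Vec (Fin (n + l + w))),
      AttackStates w r v T ψ → AttackStates w r (fun j => xor (v j) (decide (i = j))) T
        ((Gate.cnot (n + l + 2 ^ r + i) 0).apply ψ) := fun v T ψ h =>
    Branched.act (Gate.apply_cnot _ _ |> funext) (fun j _ b hb => hb.cnot hn hi) h
  have hx : ∀ (v : ℕ → Bool) (T : ℕ → Fin l → Bool) (ψ : Vec (Fin (n + l + w))),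
      AttackStates w r v T ψ → AttackStates w r (fun j => !v j) T ((Gate.x 0).apply ψ) :=
    fun v T ψ h => Branched.act (Gate.apply_x _ |> funext) (fun j _ b hb => hb.x hn) h
  refine Triple.gate_cons (hx _ _) (Triple.gate_cons (hcnot _ _)
    (Triple.query_cons (fun ψ h => ⟨h.smallOverlap hn hi ?_, h.query f⟩)
      (Triple.gate_cons (hcnot _ _) (Triple.gate_cons (hx _ _) (Triple.nil fun ψ h => ?_)))))
  · intro j hj
    simp [hj.symm]
  -- The gates after the query undo those before it, so the next round finds a cleared message
  -- register.
  · have e1 : (fun j => !((!false ^^ decide (i = j)) ^^ decide (i = j))) = fun _ => false := by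
      ext j
      simp
    simp only [Bool.not_false, attackTag_succ] at h e1
    rwa [e1] at h

/-- The loop leaves `2 ^ r - 1` copies of the unwanted value in each tag. The last query makes their
number `2 ^ r`, which is even because `r > 0`, so they cancel and all branches hold the same tag. -/
lemma triple_classicalCircuit {r : ℕ} (hn : 0 < n) (hr : 0 < r) (hW : 2 * 2 ^ r ≤ w) :
    Triple (applyOn (queryWires n l w) (standardOracle f)) (SmallOverlap n l w r)
      (fun ψ => ψ = ket fun _ => false) (classicalCircuit n l r)
      (AttackStates w r (fun _ => true) (fun _ => f fun _ => false)) := by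
  rw [classicalCircuit]
  refine (triple_oneHotCircuit _ _ (by omega)).append
    (((Triple.nil (R := AttackStates w r (fun _ => false) (attackTag f 0)) ?_).append
      (Triple.flatMap_range (I := fun i => AttackStates w r (fun _ => false) (attackTag f i))
        fun i hi => triple_classicalStep f hn hi)).append
      (Triple.gate_cons (R := AttackStates w r (fun _ => true) (attackTag f (2 ^ r))) ?_
        -- No branch asks for the challenge in this query, so the choice of the index is arbitrary.
        (Triple.query_cons (fun ψ h => ⟨h.smallOverlap hn (i := 0) (by positivity) (by simp),
          h.query f⟩) (Triple.nil fun ψ h => ?_))))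
  · intro ψ h
    refine h.mono ?_
    rintro j _ φ ⟨b, rfl, h1, h2, h3⟩
    refine ⟨b, rfl, h1, h3, fun u hu => ?_, fun u => ?_⟩
    · rw [h2 u (by omega)]
      simp
    · rw [h2 _ (by omega)]
      simp [attackTag]
  · exact fun ψ h => Branched.act (Gate.apply_x _ |> funext) (fun j _ b hb => hb.x hn) h
  · refine h.mono ?_
    rintro j hj φ ⟨b, rfl, hb⟩
    refine ⟨b, rfl, ?_⟩
    convert hb using 1
    ext u
    have h1 : (2 ^ r + 1) % 2 = 1 := by
      obtain ⟨r', rfl⟩ := Nat.exists_eq_succ_of_ne_zero hr.ne'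
      rw [pow_succ]
      omega
    have h2 : firstBit n false = fun _ => false := by
      ext u
      simp [firstBit]
    simp [attackTag, hj, h1, h2]

lemma normSq_classicalOracle (ψ : Vec (Fin (n + l + w))) :
    normSq (applyOn (queryWires n l w) (standardOracle f) ψ) = normSq ψ := by
  rw [applyOn_standardOracle]
  exact normSq_comp ψ (queryAct_involutive f)

lemma AttackStates.tag_eq {r : ℕ} {v : ℕ → Bool} {t : Fin l → Bool} {ψ : Vec (Fin (n + l + w))}
    (h : AttackStates w r v (fun _ => t) ψ) {b : Fin (n + l + w) → Bool} (hb : ψ b ≠ 0) :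
    b ∘ queryWires n l w ∘ Sum.inr = t := by
  by_contra hne
  apply hb
  obtain ⟨φ, rfl, hφ⟩ := h
  rw [Pi.smul_apply, Finset.sum_apply, Finset.sum_eq_zero, smul_zero]
  intro j hj
  obtain ⟨b', h1, _, _, _, h4⟩ := hφ j (Finset.mem_range.1 hj)
  have : b ≠ b' := by
    rintro rfl
    apply hne
    ext u
    have h4u : getBit b (n + u) = t u := h4 u
    rw [← h4u, ← queryWires_inr (n := n) (w := w) u, getBit_val]
    rfl
  simp [h1, ket, this]

end Attack

/-! ### Width, number of queries, and success of the classical attack -/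

lemma lt_width {g : Gate ℕ} {c : List Instr} (h : Instr.gate g ∈ c) {i : ℕ} (hi : i ∈ g.wires) :
    i < width c := by
  induction c with
  | nil => simp at h
  | cons a c ih =>
    rcases List.mem_cons.1 h with rfl | h'
    · have : ∀ L : List ℕ, i ∈ L → i < L.foldr (fun i m => max (i + 1) m) 0 := by
        intro L
        induction L with
        | nil => simp
        | cons a L ih =>
          intro hL
          simp only [List.foldr_cons, lt_max_iff]
          rcases List.mem_cons.1 hL with rfl | hL
          · exact Or.inl (Nat.lt_succ_self _)
          · exact Or.inr (ih hL)
      exact lt_max_of_lt_left (this _ hi)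
    · cases a with
      | gate g' => exact lt_max_of_lt_right (ih h')
      | query => exact ih h'

/-- The highest wire of the one-hot register is the control in the last round, so the work register
has room for all control wires. -/
lemma le_width_classicalCircuit (n l r : ℕ) :
    2 * 2 ^ r ≤ width (classicalCircuit n l r) := by
  have hr : 0 < 2 ^ r := by positivity
  have : n + l + 2 ^ r + (2 ^ r - 1) < width (classicalCircuit n l r) := by
    refine lt_width (g := .cnot (n + l + 2 ^ r + (2 ^ r - 1)) 0) ?_ (by simp [Gate.wires])
    simp only [classicalCircuit, List.mem_append, List.mem_flatMap, List.mem_range]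
    refine Or.inr (Or.inl ⟨2 ^ r - 1, by omega, ?_⟩)
    simp [classicalStep]
  omega

lemma numQueries_append (c c' : List Instr) :
    numQueries (c ++ c') = numQueries c + numQueries c' := by
  induction c with
  | nil => simp [numQueries]
  | cons a c ih => cases a <;> simp [numQueries, ih]; omega

lemma numQueries_flatMap_range {f : ℕ → List Instr} {q : ℕ} (h : ∀ i, numQueries (f i) = q)
    (k : ℕ) : numQueries ((List.range k).flatMap f) = k * q := by
  induction k with
  | zero => simp [numQueries]
  | succ k ih => simp [List.range_succ, numQueries_append, ih, h, add_mul]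

lemma numQueries_classicalCircuit (n l r : ℕ) :
    numQueries (classicalCircuit n l r) = 2 ^ r + 1 := by
  have h1 : numQueries (oneHotCircuit (n + l) r) = 0 := by
    simp only [oneHotCircuit, numQueries]
    refine (numQueries_flatMap_range (q := 0) (fun t => ?_) r).trans (mul_zero _)
    simp only [oneHotLevel, numQueries]
    exact (numQueries_flatMap_range (q := 0) (fun i => rfl) _).trans (mul_zero _)
  rw [classicalCircuit, numQueries_append, numQueries_append, h1,
    numQueries_flatMap_range (q := 1) (fun i => rfl)]
  simp [numQueries]

/-- Correctness of a primitive is known only on the support of the setup; other keys have weight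
zero. -/
lemma tsum_toReal_mul_eq_one {K : Type} (p : PMF K) {g : K → ℝ} (h : ∀ k ∈ p.support, g k = 1) :
    ∑' k, (p k).toReal * g k = 1 := by
  have : ∀ k, (p k).toReal * g k = (p k).toReal := by
    intro k
    by_cases hk : k ∈ p.support
    · rw [h k hk, mul_one]
    · rw [PMF.mem_support_iff, not_not] at hk
      simp [hk]
  simp only [this]
  rw [← ENNReal.tsum_toReal_eq (fun k => p.apply_ne_top k), p.tsum_coe, ENNReal.toReal_one]

lemma ClassicalPrimitive.winProb_eq_one (F : ClassicalPrimitive) {μ : ℝ} {s r : ℕ} {c : Config}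
    (hr : 0 < r) (hμ : ((2 ^ r : ℕ) : ℝ)⁻¹ ≤ 1 - μ) (hbits : c.challengeBits = [])
    (hc : c.circuit = classicalCircuit (F.msgLen s) (F.tagLen s) r) : F.winProb μ s c = 1 := by
  refine tsum_toReal_mul_eq_one _ fun k hk => ?_
  have hm : challengeMsg (F.msgLen s) c.challengeBits = fun _ => false := by
    ext i
    simp [challengeMsg, hbits]
  obtain ⟨h1, h2⟩ := triple_classicalCircuit (F.eval s k) (F.msgLen_pos s) hr
    (w := width c.circuit) (by rw [hc]; exact le_width_classicalCircuit _ _ _) _ rfl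
  have h3 := normSq_run (normSq_classicalOracle (w := width c.circuit) (F.eval s k)) c.circuit
    (ket fun _ => false)
  rw [normSq_ket] at h3
  rw [← hc] at h1 h2
  rw [ClassicalPrimitive.winProbKey]
  simp only [hm]
  rw [if_pos]
  -- The winning probability is compared with the squared norm of the final state: where the
  -- verification rejects, the amplitude is zero.
  · rw [← h3, normSq]
    refine Finset.sum_congr rfl fun b _ => ?_
    split_ifs with hv
    · rfl
    · by_cases hb : (run (applyOn (queryWires (F.msgLen s) (F.tagLen s) (width c.circuit))
          (standardOracle (F.eval s k))) c.circuit (ket fun _ => false)).2 b = 0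
      · rw [hb]
        simp
      · rw [h2.tag_eq hb, F.correct s k hk] at hv
        exact absurd rfl hv
  · intro ψ hψ
    have h4 := h1 ψ hψ
    rw [SmallOverlap] at h4
    refine ⟨fidelity_nonneg _ _, (le_of_eq ?_).trans (h4.trans hμ)⟩
    congr!

/-! ### Product states of blocks of qubits -/

section Blocks

variable {W n : ℕ}

/-- The bits of block `m`. -/
def block (n m : ℕ) (b : Fin W → Bool) : Fin n → Bool := fun u => getBit b (m * n + u)

/-- The bits after the `K` blocks of `n` bits agree. -/
def SameControl (n K : ℕ) (B b : Fin W → Bool) : Prop :=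
  ∀ v, K * n ≤ v → getBit b v = getBit B v

open Classical in
/-- The block `m` is in the state `V m`, and the qubits after the `K` blocks are in a basis
state. -/
def blockState (K : ℕ) (B : Fin W → Bool) (V : ℕ → Vec (Fin n)) : Vec (Fin W) := fun b =>
  if SameControl n K B b then ∏ m ∈ Finset.range K, V m (block n m b) else 0

lemma prod_range_eq_zero_mul {K : ℕ} (hK : 0 < K) (f : ℕ → ℂ) :
    ∏ m ∈ Finset.range K, f m = f 0 * ∏ m ∈ Finset.range (K - 1), f (m + 1) := by
  obtain ⟨K, rfl⟩ := Nat.exists_eq_succ_of_ne_zero hK.ne'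
  rw [Finset.prod_range_succ', mul_comm]
  rfl

lemma block_lt {K m : ℕ} (hm : m < K) (u : Fin n) : m * n + u < K * n := by
  have : (m + 1) * n ≤ K * n := Nat.mul_le_mul_right n hm
  rw [add_mul] at this
  omega

lemma le_block {m : ℕ} (hm : 0 < m) (u : Fin n) : n ≤ m * n + u :=
  (Nat.le_mul_of_pos_left n hm).trans (Nat.le_add_right _ _)

lemma block_congr {m : ℕ} {b b' : Fin W → Bool}
    (h : ∀ u : Fin n, getBit b (m * n + u) = getBit b' (m * n + u)) : block n m b = block n m b' :=
  funext h

lemma block_zero_eq_firstBit_iff {b b' : Fin W → Bool} {t v : Bool}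
    (h : ∀ w, getBit b' w = xor (getBit b w) (decide (w = 0) && t)) :
    block n 0 b' = firstBit n v ↔ block n 0 b = firstBit n (xor v t) := by
  simp only [funext_iff, block, firstBit, zero_mul, zero_add, h]
  refine forall_congr' fun u => ?_
  by_cases hu : u.val = 0
  · simp only [hu, decide_true, Bool.true_and]
    cases getBit b 0 <;> cases t <;> cases v <;> simp
  · simp [hu]

/-- Flipping the first qubit of block `0` if it is in a basis state. -/
lemma blockState_flip {K : ℕ} (hn : 0 < n) (hK : 0 < K) {B : Fin W → Bool}
    {V : ℕ → Vec (Fin n)} {v t : Bool} (hV : V 0 = ket (firstBit n v))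
    {p : (Fin W → Bool) → (Fin W → Bool)} {s : (Fin W → Bool) → Bool}
    (hp : ∀ b w, getBit (p b) w = xor (getBit b w) (decide (w = 0) && s b))
    (hs : ∀ b, SameControl n K B b → s b = t) :
    (fun b => blockState K B V (p b))
      = blockState K B (Function.update V 0 (ket (firstBit n (xor v t)))) := by
  have hne : ∀ b w, w ≠ 0 → getBit (p b) w = getBit b w := by
    intro b w hw
    rw [hp, decide_eq_false hw]
    simp
  have hKn : 0 < K * n := Nat.mul_pos hK hn
  have hc : ∀ b, SameControl n K B (p b) ↔ SameControl n K B b := by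
    intro b
    refine forall_congr' fun v => imp_congr_right fun hv => ?_
    rw [hne b v (by omega)]
  ext b
  by_cases hb : SameControl n K B b
  · rw [blockState, blockState, if_pos ((hc b).2 hb), if_pos hb, prod_range_eq_zero_mul hK,
      prod_range_eq_zero_mul hK]
    congr 1
    · rw [hV, Function.update_self]
      simp only [ket]
      have hiff : block n 0 (p b) = firstBit n v ↔ block n 0 b = firstBit n (xor v t) :=
        block_zero_eq_firstBit_iff fun w => by rw [hp, hs b hb]
      simp only [hiff]
    · refine Finset.prod_congr rfl fun m _ => ?_
      rw [Function.update_of_ne (Nat.succ_ne_zero m)]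
      congr 1
      refine block_congr fun u => hne b _ ?_
      have : n ≤ (m + 1) * n + u := le_block m.succ_pos u
      omega
  · rw [blockState, blockState, if_neg (mt (hc b).1 hb), if_neg hb]

/-- The wires `u` and `y + u` with `u < k` trade places. -/
def swapWire (y k v : ℕ) : ℕ :=
  if v < k then y + v else if y ≤ v ∧ v < y + k then v - y else v

/-- Exchange of the first `k` wires with those from `y` on, controlled by the wire `c`. -/
def swapBits (c y k : ℕ) (b : Fin W → Bool) : Fin W → Bool := fun v =>
  if getBit b c then getBit b (swapWire y k v) else b v

/-- The gates that exchange the wires `k` and `y + k`, controlled by the wire `c`. -/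
def swapStep (c y k : ℕ) : List (Gate ℕ) :=
  [.cnot (y + k) k, .ccx c k (y + k), .cnot (y + k) k]

/-- The circuit that exchanges the first `n` wires with those from `y` on, controlled by the
wire `c`. -/
def swapCircuit (n c y : ℕ) : List Instr :=
  (List.range n).flatMap fun k => (swapStep c y k).map .gate

lemma getBit_swapBits (c y k : ℕ) (b : Fin W → Bool) {v : ℕ} (hv : v < W) :
    getBit (swapBits c y k b) v = if getBit b c then getBit b (swapWire y k v) else getBit b v := by
  rw [getBit_of_lt _ hv, swapBits, getBit_of_lt b hv]

/-- If the control is zero the two outer gates cancel; if it is one, three alternating controlled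
NOT gates exchange the two bits. -/
lemma getBit_swapStep {c y k : ℕ} (hc : c ≠ k) (hcy : c ≠ y + k) (hy : 0 < y) (hW : y + k < W)
    (b : Fin W → Bool) (v : ℕ) :
    getBit (Gate.act (.cnot (y + k) k) (Gate.act (.ccx c k (y + k))
      (Gate.act (.cnot (y + k) k) b))) v
      = if getBit b c then getBit b (if v = k then y + k else if v = y + k then k else v)
        else getBit b v := by
  have h1 : y + k ≠ k := by omega
  have h2 : k ≠ y + k := by omega
  simp only [Gate.getBit_act_cnot (show k < W by omega) h1, Gate.getBit_act_ccx hW hcy h2]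
  by_cases e1 : v = k
  · subst e1
    simp only [h2, h1, hc, decide_true, decide_false, Bool.true_and, Bool.false_and, if_true,
      Bool.xor_false]
    cases getBit b v <;> cases getBit b (y + v) <;> cases getBit b c <;> rfl
  · by_cases e2 : v = y + k
    · subst e2
      simp only [h1, hc, decide_true, decide_false, Bool.true_and, Bool.false_and, if_true,
        if_false, Bool.xor_false]
      cases getBit b k <;> cases getBit b (y + k) <;> cases getBit b c <;> rfl
    · simp [e1, e2]

/-- Gates act by precomposition, so the exchange made last stands innermost. The control lies
outside the exchanged wires and keeps its value throughout. -/
lemma swapBits_succ {c y k : ℕ} (hc : k < c) (hcy : c < y ∨ y + k < c) (hy : k < y)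
    (hW : y + k < W) (b : Fin W → Bool) :
    swapBits c y (k + 1) b = swapBits c y k (Gate.act (.cnot (y + k) k)
      (Gate.act (.ccx c k (y + k)) (Gate.act (.cnot (y + k) k) b))) := by
  refine getBit_ext fun v hv => ?_
  have hbit := getBit_swapStep (c := c) (y := y) (k := k) (by omega) (by omega) (by omega) hW b
  rw [getBit_swapBits _ _ _ _ hv, getBit_swapBits _ _ _ _ hv, hbit, hbit, hbit]
  have e1 : c ≠ k := by omega
  have e2 : c ≠ y + k := by omega
  simp only [e1, e2, if_false, ite_self]
  cases hbc : getBit b c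
  · simp
  · simp only [if_true]
    congr 1
    simp only [swapWire]
    split_ifs <;> omega

lemma swapBits_zero (c y : ℕ) (b : Fin W → Bool) : swapBits c y 0 b = b := by
  refine getBit_ext fun v hv => ?_
  rw [getBit_swapBits _ _ _ _ hv]
  have : swapWire y 0 v = v := by
    simp only [swapWire]
    split_ifs <;> omega
  rw [this, ite_self]

lemma swapWire_block {m₀ m : ℕ} (hm₀ : 0 < m₀) (u : Fin n) :
    swapWire (m₀ * n) n (m * n + u) = Equiv.swap 0 m₀ m * n + u := by
  have hu := u.2
  rcases Nat.eq_zero_or_pos m with rfl | hm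
  · rw [Equiv.swap_apply_left, swapWire, if_pos (by omega)]
    omega
  · have h1 := le_block hm u
    rw [swapWire, if_neg (by omega)]
    rcases lt_trichotomy m m₀ with h | h | h
    · have h2 := block_lt h u
      rw [Equiv.swap_apply_of_ne_of_ne hm.ne' h.ne, if_neg (by omega)]
    · subst h
      rw [Equiv.swap_apply_right, if_pos (by omega)]
      omega
    · have h2 : (m₀ + 1) * n ≤ m * n := Nat.mul_le_mul_right n h
      rw [add_mul] at h2
      rw [Equiv.swap_apply_of_ne_of_ne hm.ne' h.ne', if_neg (by omega)]

/-- A controlled exchange of block `0` with another block. -/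
lemma blockState_swapBits {K m₀ c : ℕ} (hm₀ : 0 < m₀) (hm : m₀ < K) (hc : K * n ≤ c)
    (hKW : K * n ≤ W) (B : Fin W → Bool) (V : ℕ → Vec (Fin n)) :
    (fun b => blockState K B V (swapBits c (m₀ * n) n b))
      = blockState K B (if getBit B c then V ∘ Equiv.swap 0 m₀ else V) := by
  have hctl : ∀ (b : Fin W → Bool) v, K * n ≤ v →
      getBit (swapBits c (m₀ * n) n b) v = getBit b v := by
    intro b v hv
    by_cases hvW : v < W
    · have h2 : (m₀ + 1) * n ≤ K * n := Nat.mul_le_mul_right n hm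
      have h3 : n ≤ m₀ * n := Nat.le_mul_of_pos_left n hm₀
      rw [add_mul] at h2
      have hsw : swapWire (m₀ * n) n v = v := by
        simp only [swapWire]
        split_ifs <;> omega
      rw [getBit_swapBits _ _ _ _ hvW, hsw, ite_self]
    · simp [getBit, hvW]
  ext b
  have hiff : SameControl n K B (swapBits c (m₀ * n) n b) ↔ SameControl n K B b := by
    refine forall_congr' fun v => imp_congr_right fun hv => ?_
    rw [hctl b v hv]
  by_cases hb : SameControl n K B b
  swap
  · rw [blockState, blockState, if_neg (mt hiff.1 hb), if_neg hb]
  rw [blockState, blockState, if_pos (hiff.2 hb), if_pos hb]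
  have hbc := hb c hc
  cases hBc : getBit B c
  · rw [hBc] at hbc
    simp only [Bool.false_eq_true, if_false]
    refine Finset.prod_congr rfl fun m hm' => ?_
    congr 1
    refine block_congr fun u => ?_
    rw [getBit_swapBits _ _ _ _ ((block_lt (Finset.mem_range.1 hm') u).trans_le hKW), hbc]
    simp
  · rw [hBc] at hbc
    simp only [if_true, Function.comp_apply]
    refine Finset.prod_equiv (Equiv.swap 0 m₀) (fun m => ?_) (fun m hm' => ?_)
    · simp only [Finset.mem_range]
      rcases eq_or_ne m 0 with rfl | h1
      · simp [hm, hm₀.trans hm]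
      · rcases eq_or_ne m m₀ with rfl | h2
        · simp [hm, hm₀.trans hm]
        · rw [Equiv.swap_apply_of_ne_of_ne h1 h2]
    · rw [Equiv.swap_apply_self]
      congr 1
      ext u
      rw [block, block, getBit_swapBits _ _ _ _ ((block_lt (Finset.mem_range.1 hm') u).trans_le hKW),
        hbc, if_pos rfl, swapWire_block hm₀]

end Blocks

/-! ### The oracle on product states of blocks -/

section Query

variable {n k w : ℕ}

lemma quantumQueryWires_injective : Function.Injective (quantumQueryWires n k w) := fun _ _ h =>
  Fin.castAdd_injective _ _ (Fin.castAdd_injective _ _ h)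

lemma comp_quantumQueryWires (b : Fin (n + k * n + w) → Bool) :
    b ∘ quantumQueryWires n k w = block n 0 b := by
  ext u
  rw [Function.comp_apply, ← getBit_val b]
  simp [quantumQueryWires, block]

lemma getBit_extend_quantumQueryWires (x : Fin n → Bool) (b : Fin (n + k * n + w) → Bool) {v : ℕ}
    (hv : n ≤ v) : getBit (Function.extend (quantumQueryWires n k w) x b) v = getBit b v := by
  by_cases h : v < n + k * n + w
  · rw [getBit_of_lt _ h, getBit_of_lt _ h, Function.extend_apply']
    rintro ⟨u, hu⟩
    have := congrArg Fin.val hu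
    simp only [quantumQueryWires, Fin.val_castAdd] at this
    omega
  · simp [getBit, h]

/-- Block `0` is the query register, and no other factor depends on its bits. -/
lemma applyOn_blockState {K : ℕ} (hK : 0 < K) (U : Op (Fin n)) (B : Fin (n + k * n + w) → Bool)
    (V : ℕ → Vec (Fin n)) :
    applyOn (quantumQueryWires n k w) U (blockState K B V)
      = blockState K B (Function.update V 0 (U.mulVec (V 0))) := by
  ext b
  rw [applyOn_eq quantumQueryWires_injective]
  have hiff : ∀ x, SameControl n K B (Function.extend (quantumQueryWires n k w) x b)
      ↔ SameControl n K B b := by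
    intro x
    refine forall_congr' fun v => imp_congr_right fun hv => ?_
    rw [getBit_extend_quantumQueryWires]
    exact (Nat.le_mul_of_pos_left n hK).trans hv
  by_cases hb : SameControl n K B b
  · simp only [blockState, hiff, hb, if_true]
    rw [prod_range_eq_zero_mul hK, Function.update_self, Matrix.mulVec, dotProduct, Finset.sum_mul]
    refine Finset.sum_congr rfl fun x _ => ?_
    rw [prod_range_eq_zero_mul hK, comp_quantumQueryWires, mul_assoc]
    congr 2
    · rw [← comp_quantumQueryWires, Function.extend_comp quantumQueryWires_injective]
    · refine Finset.prod_congr rfl fun m _ => ?_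
      rw [Function.update_of_ne (Nat.succ_ne_zero m)]
      congr 1
      exact block_congr fun u => getBit_extend_quantumQueryWires _ _ (le_block m.succ_pos u)
  · simp [blockState, hiff, hb]

end Query

/-! ### The attack on quantum primitives -/

/-- Number of blocks of `n` qubits in the attack: the query register, `k` forgery blocks, and a
block for each of the `k * N` queries. -/
abbrev numBlocks (k N : ℕ) : ℕ := 1 + k + k * N

/-- One query of the attack: in branch `i` the output is moved to the forgery block `β`, in the
other branches it is discarded. -/
def quantumStep (n k N β i : ℕ) : List Instr :=
  [.gate (.x 0), .gate (.cnot (numBlocks k N * n + N + i) 0), .query] ++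
    (swapCircuit n (numBlocks k N * n + N + i) ((1 + β) * n) ++
      swapCircuit n (numBlocks k N * n) ((1 + k + (β * N + i)) * n))

/-- The circuit of the attack on a quantum primitive. -/
def quantumCircuit (n k r : ℕ) : List Instr :=
  oneHotCircuit (numBlocks k (2 ^ r) * n) r ++ (List.range k).flatMap fun β =>
    (List.range (2 ^ r)).flatMap (quantumStep n k (2 ^ r) β)

/-! ### The branches of the quantum attack -/

section Attack

variable {n k r w : ℕ}

/-- In branch `j`, the query register is in the state `X j` and the forgery block `β` in the state
`Y j β`. The first `d` blocks for discarded states are in use. -/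
def QState (n k r w : ℕ) (X : ℕ → Vec (Fin n)) (Y : ℕ → ℕ → Vec (Fin n)) (d : ℕ)
    (j : ℕ) (φ : Vec (Fin (n + k * n + w))) : Prop :=
  ∃ B V, Hot (numBlocks k (2 ^ r) * n) (2 ^ r) j B ∧ φ = blockState (numBlocks k (2 ^ r)) B V ∧
    V 0 = X j ∧ (∀ β < k, V (1 + β) = Y j β) ∧
    ∀ m, d ≤ m → m < k * 2 ^ r → V (1 + k + m) = ket fun _ => false

/-- A superposition of branches with different states of the blocks. -/
def QStates (n k r w : ℕ) (X : ℕ → Vec (Fin n)) (Y : ℕ → ℕ → Vec (Fin n)) (d : ℕ) :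
    Vec (Fin (n + k * n + w)) → Prop :=
  Branched (2 ^ r) ((Real.sqrt 2 : ℂ)⁻¹ ^ r) fun j φ => normSq φ = 1 ∧ QState n k r w X Y d j φ

variable {X : ℕ → Vec (Fin n)} {Y : ℕ → ℕ → Vec (Fin n)} {d : ℕ}

lemma firstBit_false : firstBit n false = fun _ => false := by
  ext u
  simp [firstBit]

/-- Covers both NOT and controlled NOT on the first wire: `s` is the control as read from a basis
state and `t j` its value throughout branch `j`. -/
lemma QStates.flip (hn : 0 < n) {v t : ℕ → Bool} {g : Gate ℕ}
    {ψ : Vec (Fin (n + k * n + w))} {s : (Fin (n + k * n + w) → Bool) → Bool}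
    (hg : ∀ φ : Vec (Fin (n + k * n + w)), g.apply φ = fun b => φ (Gate.act g b))
    (hact : ∀ (b : Fin (n + k * n + w) → Bool) u,
      getBit (Gate.act g b) u = xor (getBit b u) (decide (u = 0) && s b))
    (hs : ∀ j < 2 ^ r, ∀ B b, Hot (numBlocks k (2 ^ r) * n) (2 ^ r) j B →
      SameControl n (numBlocks k (2 ^ r)) B b → s b = t j)
    (h : QStates n k r w (fun j => ket (firstBit n (v j))) Y d ψ) :
    QStates n k r w (fun j => ket (firstBit n (xor (v j) (t j)))) Y d (g.apply ψ) := by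
  refine h.map g.lin ?_
  rintro j hj φ ⟨hφ, B, V, hB, rfl, h0, h1, h2⟩
  refine ⟨(Gate.normSq_apply g _).trans hφ, B, Function.update V 0 _, hB, ?_, Function.update_self _ _ _, ?_, ?_⟩
  · exact (hg _).trans (blockState_flip hn (by positivity) h0 hact fun b hb => hs j hj B b hB hb)
  · intro β hβ
    rw [Function.update_of_ne (by omega), h1 β hβ]
  · intro m hm hm'
    rw [Function.update_of_ne (by omega), h2 m hm hm']

lemma QStates.query {ψ : Vec (Fin (n + k * n + w))} (U : Matrix.unitaryGroup (Fin n → Bool) ℂ)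
    (h : QStates n k r w X Y d ψ) :
    QStates n k r w (fun j => (U : Op (Fin n)).mulVec (X j)) Y d
      (applyOn (quantumQueryWires n k w) (U : Op (Fin n)) ψ) := by
  refine h.map (applyOnLin (quantumQueryWires n k w) (U : Op (Fin n))) ?_
  rintro j hj φ ⟨hφ, B, V, hB, rfl, h0, h1, h2⟩
  refine ⟨(normSq_applyOn quantumQueryWires_injective U _).trans hφ, B, _, hB,
    applyOn_blockState (by positivity) _ _ _, ?_, ?_, ?_⟩
  · rw [Function.update_self, h0]
  · intro β hβ
    rw [Function.update_of_ne (by omega), h1 β hβ]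
  · intro m hm hm'
    rw [Function.update_of_ne (by omega), h2 m hm hm']

/-- The effect of a controlled exchange on the branches of a superposition. -/
lemma triple_swapCircuit {W c y N : ℕ} {a : ℂ} (O : Vec (Fin W) → Vec (Fin W))
    (Q : Vec (Fin W) → Prop) {P R : ℕ → Vec (Fin W) → Prop} (hc : n ≤ c)
    (hcy : c < y ∨ y + n ≤ c) (hy : n ≤ y) (hW : y + n ≤ W)
    (h : ∀ j < N, ∀ φ, P j φ → R j fun b => φ (swapBits c y n b)) :
    Triple O Q (Branched N a fun j φ => normSq φ = 1 ∧ P j φ) (swapCircuit n c y)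
      (Branched N a fun j φ => normSq φ = 1 ∧ R j φ) := by
  -- Halfway through an exchange the blocks are mixed, so the invariant keeps the initial branch
  -- composed with the partial exchange and uses `h` only at the end.
  have key := Triple.flatMap_range (O := O) (Q := Q) (k := n)
    (f := fun k => (swapStep c y k).map .gate)
    (I := fun k => Branched N a fun j φ => normSq φ = 1 ∧
      ∃ φ', P j φ' ∧ φ = fun b => φ' (swapBits c y k b)) ?_
  · have h0 : Triple O Q (Branched N a fun j φ => normSq φ = 1 ∧ P j φ) []
        (Branched N a fun j φ => normSq φ = 1 ∧
          ∃ φ', P j φ' ∧ φ = fun b => φ' (swapBits c y 0 b)) := by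
      refine Triple.nil fun ψ hψ => hψ.mono ?_
      rintro j hj φ ⟨hφ, hP⟩
      exact ⟨hφ, φ, hP, by simp only [swapBits_zero]⟩
    refine (h0.append key).mono_post fun ψ hψ => hψ.mono ?_
    rintro j hj φ ⟨hφ, φ', hP, rfl⟩
    exact ⟨hφ, h j hj φ' hP⟩
  · intro k hk ψ hψ
    have hrun : run O ((swapStep c y k).map .gate) ψ
        = ([], ((Gate.cnot (y + k) k).lin ∘ₗ (Gate.ccx c k (y + k)).lin ∘ₗ
          (Gate.cnot (y + k) k).lin) ψ) := by
      simp only [swapStep, List.map_cons, List.map_nil, run, LinearMap.comp_apply, Gate.lin_apply]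
    rw [hrun]
    refine ⟨by simp, hψ.map _ ?_⟩
    rintro j hj _ ⟨hφ, φ', hP, rfl⟩
    simp only [LinearMap.comp_apply, Gate.lin_apply, Gate.normSq_apply]
    refine ⟨hφ, φ', hP, ?_⟩
    rw [Gate.apply_cnot, Gate.apply_ccx, Gate.apply_cnot]
    ext b
    rw [swapBits_succ (by omega) (by omega) (by omega) (by omega)]

lemma block_add_le {m K : ℕ} (hm : m < K) : m * n + n ≤ K * n := by
  have : (m + 1) * n ≤ K * n := Nat.mul_le_mul_right n hm
  rwa [add_mul, one_mul] at this

variable (O : Vec (Fin (n + k * n + w)) → Vec (Fin (n + k * n + w)))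
  (Q : Vec (Fin (n + k * n + w)) → Prop)

/-- The control is wire `i` of the one-hot register, which is one in branch `i` only. There the
query register receives the former content of the forgery block. -/
lemma triple_moveToForgery {β i : ℕ} (hβ : β < k) (hi : i < 2 ^ r)
    (hW : numBlocks k (2 ^ r) * n + 2 * 2 ^ r ≤ n + k * n + w) :
    Triple O Q (QStates n k r w X Y d)
      (swapCircuit n (numBlocks k (2 ^ r) * n + 2 ^ r + i) ((1 + β) * n))
      (QStates n k r w (fun j => if i = j then Y j β else X j)
        (fun j β' => if i = j ∧ β' = β then X j else Y j β') d) := by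
  have hK : 1 + β < numBlocks k (2 ^ r) := by
    simp only [numBlocks]
    omega
  have hle := block_add_le (n := n) hK
  have hn1 : n ≤ (1 + β) * n := Nat.le_mul_of_pos_left n (by omega)
  refine triple_swapCircuit O Q (by omega) (Or.inr (by omega)) hn1 (by omega) ?_
  rintro j hj _ ⟨B, V, hB, rfl, h0, h1, h2⟩
  refine ⟨B, _, hB, blockState_swapBits (by omega) hK (by omega) (by omega) B V, ?_, ?_, ?_⟩
  · rw [hB.2.2 i hi]
    by_cases hij : i = j
    · simp [hij, h1 β hβ]
    · simp [hij, h0]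
  · intro β' hβ'
    rw [hB.2.2 i hi]
    by_cases hij : i = j
    · by_cases hββ : β' = β
      · simp [hij, hββ, h0]
      · have : Equiv.swap 0 (1 + β) (1 + β') = 1 + β' :=
          Equiv.swap_apply_of_ne_of_ne (by omega) (by omega)
        simp [hij, hββ, this, h1 β' hβ']
    · simp [hij, h1 β' hβ']
  · intro m hm hm'
    have : Equiv.swap 0 (1 + β) (1 + k + m) = 1 + k + m :=
      Equiv.swap_apply_of_ne_of_ne (by omega) (by omega)
    split_ifs
    · rw [Function.comp_apply, this, h2 m hm hm']
    · exact h2 m hm hm'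

/-- The control is the constant wire, so the exchange takes place in all branches. It resets the
query register by means of a fresh zero block, and the discarded state is kept, as a unitary circuit
cannot erase it. -/
lemma triple_discard (hd : d < k * 2 ^ r)
    (hW : numBlocks k (2 ^ r) * n + 2 * 2 ^ r ≤ n + k * n + w) :
    Triple O Q (QStates n k r w X Y d)
      (swapCircuit n (numBlocks k (2 ^ r) * n) ((1 + k + d) * n))
      (QStates n k r w (fun _ => ket fun _ => false) Y (d + 1)) := by
  have hK : 1 + k + d < numBlocks k (2 ^ r) := by
    simp only [numBlocks]
    omega
  have hle := block_add_le (n := n) hK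
  have hn1 : n ≤ (1 + k + d) * n := Nat.le_mul_of_pos_left n (by omega)
  refine triple_swapCircuit O Q (by omega) (Or.inr (by omega)) hn1 (by omega) ?_
  rintro j hj _ ⟨B, V, hB, rfl, h0, h1, h2⟩
  refine ⟨B, _, hB, blockState_swapBits (by omega) hK le_rfl (by omega) B V, ?_, ?_, ?_⟩
  · rw [hB.1]
    simp [h2 d le_rfl hd]
  · intro β' hβ'
    have : Equiv.swap 0 (1 + k + d) (1 + β') = 1 + β' :=
      Equiv.swap_apply_of_ne_of_ne (by omega) (by omega)
    rw [hB.1]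
    simp [this, h1 β' hβ']
  · intro m hm hm'
    have : Equiv.swap 0 (1 + k + d) (1 + k + m) = 1 + k + m :=
      Equiv.swap_apply_of_ne_of_ne (by omega) (by omega)
    rw [hB.1]
    simp [this, h2 m (by omega) hm']

/-- The query register is zero with probability at most `2 ^ (-r)`. -/
def SmallQuantumOverlap (n k r w : ℕ) (ψ : Vec (Fin (n + k * n + w))) : Prop :=
  fidelity (reduced (quantumQueryWires n k w) ψ) (pureState (ket fun _ => false))
    ≤ ((2 ^ r : ℕ) : ℝ)⁻¹

lemma QStates.smallOverlap {i : ℕ} {v : ℕ → Bool} {ψ : Vec (Fin (n + k * n + w))} (hn : 0 < n)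
    (hi : i < 2 ^ r) (hv : ∀ j, j ≠ i → v j = true)
    (h : QStates n k r w (fun j => ket (firstBit n (v j))) Y d ψ) :
    SmallQuantumOverlap n k r w ψ := by
  rw [SmallQuantumOverlap, fidelity_reduced_ket quantumQueryWires_injective,
    ← norm_inv_sqrt_two_pow]
  refine Branched.sum_le hi (fun b => b ∘ quantumQueryWires n k w = fun _ => false)
    (h.mono ?_)
  rintro j _ φ ⟨hφ, B, V, hB, rfl, h0, h1, h2⟩
  refine ⟨hφ, fun hj b' hb' => ?_⟩
  rw [comp_quantumQueryWires] at hb'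
  rw [blockState]
  split_ifs
  · rw [prod_range_eq_zero_mul (by positivity), h0]
    simp only [hb', hv j hj]
    have : (fun _ => false) ≠ firstBit n true := by
      intro h
      have := congrFun h ⟨0, hn⟩
      simp [firstBit] at this
    simp [ket, this]
  · rfl

/-- The state of the forgery block `β'` in branch `j` when the queries for the blocks before `β` and
the first `i` queries for the block `β` have been made. -/
def forgeryState (v : Vec (Fin n)) (β i j β' : ℕ) : Vec (Fin n) :=
  if β' < β ∨ β' = β ∧ j < i then v else ket fun _ => false

lemma triple_quantumStep (U : Matrix.unitaryGroup (Fin n → Bool) ℂ) {β i : ℕ} (hn : 0 < n)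
    (hβ : β < k) (hi : i < 2 ^ r)
    (hW : numBlocks k (2 ^ r) * n + 2 * 2 ^ r ≤ n + k * n + w) :
    Triple (applyOn (quantumQueryWires n k w) (U : Op (Fin n))) (SmallQuantumOverlap n k r w)
      (QStates n k r w (fun _ => ket fun _ => false)
        (forgeryState ((U : Op (Fin n)).mulVec (ket fun _ => false)) β i) (β * 2 ^ r + i))
      (quantumStep n k (2 ^ r) β i)
      (QStates n k r w (fun _ => ket fun _ => false)
        (forgeryState ((U : Op (Fin n)).mulVec (ket fun _ => false)) β (i + 1))
        (β * 2 ^ r + (i + 1))) := by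
  set v := (U : Op (Fin n)).mulVec (ket fun _ => false)
  have hd : β * 2 ^ r + i < k * 2 ^ r := by
    have : (β + 1) * 2 ^ r ≤ k * 2 ^ r := Nat.mul_le_mul_right _ hβ
    rw [add_mul] at this
    omega
  have hKn : 0 < numBlocks k (2 ^ r) * n := by positivity
  rw [quantumStep]
  refine Triple.append (R := QStates n k r w
      (fun j => (U : Op (Fin n)).mulVec (ket (firstBit n (xor true (decide (i = j))))))
      (forgeryState v β i) (β * 2 ^ r + i)) ?_
    (((triple_moveToForgery _ _ hβ hi hW).append (triple_discard _ _ hd hW)).mono_post ?_)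
  · refine Triple.gate_cons (R := QStates n k r w (fun _ => ket (firstBit n true))
      (forgeryState v β i) (β * 2 ^ r + i)) (fun ψ h => ?_)
      (Triple.gate_cons (R := QStates n k r w
        (fun j => ket (firstBit n (xor true (decide (i = j))))) (forgeryState v β i)
          (β * 2 ^ r + i)) (fun ψ h => ?_)
      (Triple.query_cons (fun ψ h => ⟨h.smallOverlap hn hi ?_, h.query U⟩)
        (Triple.nil fun ψ h => h)))
    · rw [← firstBit_false] at h
      exact QStates.flip hn (v := fun _ => false) (t := fun _ => true) (s := fun _ => true)
        (Gate.apply_x 0) (fun b u => by rw [Gate.getBit_act_x (by omega), Bool.and_true])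
        (fun _ _ _ _ _ _ => rfl) h
    · exact QStates.flip hn (v := fun _ => true)
        (s := fun b => getBit b (numBlocks k (2 ^ r) * n + 2 ^ r + i)) (Gate.apply_cnot _ 0)
        (Gate.getBit_act_cnot (by omega) (by omega))
        (fun j _ B b hB hb => by rw [hb _ (by omega), hB.2.2 i hi]) h
    · intro j hj
      simp [hj.symm]
  · intro ψ h
    have : (fun j β' => if i = j ∧ β' = β then
        (U : Op (Fin n)).mulVec (ket (firstBit n (xor true (decide (i = j)))))
          else forgeryState v β i j β') = forgeryState v β (i + 1) := by
      ext j β' : 2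
      by_cases hij : i = j ∧ β' = β
      · have h1 : β' < β ∨ β' = β ∧ j < i + 1 := by omega
        have h2 : xor true (decide (i = j)) = false := by simp [hij.1]
        rw [if_pos hij, forgeryState, if_pos h1, h2, firstBit_false]
      · have h1 : (β' < β ∨ β' = β ∧ j < i + 1) ↔ (β' < β ∨ β' = β ∧ j < i) := by omega
        rw [if_neg hij, forgeryState, forgeryState]
        simp only [h1]
    rw [this] at h
    exact h

lemma blockState_ket {K : ℕ} {b : Fin w → Bool} (hb : ∀ v < K * n, getBit b v = false) :
    ket b = blockState K b fun _ : ℕ => ket (fun _ : Fin n => false) := by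
  ext b'
  have hblock : ∀ m < K, ∀ u : Fin n, getBit b (m * n + u) = false := fun m hm u =>
    hb _ (block_lt hm u)
  rw [blockState]
  by_cases h : b' = b
  · subst h
    rw [if_pos (show SameControl n K b' b' from fun _ _ => rfl), Finset.prod_eq_one]
    · simp [ket]
    · intro m hm
      have : block n m b' = fun _ => false :=
        funext fun u => hblock m (Finset.mem_range.1 hm) u
      simp [ket, this]
  · simp only [ket, h, if_false]
    split_ifs with hs
    · symm
      by_contra hne
      apply h
      rw [Finset.prod_eq_zero_iff] at hne
      push Not at hne
      refine getBit_ext fun v _ => ?_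
      rcases le_or_gt (K * n) v with hv | hv
      · exact hs v hv
      · have hn : 0 < n := Nat.pos_of_ne_zero fun h0 => by simp [h0] at hv
        have hm : v / n < K := (Nat.div_lt_iff_lt_mul hn).2 hv
        have h1 : block n (v / n) b' = fun _ => false := by
          by_contra h2
          exact hne _ (Finset.mem_range.2 hm) (by simp [h2])
        have h2 := congrFun h1 ⟨v % n, Nat.mod_lt v hn⟩
        rw [block, Nat.div_add_mod'] at h2
        rw [h2, hb v hv]
    · rfl

lemma triple_quantumCircuit (U : Matrix.unitaryGroup (Fin n → Bool) ℂ) (hn : 0 < n)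
    (hW : numBlocks k (2 ^ r) * n + 2 * 2 ^ r ≤ n + k * n + w) :
    Triple (applyOn (quantumQueryWires n k w) (U : Op (Fin n))) (SmallQuantumOverlap n k r w)
      (fun ψ => ψ = ket fun _ => false) (quantumCircuit n k r)
      (QStates n k r w (fun _ => ket fun _ => false)
        (fun _ _ => (U : Op (Fin n)).mulVec (ket fun _ => false)) (k * 2 ^ r)) := by
  set v := (U : Op (Fin n)).mulVec (ket fun _ => false)
  have hloop := Triple.flatMap_range (k := k)
    (O := applyOn (quantumQueryWires n k w) (U : Op (Fin n))) (Q := SmallQuantumOverlap n k r w)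
    (f := fun β => (List.range (2 ^ r)).flatMap (quantumStep n k (2 ^ r) β))
    (I := fun β => QStates n k r w (fun _ => ket fun _ => false) (forgeryState v β 0)
      (β * 2 ^ r)) ?_
  · rw [quantumCircuit]
    refine (((triple_oneHotCircuit _ _ hW).mono_post fun ψ h => ?_).append hloop).mono_post
      fun ψ h => ?_
    · refine h.mono ?_
      rintro j _ φ ⟨b, rfl, hb⟩
      refine ⟨normSq_ket b, b, _, hb, blockState_ket hb.2.1, rfl, fun β _ => ?_, fun m _ _ => rfl⟩
      simp [forgeryState]
    · refine h.mono ?_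
      rintro j _ φ ⟨hφ, B, V, hB, hV, h0, h1, h2⟩
      refine ⟨hφ, B, V, hB, hV, h0, fun β hβ => ?_, h2⟩
      rw [h1 β hβ, forgeryState, if_pos (Or.inl hβ)]
  · intro β hβ
    have h := Triple.flatMap_range (I := fun i => QStates n k r w (fun _ => ket fun _ => false)
      (forgeryState v β i) (β * 2 ^ r + i)) fun i hi => triple_quantumStep U hn hβ hi hW
    refine h.mono_post fun ψ hψ => ?_
    have hd : β * 2 ^ r + 2 ^ r = (β + 1) * 2 ^ r := by ring
    rw [hd] at hψ
    refine hψ.mono ?_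
    rintro j hj φ ⟨hφ, B, V, hB, hV, h0, h1, h2⟩
    refine ⟨hφ, B, V, hB, hV, h0, fun β' hβ' => ?_, h2⟩
    -- As `j < 2 ^ r`, every branch has filled block `β`, and this is the situation at the start of
    -- block `β + 1`.
    have : (β' < β ∨ β' = β ∧ j < 2 ^ r) ↔ (β' < β + 1 ∨ β' = β + 1 ∧ j < 0) := by omega
    rw [h1 β' hβ', forgeryState, forgeryState]
    simp only [this]

end Attack

/-! ### The state of the forgery register -/

section Forgery

variable {n k r w : ℕ}

lemma forgeryWires_injective : Function.Injective (forgeryWires n k w) := fun _ _ h =>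
  finProdFinEquiv.injective (Fin.natAdd_injective _ _ (Fin.castAdd_injective _ _ h))

lemma forgeryWires_val (β : Fin k) (u : Fin n) :
    (forgeryWires n k w (β, u)).val = (1 + β) * n + u := by
  simp only [forgeryWires, Fin.val_castAdd, Fin.val_natAdd, finProdFinEquiv_apply_val]
  ring

lemma getBit_extend_forgeryWires (x : Fin k × Fin n → Bool) (b : Fin (n + k * n + w) → Bool) {v : ℕ}
    (hv : v < n ∨ (1 + k) * n ≤ v) :
    getBit (Function.extend (forgeryWires n k w) x b) v = getBit b v := by
  by_cases h : v < n + k * n + w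
  · rw [getBit_of_lt _ h, getBit_of_lt _ h, Function.extend_apply']
    rintro ⟨⟨β, u⟩, hu⟩
    have h1 := congrArg Fin.val hu
    rw [forgeryWires_val] at h1
    have h2 := block_lt (show 1 + β.val < 1 + k by omega) u
    have h3 := le_block (show 0 < 1 + β.val by omega) u
    simp only at h1
    omega
  · simp [getBit, h]

/-- The product of `k` copies of a state. -/
def powState (k : ℕ) (v : Vec (Fin n)) : Vec (Fin k × Fin n) := fun x =>
  ∏ β, v fun u => x (β, u)

lemma normSq_powState {v : Vec (Fin n)} (hv : normSq v = 1) : normSq (powState k v) = 1 := by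
  have h : ∏ _β : Fin k, ∑ b, ‖v b‖ ^ 2 = 1 := by
    rw [normSq] at hv
    simp [hv]
  rw [Fintype.prod_sum] at h
  rw [normSq, ← h]
  refine Fintype.sum_equiv (Equiv.curry (Fin k) (Fin n) Bool) _ _ fun x => ?_
  rw [powState, norm_prod, Finset.prod_pow]
  rfl

lemma submatrix_pureState_powState (v : Vec (Fin n)) :
    (pureState (powState k v)).submatrix (fun (a : Fin k → Fin n → Bool) p => a p.1 p.2)
      (fun a p => a p.1 p.2) = copies k (pureState v) := by
  ext a b
  simp only [Matrix.submatrix_apply, pureState, Matrix.vecMulVec_apply, copies, powState,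
    Pi.star_apply, star_prod, Finset.prod_mul_distrib]

/-- The forgery blocks hold the same product in every branch, so this product is a common factor of
the superposition. The branch labels and the discarded states may be entangled with each other, but
not with the forgery. -/
lemma reduced_forgeryWires {X : ℕ → Vec (Fin n)} {v : Vec (Fin n)} {d : ℕ}
    {ψ : Vec (Fin (n + k * n + w))} (hψ : normSq ψ = 1) (hv : normSq v = 1)
    (h : QStates n k r w X (fun _ _ => v) d ψ) :
    reduced (forgeryWires n k w) ψ = pureState (powState k v) := by
  classical
  obtain ⟨φ, rfl, hφ⟩ := h
  choose! hnorm B V hB hφV h0 h1 h2 using hφ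
  set K := numBlocks k (2 ^ r) with hK
  have hkK : 1 + k ≤ K := Nat.le_add_right _ _
  -- Branch `j` without its forgery factors.
  let g : ℕ → Vec (Fin (n + k * n + w)) := fun j b => if SameControl n K (B j) b then
    V j 0 (block n 0 b) * ∏ m ∈ Finset.range (k * 2 ^ r), V j (1 + k + m) (block n (1 + k + m) b)
    else 0
  refine reduced_of_factor forgeryWires_injective hψ (normSq_powState hv)
    (G := fun b => (Real.sqrt 2 : ℂ)⁻¹ ^ r * ∑ j ∈ Finset.range (2 ^ r), g j b) ?_ ?_
  · intro x b
    congr 1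
    refine Finset.sum_congr rfl fun j _ => ?_
    have hiff : SameControl n K (B j) (Function.extend (forgeryWires n k w) x b)
        ↔ SameControl n K (B j) b := by
      refine forall_congr' fun v => imp_congr_right fun hv => ?_
      rw [getBit_extend_forgeryWires x b (Or.inr ((Nat.mul_le_mul_right n hkK).trans hv))]
    have hb0 : block n 0 (Function.extend (forgeryWires n k w) x b) = block n 0 b :=
      block_congr fun u => getBit_extend_forgeryWires x b (Or.inl (by omega))
    have hbm : ∀ m, block n (1 + k + m) (Function.extend (forgeryWires n k w) x b)
        = block n (1 + k + m) b := fun m =>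
      block_congr fun u => getBit_extend_forgeryWires x b (Or.inr
        ((Nat.mul_le_mul_right n (Nat.le_add_right _ _)).trans (Nat.le_add_right _ _)))
    simp only [g, hiff, hb0, hbm]
  · intro b
    rw [Pi.smul_apply, Finset.sum_apply, smul_eq_mul,
      mul_left_comm (powState k v _)]
    congr 1
    rw [Finset.mul_sum]
    refine Finset.sum_congr rfl fun j hj => ?_
    have hj' := Finset.mem_range.1 hj
    rw [hφV j hj', blockState]
    simp only [g]
    split_ifs
    -- The product splits into the query block, the forgery blocks and the discarded blocks.
    · rw [hK, numBlocks, Finset.prod_range_add, add_comm 1 k, Finset.prod_range_succ', mul_assoc,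
        ← add_comm 1 k]
      congr 1
      rw [Finset.prod_range, powState]
      refine Finset.prod_congr rfl fun β _ => ?_
      have hb : block n (1 + β) b = fun u => (b ∘ forgeryWires n k w) (β, u) := by
        ext u
        rw [block, ← forgeryWires_val (w := w), getBit_val]
        rfl
      rw [add_comm β.val 1, h1 j hj' β β.2, hb]
    · rw [mul_zero]

end Forgery

lemma le_width_quantumCircuit {n k r : ℕ} (hk : 0 < k) :
    numBlocks k (2 ^ r) * n + 2 * 2 ^ r ≤ width (quantumCircuit n k r) := by
  have hr : 0 < 2 ^ r := by positivity
  have : numBlocks k (2 ^ r) * n + 2 ^ r + (2 ^ r - 1) < width (quantumCircuit n k r) := by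
    refine lt_width (g := .cnot (numBlocks k (2 ^ r) * n + 2 ^ r + (2 ^ r - 1)) 0) ?_
      (by simp [Gate.wires])
    simp only [quantumCircuit, List.mem_append, List.mem_flatMap, List.mem_range]
    refine Or.inr ⟨0, hk, 2 ^ r - 1, by omega, ?_⟩
    simp [quantumStep]
  omega

/-- The test compares copies of the same pure state. Nothing has to cancel here, so `r` need not be
positive. -/
lemma QuantumPrimitive.winProb_eq_one (F : QuantumPrimitive) {μ : ℝ} {s r : ℕ} {c : Config}
    (hμ : ((2 ^ r : ℕ) : ℝ)⁻¹ ≤ 1 - μ) (hgates : c.challengeGates = [])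
    (hc : c.circuit = quantumCircuit (F.dim s) (F.testCopies s) r) : F.winProb μ s c = 1 := by
  refine tsum_toReal_mul_eq_one _ fun key _ => ?_
  have hn := F.dim_pos s
  have hk := F.testCopies_pos s
  have hφ : prepare (F.dim s) c.challengeGates = ket fun _ => false := by
    rw [hgates]
    rfl
  obtain ⟨h1, h2⟩ := triple_quantumCircuit (k := F.testCopies s) (r := r) (F.eval s key) hn
    (w := width c.circuit)
    (by rw [hc]; exact (le_width_quantumCircuit hk).trans (Nat.le_add_left _ _)) _ rfl
  have h3 := normSq_run (normSq_applyOn (quantumQueryWires_injective (k := F.testCopies s)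
    (w := width c.circuit)) (F.eval s key)) c.circuit (ket fun _ => false)
  rw [normSq_ket] at h3
  rw [← hc] at h1 h2
  have hv : normSq ((F.eval s key : Op (Fin (F.dim s))).mulVec (ket fun _ => false)) = 1 :=
    (sum_norm_sq_mulVec (F.eval s key) _).trans (normSq_ket _)
  have hred := reduced_forgeryWires h3 hv h2
  have : Nonempty (Fin (F.dim s)) := ⟨⟨0, hn⟩⟩
  rw [QuantumPrimitive.winProbKey]
  simp only [hφ]
  rw [if_pos]
  · rw [hred, submatrix_pureState_powState]
    exact (F.test s).accept_self hk hk hv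
  · intro ψ hψ
    have h4 := h1 ψ hψ
    rw [SmallQuantumOverlap] at h4
    refine ⟨fidelity_nonneg _ _, (le_of_eq ?_).trans (h4.trans hμ)⟩
    congr!

/-! ### Programs that write the circuits of the attacks -/

/-- The content of a memory cell. -/
abbrev var (i : ℕ) : Expr := .cell (.lit i)

lemma flatMap_range_succ {α : Type} (f : ℕ → List α) (k : ℕ) :
    (List.range (k + 1)).flatMap f = (List.range k).flatMap f ++ f k := by
  rw [List.range_succ, List.flatMap_append, List.flatMap_cons, List.flatMap_nil, List.append_nil]

/-- The loop rule for programs that write circuits: `L i` is the memory before round `i` and `F i`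
what that round writes. -/
lemma runLe_for {e : Expr} {p : Prog} {L : ℕ → List ℕ} {F : ℕ → List Instr} {k C : ℕ}
    (c : List Instr) (hcond : ∀ i < k, e.eval (fun a => (L i).getD a 0) ≠ 0)
    (hend : e.eval (fun a => (L k).getD a 0) = 0)
    (h : ∀ i < k, ∀ c, RunLe p (cfg (L i) c) (cfg (L (i + 1)) (c ++ F i)) C) :
    RunLe (.loop e p) (cfg (L 0) c) (cfg (L k) (c ++ (List.range k).flatMap F))
      (k * (C + 1) + 1) := by
  have := RunLe.loop_count (e := e) (p := p) (k := k) (C := C)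
    (f := fun i => cfg (L i) (c ++ (List.range i).flatMap F)) (fun i hi => ⟨hcond i hi, ?_⟩) hend
  · simpa using this
  · have := h i hi (c ++ (List.range i).flatMap F)
    rwa [List.append_assoc, ← flatMap_range_succ] at this

/-- The power `s ^ c` of the first input. -/
def powExpr : ℕ → Expr
  | 0 => .lit 1
  | c + 1 => .mul (powExpr c) (var 0)

lemma eval_powExpr (mem : ℕ → ℕ) (c : ℕ) : (powExpr c).eval mem = mem 0 ^ c := by
  induction c with
  | zero => rfl
  | succ c ih => simp only [powExpr, Expr.eval, ih, pow_succ]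

/-- The cap `s ^ c` makes the search end for every `s`, also where `1 - μ` is tiny or rounds to
zero. -/
lemma exists_searchExp (s D c : ℕ) : ∃ r, 2 ^ s ≤ 2 ^ r * (2 ^ s - D - 1) ∨ s ^ c ≤ 2 ^ r :=
  ⟨s ^ c, Or.inr Nat.lt_two_pow_self.le⟩

/-- The logarithm of the number of branches of the attack: `2 ^ r` is at least the inverse of
`1 - D / 2 ^ s - 1 / 2 ^ s`, unless it is at least `s ^ c`. -/
def searchExp (s D c : ℕ) : ℕ := Nat.find (exists_searchExp s D c)

/-- The body of the loop of `searchProg`. -/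
def searchStep (c : ℕ) : Prog :=
  .ite (.sub (powExpr c) (var 5))
    (.seq (.store (.lit 6) (.add (var 6) (var 6))) (.store (.lit 5) (.add (var 5) (var 5))))
    (.store (.lit 6) (var 4))

/-- The program that computes `2 ^ s` and the number of branches. -/
def searchProg (c : ℕ) : Prog :=
  .seq (.store (.lit 4) (.lit 1)) <|
  .seq (.loop (.sub (var 0) (var 8))
    (.seq (.store (.lit 4) (.add (var 4) (var 4))) (.store (.lit 8) (.add (var 8) (.lit 1))))) <|
  .seq (.store (.lit 8) (.lit 0)) <|
  .seq (.store (.lit 6) (.sub (.sub (var 4) (var 3)) (.lit 1))) <|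
  .seq (.store (.lit 5) (.lit 1)) <|
  .loop (.sub (var 4) (var 6)) (searchStep c)

/-- Cells 0 to 3 hold the input, cell 4 holds `2 ^ s`, cell 5 the number of branches, cell 6 its
product with `2 ^ s - D - 1`, and cells 7 to 10 serve as counters. The final content of cell 6
depends on how the search ends. -/
lemma runLe_searchProg (s n l D c : ℕ) : ∃ X, RunLe (searchProg c)
    (cfg [s, n, l, D, 0, 0, 0, 0, 0, 0, 0] [])
    (cfg [s, n, l, D, 2 ^ s, 2 ^ searchExp s D c, X, 0, 0, 0, 0] [])
    (3 * s + 4 * searchExp s D c + 10) := by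
  set r := searchExp s D c with hr
  set x := 2 ^ s - D - 1 with hx
  have h1 : RunLe (.loop (.sub (var 0) (var 8)) (.seq (.store (.lit 4) (.add (var 4) (var 4)))
      (.store (.lit 8) (.add (var 8) (.lit 1))))) (cfg [s, n, l, D, 1, 0, 0, 0, 0, 0, 0] [])
      (cfg [s, n, l, D, 2 ^ s, 0, 0, 0, s, 0, 0] []) (s * (2 + 1) + 1) := by
    have := RunLe.loop_count (k := s) (C := 2) (e := .sub (var 0) (var 8))
      (p := .seq (.store (.lit 4) (.add (var 4) (var 4))) (.store (.lit 8) (.add (var 8) (.lit 1))))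
      (f := fun i => cfg [s, n, l, D, 2 ^ i, 0, 0, 0, i, 0, 0] []) ?_ (Nat.sub_self s)
    · simpa using this
    · intro i hi
      refine ⟨Nat.sub_ne_zero_of_lt hi, RunLe.seq (m := 1) (n := 1)
        (runLe_store _ _ (by simp) _ (x := 2 ^ (i + 1)) ?_)
        (runLe_store _ _ (by simp) _ (x := i + 1) rfl)⟩
      change 2 ^ i + 2 ^ i = _
      ring
  have hspec : 2 ^ s ≤ 2 ^ r * x ∨ s ^ c ≤ 2 ^ r := Nat.find_spec (exists_searchExp s D c)
  have hmin : ∀ t < r, ¬ (2 ^ s ≤ 2 ^ t * x ∨ s ^ c ≤ 2 ^ t) := fun t ht =>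
    Nat.find_min (exists_searchExp s D c) ht
  have h2 : ∃ X, RunLe (.loop (.sub (var 4) (var 6)) (searchStep c)) (cfg [s, n, l, D, 2 ^ s, 1, x, 0, 0, 0, 0] [])
      (cfg [s, n, l, D, 2 ^ s, 2 ^ r, X, 0, 0, 0, 0] []) (r * (3 + 1) + 4) := by
    have hpow : ∀ L : List ℕ, (Expr.sub (powExpr c) (var 5)).eval (fun a => L.getD a 0)
        = L.getD 0 0 ^ c - L.getD 5 0 := by
      intro L
      simp only [Expr.eval, eval_powExpr]
    -- The `r` doublings, common to both ways of leaving the loop.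
    have hpre : ∀ {s' : Config} {m : ℕ}, RunLe (.loop (.sub (var 4) (var 6)) (searchStep c)) (cfg [s, n, l, D, 2 ^ s, 2 ^ r, 2 ^ r * x,
        0, 0, 0, 0] []) s' m → RunLe (.loop (.sub (var 4) (var 6)) (searchStep c)) (cfg [s, n, l, D, 2 ^ s, 1, x, 0, 0, 0, 0] []) s'
          (r * (3 + 1) + m) := by
      intro s' m hm
      have := RunLe.loop_prefix (k := r) (C := 3) (e := .sub (var 4) (var 6))
        (p := searchStep c)
        (f := fun t => cfg [s, n, l, D, 2 ^ s, 2 ^ t, 2 ^ t * x, 0, 0, 0, 0] []) ?_ hm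
      · simpa using this
      · intro t ht
        have hlt := hmin t ht
        rw [not_or, not_le, not_le] at hlt
        refine ⟨Nat.sub_ne_zero_of_lt hlt.1, RunLe.ite_true (n := 2) ?_
          (RunLe.seq (m := 1) (n := 1)
            (runLe_store _ _ (by simp) _ (x := 2 ^ (t + 1) * x) ?_)
            (runLe_store _ _ (by simp) _ (x := 2 ^ (t + 1)) ?_))⟩
        · exact (hpow _).trans_ne (Nat.sub_ne_zero_of_lt hlt.2)
        · change 2 ^ t * x + 2 ^ t * x = _
          ring
        · change 2 ^ t + 2 ^ t = _
          ring
    by_cases hX : 2 ^ s ≤ 2 ^ r * x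
    · exact ⟨2 ^ r * x, (hpre (RunLe.loop_exit (Nat.sub_eq_zero_of_le hX))).mono (by omega)⟩
    -- The cap is reached: one more round writes `2 ^ s` to cell 6, which stops the loop.
    · refine ⟨2 ^ s, (hpre (m := 4) ?_).mono (by omega)⟩
      refine RunLe.loop_step (m := 2) (n := 1)
        (s' := cfg [s, n, l, D, 2 ^ s, 2 ^ r, 2 ^ s, 0, 0, 0, 0] [])
        (Nat.sub_ne_zero_of_lt (not_le.1 hX)) ?_ (RunLe.loop_exit (Nat.sub_self _))
      refine RunLe.ite_false (n := 1) ?_ (runLe_store _ _ (by simp) _ rfl)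
      exact (hpow _).trans (Nat.sub_eq_zero_of_le (hspec.resolve_left hX))
  obtain ⟨X, h2⟩ := h2
  refine ⟨X, ?_⟩
  have := (runLe_store [s, n, l, D, 0, 0, 0, 0, 0, 0, 0] [] (a := 4) (by simp) (.lit 1) rfl).seq
    (h1.seq ((runLe_store _ _ (a := 8) (by simp) (.lit 0) rfl).seq
    ((runLe_store _ _ (a := 6) (by simp) (.sub (.sub (var 4) (var 3)) (.lit 1)) (x := x) rfl).seq
    ((runLe_store _ _ (a := 5) (by simp) (.lit 1) (x := 1) rfl).seq h2))))
  exact this.mono (by omega)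

/-- The program that writes `oneHotCircuit`. -/
def oneHotProg (base : Expr) : Prog :=
  .seq (.gate (.x base)) <|
  .seq (.gate (.x (.add base (var 5)))) <|
  .seq (.store (.lit 7) (.lit 1)) <|
  .loop (.sub (var 5) (var 7)) <|
    .seq (.gate (.h (.add base (var 7)))) <|
    .seq (.loop (.sub (var 7) (var 8)) <|
      .seq (.gate (.ccx (.add base (var 7)) (.add (.add base (var 5)) (var 8))
        (.add (.add base (var 5)) (.add (var 7) (var 8))))) <|
      .seq (.gate (.cnot (.add (.add base (var 5)) (.add (var 7) (var 8)))
        (.add (.add base (var 5)) (var 8)))) <|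
      .store (.lit 8) (.add (var 8) (.lit 1))) <|
    .seq (.store (.lit 8) (.lit 0)) <|
    .store (.lit 7) (.add (var 7) (var 7))

section Write

variable {s n l D P X : ℕ}

/-- The hypothesis on `base` says that its value does not change with the counters in cells 7 and 8.
-/
lemma runLe_oneHotProg {base : Expr} {b r : ℕ}
    (hb : ∀ M i, base.eval (fun a => [s, n, l, D, P, 2 ^ r, X, M, i, 0, 0].getD a 0) = b)
    (c : List Instr) :
    RunLe (oneHotProg base) (cfg [s, n, l, D, P, 2 ^ r, X, 0, 0, 0, 0] c)
      (cfg [s, n, l, D, P, 2 ^ r, X, 2 ^ r, 0, 0, 0] (c ++ oneHotCircuit b r))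
      (r * (4 * 2 ^ r + 5) + 4) := by
  have hinner : ∀ M c, RunLe _ (cfg [s, n, l, D, P, 2 ^ r, X, M, 0, 0, 0] c)
      (cfg [s, n, l, D, P, 2 ^ r, X, M, M, 0, 0] _) (M * (3 + 1) + 1) := fun M c =>
    runLe_for (k := M) (C := 3) (e := .sub (var 7) (var 8))
      (p := .seq (.gate (.ccx (.add base (var 7)) (.add (.add base (var 5)) (var 8))
        (.add (.add base (var 5)) (.add (var 7) (var 8))))) <|
      .seq (.gate (.cnot (.add (.add base (var 5)) (.add (var 7) (var 8)))
        (.add (.add base (var 5)) (var 8)))) <|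
      .store (.lit 8) (.add (var 8) (.lit 1)))
      (L := fun i => [s, n, l, D, P, 2 ^ r, X, M, i, 0, 0])
      (F := fun i => [.gate (.ccx (b + M) (b + 2 ^ r + i) (b + 2 ^ r + (M + i))),
        .gate (.cnot (b + 2 ^ r + (M + i)) (b + 2 ^ r + i))]) c
      (fun i hi => Nat.sub_ne_zero_of_lt hi) (Nat.sub_self M) (fun i hi c => by
        have h1 := runLe_gate [s, n, l, D, P, 2 ^ r, X, M, i, 0, 0] c
          (.ccx (.add base (var 7)) (.add (.add base (var 5)) (var 8))
            (.add (.add base (var 5)) (.add (var 7) (var 8))))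
          (g' := .ccx (b + M) (b + 2 ^ r + i) (b + 2 ^ r + (M + i)))
          (by simp only [Gate.map, Expr.eval, hb]; rfl)
        have h2 := runLe_gate [s, n, l, D, P, 2 ^ r, X, M, i, 0, 0]
          (c ++ [.gate (.ccx (b + M) (b + 2 ^ r + i) (b + 2 ^ r + (M + i)))])
          (.cnot (.add (.add base (var 5)) (.add (var 7) (var 8)))
            (.add (.add base (var 5)) (var 8)))
          (g' := .cnot (b + 2 ^ r + (M + i)) (b + 2 ^ r + i))
          (by simp only [Gate.map, Expr.eval, hb]; rfl)
        rw [List.append_assoc] at h2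
        exact h1.seq (h2.seq (runLe_store _ _ (by simp) _ (x := i + 1) rfl)))
  have hloop := fun c => runLe_for (k := r) (C := 4 * 2 ^ r + 4) (e := .sub (var 5) (var 7))
    (p := .seq (.gate (.h (.add base (var 7)))) <|
    .seq (.loop (.sub (var 7) (var 8)) <|
      .seq (.gate (.ccx (.add base (var 7)) (.add (.add base (var 5)) (var 8))
        (.add (.add base (var 5)) (.add (var 7) (var 8))))) <|
      .seq (.gate (.cnot (.add (.add base (var 5)) (.add (var 7) (var 8)))
        (.add (.add base (var 5)) (var 8)))) <|
      .store (.lit 8) (.add (var 8) (.lit 1))) <|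
    .seq (.store (.lit 8) (.lit 0)) <|
    .store (.lit 7) (.add (var 7) (var 7)))
    (L := fun t => [s, n, l, D, P, 2 ^ r, X, 2 ^ t, 0, 0, 0])
    (F := fun t => oneHotLevel b (2 ^ r) (2 ^ t)) c
    (fun t ht => Nat.sub_ne_zero_of_lt (Nat.pow_lt_pow_right one_lt_two ht)) (Nat.sub_self (2 ^ r))
    (fun t ht c => by
      have h1 := runLe_gate [s, n, l, D, P, 2 ^ r, X, 2 ^ t, 0, 0, 0] c
        (.h (.add base (var 7))) (g' := .h (b + 2 ^ t)) (by simp only [Gate.map, Expr.eval, hb]; rfl)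
      have h2 := hinner (2 ^ t) (c ++ [.gate (.h (b + 2 ^ t))])
      rw [List.append_assoc, List.singleton_append] at h2
      have hle : 2 ^ t ≤ 2 ^ r := Nat.pow_le_pow_right (by norm_num) ht.le
      exact (h1.seq (h2.seq ((runLe_store _ _ (a := 8) (by simp) (.lit 0) (x := 0) rfl).seq
        (runLe_store _ _ (a := 7) (by simp) (.add (var 7) (var 7)) (x := 2 ^ (t + 1))
          (show 2 ^ t + 2 ^ t = 2 ^ (t + 1) by ring))))).mono (by omega))
  have h1 := runLe_gate [s, n, l, D, P, 2 ^ r, X, 0, 0, 0, 0] c (.x base) (g' := .x b)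
    (by simp only [Gate.map, hb])
  have h2 := runLe_gate [s, n, l, D, P, 2 ^ r, X, 0, 0, 0, 0] (c ++ [.gate (.x b)])
    (.x (.add base (var 5))) (g' := .x (b + 2 ^ r)) (by simp only [Gate.map, Expr.eval, hb]; rfl)
  rw [List.append_assoc] at h2
  have h3 := hloop (c ++ ([.gate (.x b)] ++ [.gate (.x (b + 2 ^ r))]))
  rw [List.append_assoc] at h3
  exact (h1.seq (h2.seq ((runLe_store _ _ (a := 7) (by simp) (.lit 1) (x := 1) rfl).seq h3))).mono
    (le_of_eq (by ring))

/-- The first control wire of the attack on a classical primitive. -/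
abbrev classicalBase : Expr := .add (var 1) (var 2)

/-- The program of the attack on a classical primitive. -/
def classicalProg (c : ℕ) : Prog :=
  .seq (searchProg c) <|
  .seq (oneHotProg classicalBase) <|
  .seq (.loop (.sub (var 5) (var 8)) <|
    .seq (.gate (.x (.lit 0))) <|
    .seq (.gate (.cnot (.add (.add classicalBase (var 5)) (var 8)) (.lit 0))) <|
    .seq .query <|
    .seq (.gate (.cnot (.add (.add classicalBase (var 5)) (var 8)) (.lit 0))) <|
    .seq (.gate (.x (.lit 0))) <|
    .store (.lit 8) (.add (var 8) (.lit 1))) <|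
  .seq (.gate (.x (.lit 0))) .query

lemma runLe_classicalProg (s n l D c : ℕ) : ∃ L, RunLe (classicalProg c)
    (cfg [s, n, l, D, 0, 0, 0, 0, 0, 0, 0] [])
    (cfg L (classicalCircuit n l (searchExp s D c)))
    (3 * s + 4 * searchExp s D c + 10
      + (searchExp s D c * (4 * 2 ^ searchExp s D c + 5) + 4
        + (2 ^ searchExp s D c * 7 + 1 + 2))) := by
  obtain ⟨X, h1⟩ := runLe_searchProg s n l D c
  set r := searchExp s D c
  have h2 := runLe_oneHotProg (s := s) (n := n) (l := l) (D := D) (P := 2 ^ s) (X := X)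
    (base := classicalBase) (b := n + l) (r := r) (fun M i => rfl) []
  have h3 := runLe_for (k := 2 ^ r) (C := 6) (e := .sub (var 5) (var 8))
    (p := .seq (.gate (.x (.lit 0))) <|
      .seq (.gate (.cnot (.add (.add classicalBase (var 5)) (var 8)) (.lit 0))) <|
      .seq .query <|
      .seq (.gate (.cnot (.add (.add classicalBase (var 5)) (var 8)) (.lit 0))) <|
      .seq (.gate (.x (.lit 0))) <|
      .store (.lit 8) (.add (var 8) (.lit 1)))
    (L := fun i => [s, n, l, D, 2 ^ s, 2 ^ r, X, 2 ^ r, i, 0, 0])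
    (F := classicalStep (n + l) (2 ^ r)) ([] ++ oneHotCircuit (n + l) r)
    (fun i hi => Nat.sub_ne_zero_of_lt hi) (Nat.sub_self (2 ^ r)) (fun i hi c => by
      have := (runLe_gate [s, n, l, D, 2 ^ s, 2 ^ r, X, 2 ^ r, i, 0, 0] c (.x (.lit 0))
          (g' := .x 0) rfl).seq ((runLe_gate _ _
            (.cnot (.add (.add classicalBase (var 5)) (var 8)) (.lit 0))
            (g' := .cnot (n + l + 2 ^ r + i) 0) rfl).seq
        ((runLe_query _ _).seq ((runLe_gate _ _
            (.cnot (.add (.add classicalBase (var 5)) (var 8)) (.lit 0))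
            (g' := .cnot (n + l + 2 ^ r + i) 0) rfl).seq
        ((runLe_gate _ _ (.x (.lit 0)) (g' := .x 0) rfl).seq
          (runLe_store _ _ (a := 8) (by simp) (.add (var 8) (.lit 1)) (x := i + 1) rfl)))))
      simp only [List.append_assoc] at this
      exact this)
  have := h1.seq (h2.seq (h3.seq ((runLe_gate _ _ (.x (.lit 0)) (g' := .x 0) rfl).seq
    (runLe_query _ _))))
  rw [List.append_assoc _ [Instr.gate (.x 0)], List.append_assoc] at this
  exact ⟨_, this.mono (by omega)⟩

/-- The program that writes `swapCircuit`. -/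
def swapProg (e y : Expr) : Prog :=
  .seq (.loop (.sub (var 1) (var 10)) <|
    .seq (.gate (.cnot (.add y (var 10)) (var 10))) <|
    .seq (.gate (.ccx e (var 10) (.add y (var 10)))) <|
    .seq (.gate (.cnot (.add y (var 10)) (var 10))) <|
    .store (.lit 10) (.add (var 10) (.lit 1))) <|
  .store (.lit 10) (.lit 0)

lemma runLe_swapProg {e y : Expr} {N M i β e' y' : ℕ}
    (he : ∀ u, e.eval (fun a => [s, n, l, D, P, N, X, M, i, β, u].getD a 0) = e')
    (hy : ∀ u, y.eval (fun a => [s, n, l, D, P, N, X, M, i, β, u].getD a 0) = y')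
    (c : List Instr) :
    RunLe (swapProg e y) (cfg [s, n, l, D, P, N, X, M, i, β, 0] c)
      (cfg [s, n, l, D, P, N, X, M, i, β, 0] (c ++ swapCircuit n e' y')) (n * 5 + 1 + 1) := by
  have h := runLe_for (k := n) (C := 4) (e := .sub (var 1) (var 10))
    (p := .seq (.gate (.cnot (.add y (var 10)) (var 10))) <|
      .seq (.gate (.ccx e (var 10) (.add y (var 10)))) <|
      .seq (.gate (.cnot (.add y (var 10)) (var 10))) <|
      .store (.lit 10) (.add (var 10) (.lit 1)))
    (L := fun u => [s, n, l, D, P, N, X, M, i, β, u])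
    (F := fun k => (swapStep e' y' k).map .gate) c
    (fun i hi => Nat.sub_ne_zero_of_lt hi) (Nat.sub_self n) (fun u hu c => by
      have := (runLe_gate [s, n, l, D, P, N, X, M, i, β, u] c (.cnot (.add y (var 10)) (var 10))
          (g' := .cnot (y' + u) u) (by simp only [Gate.map, Expr.eval, hy]; rfl)).seq
        ((runLe_gate _ _ (.ccx e (var 10) (.add y (var 10))) (g' := .ccx e' u (y' + u))
          (by simp only [Gate.map, Expr.eval, hy, he]; rfl)).seq
        ((runLe_gate _ _ (.cnot (.add y (var 10)) (var 10)) (g' := .cnot (y' + u) u)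
          (by simp only [Gate.map, Expr.eval, hy]; rfl)).seq
        (runLe_store _ _ (a := 10) (by simp) (.add (var 10) (.lit 1)) (x := u + 1) rfl)))
      simp only [List.append_assoc] at this
      exact this)
  exact h.seq (runLe_store _ _ (a := 10) (by simp) (.lit 0) rfl)

/-- The first control wire of the attack on a quantum primitive. -/
abbrev quantumBase : Expr :=
  .mul (.add (.add (.lit 1) (var 2)) (.mul (var 2) (var 5))) (var 1)

/-- The program of the attack on a quantum primitive. -/
def quantumProg (c : ℕ) : Prog :=
  .seq (searchProg c) <|
  .seq (oneHotProg quantumBase) <|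
  .loop (.sub (var 2) (var 9)) <|
    .seq (.loop (.sub (var 5) (var 8)) <|
      .seq (.gate (.x (.lit 0))) <|
      .seq (.gate (.cnot (.add (.add quantumBase (var 5)) (var 8)) (.lit 0))) <|
      .seq .query <|
      .seq (swapProg (.add (.add quantumBase (var 5)) (var 8))
        (.mul (.add (.lit 1) (var 9)) (var 1))) <|
      .seq (swapProg quantumBase
        (.mul (.add (.add (.lit 1) (var 2)) (.add (.mul (var 9) (var 5)) (var 8))) (var 1))) <|
      .store (.lit 8) (.add (var 8) (.lit 1))) <|
    .seq (.store (.lit 8) (.lit 0)) <|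
    .store (.lit 9) (.add (var 9) (.lit 1))

lemma runLe_quantumProg (s n k D c : ℕ) : ∃ L, RunLe (quantumProg c)
    (cfg [s, n, k, D, 0, 0, 0, 0, 0, 0, 0] [])
    (cfg L (quantumCircuit n k (searchExp s D c)))
    (3 * s + 4 * searchExp s D c + 10
      + (searchExp s D c * (4 * 2 ^ searchExp s D c + 5) + 4
        + (k * (2 ^ searchExp s D c * (10 * n + 9) + 4) + 1))) := by
  obtain ⟨X, h1⟩ := runLe_searchProg s n k D c
  set r := searchExp s D c
  have h2 := runLe_oneHotProg (s := s) (n := n) (l := k) (D := D) (P := 2 ^ s) (X := X)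
    (base := quantumBase) (b := numBlocks k (2 ^ r) * n) (r := r) (fun M i => rfl) []
  have hinner := fun β c => runLe_for (k := 2 ^ r) (C := 10 * n + 8) (e := .sub (var 5) (var 8))
    (p := .seq (.gate (.x (.lit 0))) <|
      .seq (.gate (.cnot (.add (.add quantumBase (var 5)) (var 8)) (.lit 0))) <|
      .seq .query <|
      .seq (swapProg (.add (.add quantumBase (var 5)) (var 8))
        (.mul (.add (.lit 1) (var 9)) (var 1))) <|
      .seq (swapProg quantumBase
        (.mul (.add (.add (.lit 1) (var 2)) (.add (.mul (var 9) (var 5)) (var 8))) (var 1))) <|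
      .store (.lit 8) (.add (var 8) (.lit 1)))
    (L := fun i => [s, n, k, D, 2 ^ s, 2 ^ r, X, 2 ^ r, i, β, 0])
    (F := quantumStep n k (2 ^ r) β) c
    (fun i hi => Nat.sub_ne_zero_of_lt hi) (Nat.sub_self (2 ^ r)) (fun i hi c => by
      have := (runLe_gate [s, n, k, D, 2 ^ s, 2 ^ r, X, 2 ^ r, i, β, 0] c (.x (.lit 0))
          (g' := .x 0) rfl).seq ((runLe_gate _ _
            (.cnot (.add (.add quantumBase (var 5)) (var 8)) (.lit 0))
            (g' := .cnot (numBlocks k (2 ^ r) * n + 2 ^ r + i) 0) rfl).seq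
        ((runLe_query _ _).seq
        ((runLe_swapProg (e := .add (.add quantumBase (var 5)) (var 8))
          (y := .mul (.add (.lit 1) (var 9)) (var 1))
          (e' := numBlocks k (2 ^ r) * n + 2 ^ r + i) (y' := (1 + β) * n)
          (fun u => rfl) (fun u => rfl) _).seq
        ((runLe_swapProg (e := quantumBase)
          (y := .mul (.add (.add (.lit 1) (var 2)) (.add (.mul (var 9) (var 5)) (var 8))) (var 1))
          (e' := numBlocks k (2 ^ r) * n) (y' := (1 + k + (β * 2 ^ r + i)) * n)
          (fun u => rfl) (fun u => rfl) _).seq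
        (runLe_store _ _ (a := 8) (by simp) (.add (var 8) (.lit 1)) (x := i + 1) rfl)))))
      simp only [List.append_assoc] at this
      exact this.mono (by omega))
  have h3 := runLe_for (k := k) (C := 2 ^ r * (10 * n + 9) + 3) (e := .sub (var 2) (var 9))
    (L := fun β => [s, n, k, D, 2 ^ s, 2 ^ r, X, 2 ^ r, 0, β, 0])
    (F := fun β => (List.range (2 ^ r)).flatMap (quantumStep n k (2 ^ r) β))
    ([] ++ oneHotCircuit (numBlocks k (2 ^ r) * n) r)
    (fun i hi => Nat.sub_ne_zero_of_lt hi) (Nat.sub_self k)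
    (fun β hβ c => ((hinner β c).seq ((runLe_store _ _ (a := 8) (by simp) (.lit 0) (x := 0) rfl).seq
      (runLe_store _ _ (a := 9) (by simp) (.add (var 9) (.lit 1)) (x := β + 1) rfl))).mono
        (le_of_eq (by ring)))
  exact ⟨_, (h1.seq (h2.seq h3)).mono (le_of_eq (by ring))⟩

end Write

/-! ### The adversaries -/

namespace PolyBounded

variable {f g : ℕ → ℕ}

lemma mono (hf : PolyBounded f) (h : ∀ s, g s ≤ f s) : PolyBounded g := by
  obtain ⟨p, hp⟩ := hf
  exact ⟨p, fun s => (h s).trans (hp s)⟩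

lemma const (c : ℕ) : PolyBounded fun _ => c := ⟨.C c, fun s => by simp⟩

lemma self : PolyBounded fun s => s := ⟨.X, fun s => by simp⟩

lemma add (hf : PolyBounded f) (hg : PolyBounded g) : PolyBounded fun s => f s + g s := by
  obtain ⟨p, hp⟩ := hf
  obtain ⟨q, hq⟩ := hg
  exact ⟨p + q, fun s => by rw [Polynomial.eval_add]; exact add_le_add (hp s) (hq s)⟩

lemma mul (hf : PolyBounded f) (hg : PolyBounded g) : PolyBounded fun s => f s * g s := by
  obtain ⟨p, hp⟩ := hf
  obtain ⟨q, hq⟩ := hg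
  exact ⟨p * q, fun s => by rw [Polynomial.eval_mul]; exact Nat.mul_le_mul (hp s) (hq s)⟩

lemma pow (hf : PolyBounded f) (c : ℕ) : PolyBounded fun s => f s ^ c := by
  induction c with
  | zero => simpa using const 1
  | succ c ih => simpa only [pow_succ] using ih.mul hf

end PolyBounded

lemma cfg_append_zeros (L : List ℕ) (k : ℕ) (c : List Instr) :
    cfg (L ++ List.replicate k 0) c = cfg L c := by
  simp only [cfg, Config.mk.injEq, and_true]
  ext i
  by_cases h : i < L.length
  · simp [List.getElem?_append_left h]
  · rw [List.getD_append_right _ _ _ _ (not_lt.1 h), List.getD_eq_default _ _ (not_lt.1 h)]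
    simp [List.getElem?_replicate]
    split_ifs <;> rfl

/-- It suffices to count steps, by `Run.exec`. The zeros appended to the input are the work cells,
which are empty at the start. -/
lemma exists_adversary {input : ℕ → List ℕ} {p : Prog} (hp : p.MulFree) {circ : ℕ → List Instr}
    {Z t : ℕ → ℕ} {k : ℕ} (hZ : PolyBounded Z) (ht : PolyBounded t)
    (hmem : ∀ s, ∀ x ∈ input s, x < 2 ^ Z s)
    (h : ∀ s, ∃ L, RunLe p (cfg (input s ++ List.replicate k 0) []) (cfg L (circ s)) (t s)) :
    ∃ A : QPTAdversary input, ∀ s, (A.out s).challengeBits = [] ∧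
      (A.out s).challengeGates = [] ∧ (A.out s).circuit = circ s := by
  choose L m hm hrun using h
  obtain ⟨T, hT⟩ : PolyBounded fun s => costBound p.weight (Z s) (t s) :=
    ht.mul ((PolyBounded.const _).mul ((hZ.add ((PolyBounded.const _).mul ht)).add (.const 1)))
  refine ⟨⟨p, fun s => cfg (L s) (circ s), T, fun s => ?_⟩, fun s => ⟨rfl, rfl, rfl⟩⟩
  have hrun := hrun s
  rw [cfg_append_zeros] at hrun
  have hlt : ∀ a, (cfg (input s) []).mem a < 2 ^ Z s := by
    intro a
    by_cases ha : a < (input s).length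
    · change (input s).getD a 0 < _
      rw [List.getD_eq_getElem _ _ ha]
      exact hmem s _ (List.getElem_mem ha)
    · change (input s).getD a 0 < _
      rw [List.getD_eq_default _ _ (not_lt.1 ha)]
      positivity
  obtain ⟨-, n, hn, he⟩ := hrun.exec hp le_rfl hlt
  refine ⟨n, hn.trans (le_trans ?_ (hT s)), he⟩
  change costBound _ _ _ ≤ costBound _ _ _
  have := hm s
  unfold costBound
  gcongr

lemma mulFree_searchProg (c : ℕ) : (searchProg c).MulFree := by
  simp [searchProg, searchStep, Prog.MulFree, Expr.MulFree]

lemma mulFree_oneHotProg (base : Expr) : (oneHotProg base).MulFree := by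
  simp [oneHotProg, Prog.MulFree, Expr.MulFree]

lemma mulFree_classicalProg (c : ℕ) : (classicalProg c).MulFree := by
  simp [classicalProg, Prog.MulFree, Expr.MulFree, mulFree_searchProg, mulFree_oneHotProg]

/-- Products occur only in wire indices and in the test of `searchStep`, whose values are not
stored. -/
lemma mulFree_quantumProg (c : ℕ) : (quantumProg c).MulFree := by
  simp [quantumProg, swapProg, Prog.MulFree, Expr.MulFree, mulFree_searchProg, mulFree_oneHotProg]

/-- By minimality, half of a power with positive exponent is still below the cap. The summand 1
covers the exponent zero. -/
lemma two_pow_searchExp_le (s D c : ℕ) : 2 ^ searchExp s D c ≤ 2 * s ^ c + 1 := by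
  rcases h : searchExp s D c with _ | k
  · simp
  · have hk := Nat.find_min (exists_searchExp s D c) (m := k)
      (show k < searchExp s D c by omega)
    rw [not_or, not_le, not_le] at hk
    rw [pow_succ]
    omega

lemma polyBounded_two_pow_searchExp (D : ℕ → ℕ) (c : ℕ) :
    PolyBounded fun s => 2 ^ searchExp s (D s) c :=
  (((PolyBounded.const 2).mul (PolyBounded.self.pow c)).add (.const 1)).mono
    fun s => two_pow_searchExp_le s (D s) c

lemma polyBounded_searchExp (D : ℕ → ℕ) (c : ℕ) : PolyBounded fun s => searchExp s (D s) c :=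
  (polyBounded_two_pow_searchExp D c).mono fun _ => Nat.lt_two_pow_self.le

lemma input_lt_two_pow {s n l : ℕ} {μ : ℝ} (hμ : μ ≤ 1) :
    ∀ x ∈ [s, n, l, ⌊2 ^ s * μ⌋₊], x < 2 ^ (s + n + l + 1) := by
  have h : ∀ x y : ℕ, x ≤ y → x < 2 ^ y := fun x y h =>
    Nat.lt_two_pow_self.trans_le (Nat.pow_le_pow_right (by norm_num) h)
  have hD : ⌊2 ^ s * μ⌋₊ < 2 ^ (s + n + l + 1) := by
    have h1 : ⌊(2 : ℝ) ^ s * μ⌋₊ ≤ 2 ^ s := by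
      refine Nat.floor_le_of_le ?_
      push_cast
      exact mul_le_of_le_one_right (by positivity) hμ
    exact h1.trans_lt (Nat.pow_lt_pow_right one_lt_two (by omega))
  intro x hx
  simp only [List.mem_cons, List.not_mem_nil, or_false] at hx
  rcases hx with rfl | rfl | rfl | rfl
  · exact h _ _ (by omega)
  · exact h _ _ (by omega)
  · exact h _ _ (by omega)
  · exact hD

lemma ClassicalPrimitive.exists_adversary (F : ClassicalPrimitive) {μ : ℕ → ℝ}
    (hμ : ∀ s, μ s ≤ 1) (c : ℕ) :
    ∃ A : QPTAdversary (F.publicInput μ), ∀ s, (A.out s).challengeBits = [] ∧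
      (A.out s).challengeGates = [] ∧ (A.out s).circuit =
        classicalCircuit (F.msgLen s) (F.tagLen s) (searchExp s ⌊2 ^ s * μ s⌋₊ c) := by
  have hr := polyBounded_searchExp (fun s => ⌊2 ^ s * μ s⌋₊) c
  have hN := polyBounded_two_pow_searchExp (fun s => ⌊2 ^ s * μ s⌋₊) c
  refine QForge.exists_adversary (k := 7) (mulFree_classicalProg c)
    (((PolyBounded.self.add F.msgLen_poly).add F.tagLen_poly).add (.const 1)) ?_
    (fun s => input_lt_two_pow (hμ s)) (fun s => runLe_classicalProg _ _ _ _ _)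
  exact (((PolyBounded.const 3).mul .self).add ((PolyBounded.const 4).mul hr)).add (.const 10)
    |>.add (((hr.mul (((PolyBounded.const 4).mul hN).add (.const 5))).add (.const 4)).add
      (((hN.mul (.const 7)).add (.const 1)).add (.const 2)))

lemma QuantumPrimitive.exists_adversary (F : QuantumPrimitive) {μ : ℕ → ℝ}
    (hμ : ∀ s, μ s ≤ 1) (c : ℕ) :
    ∃ A : QPTAdversary (F.publicInput μ), ∀ s, (A.out s).challengeBits = [] ∧
      (A.out s).challengeGates = [] ∧ (A.out s).circuit =
        quantumCircuit (F.dim s) (F.testCopies s) (searchExp s ⌊2 ^ s * μ s⌋₊ c) := by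
  have hr := polyBounded_searchExp (fun s => ⌊2 ^ s * μ s⌋₊) c
  have hN := polyBounded_two_pow_searchExp (fun s => ⌊2 ^ s * μ s⌋₊) c
  refine QForge.exists_adversary (k := 7) (mulFree_quantumProg c)
    (((PolyBounded.self.add F.dim_poly).add F.testCopies_poly).add (.const 1)) ?_
    (fun s => input_lt_two_pow (hμ s)) (fun s => runLe_quantumProg _ _ _ _ _)
  exact (((PolyBounded.const 3).mul .self).add ((PolyBounded.const 4).mul hr)).add (.const 10)
    |>.add (((hr.mul (((PolyBounded.const 4).mul hN).add (.const 5))).add (.const 4)).add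
      ((F.testCopies_poly.mul ((hN.mul (((PolyBounded.const 10).mul F.dim_poly).add
        (.const 9))).add (.const 4))).add (.const 1)))

/-! ### The number of branches -/

/-- The number `x = 2 ^ s - D - 1` lies between `2 ^ s (1 - μ) - 1` and `2 ^ s (1 - μ)`. Hence `2 ^
s ≤ 2 ^ r x` implies `1 ≤ 2 ^ r (1 - μ)`, and if the search stops at the cap, `hc` gives the same.
Minimality gives `2 ^ (r - 1) x < 2 ^ s`; one factor 2 of the constant 4 comes from this exponent
and the other from rounding. -/
lemma searchExp_spec {s c : ℕ} {μ : ℝ} (hμ : 0 < μ) (hs : 0 < s)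
    (hc : ((s : ℝ) ^ c)⁻¹ ≤ 1 - μ) (hpow : 2 * (s : ℝ) ^ c ≤ 2 ^ s) {r : ℕ}
    (hr : searchExp s ⌊2 ^ s * μ⌋₊ c = r) :
    0 < r ∧ ((2 ^ r : ℕ) : ℝ)⁻¹ ≤ 1 - μ ∧ ((2 ^ r : ℕ) : ℝ) * (1 - μ) ≤ 4 := by
  set D := ⌊(2 : ℝ) ^ s * μ⌋₊ with hD
  have hs' : (0 : ℝ) < (s : ℝ) ^ c := by positivity
  have hv : 0 < 1 - μ := (inv_pos.2 hs').trans_le hc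
  have h2 : (0 : ℝ) < 2 ^ s := by positivity
  have hDlt : (2 : ℝ) ^ s * μ < D + 1 := Nat.lt_floor_add_one _
  have hDle : (D : ℝ) ≤ 2 ^ s * μ := Nat.floor_le (by positivity)
  have hxle : ((2 ^ s - D - 1 : ℕ) : ℝ) ≤ 2 ^ s * (1 - μ) := by
    rcases le_or_gt (D + 1) (2 ^ s) with h | h
    · have : ((2 ^ s - D - 1 : ℕ) : ℝ) = 2 ^ s - D - 1 := by
        rw [Nat.sub_sub, Nat.cast_sub h]
        push_cast
        ring
      rw [this]
      linarith
    · rw [Nat.sub_sub, Nat.sub_eq_zero_of_le h.le, Nat.cast_zero]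
      positivity
  have hxge : 2 ^ s * (1 - μ) - 1 ≤ ((2 ^ s - D - 1 : ℕ) : ℝ) := by
    have h : 2 ^ s ≤ (2 ^ s - D - 1) + (D + 1) := by omega
    have : (2 : ℝ) ^ s ≤ ((2 ^ s - D - 1 : ℕ) : ℝ) + (D + 1) := by exact_mod_cast h
    linarith
  have hinv : ((2 ^ r : ℕ) : ℝ)⁻¹ ≤ 1 - μ := by
    have hN : (0 : ℝ) < ((2 ^ r : ℕ) : ℝ) := by positivity
    have hfind : 2 ^ s ≤ 2 ^ searchExp s D c * (2 ^ s - D - 1) ∨ s ^ c ≤ 2 ^ searchExp s D c :=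
      Nat.find_spec (exists_searchExp s D c)
    rw [hr] at hfind
    rcases hfind with h | h
    · have h' : (2 : ℝ) ^ s ≤ ((2 ^ r : ℕ) : ℝ) * ((2 ^ s - D - 1 : ℕ) : ℝ) := by
        rw [← Nat.cast_mul]
        exact_mod_cast h
      rw [inv_le_iff_one_le_mul₀' hN]
      refine le_of_mul_le_mul_left ?_ h2
      calc 2 ^ s * 1 ≤ ((2 ^ r : ℕ) : ℝ) * (2 ^ s * (1 - μ)) := by
            rw [mul_one]
            exact h'.trans (mul_le_mul_of_nonneg_left hxle hN.le)
        _ = 2 ^ s * (((2 ^ r : ℕ) : ℝ) * (1 - μ)) := by ring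
    · refine le_trans (inv_anti₀ hs' ?_) hc
      exact_mod_cast h
  -- The exponent zero would mean `1 ≤ 1 - μ`.
  rcases r with _ | k
  · norm_num at hinv
    linarith
  refine ⟨k.succ_pos, hinv, ?_⟩
  have hk := Nat.find_min (exists_searchExp s D c) (m := k) (show k < searchExp s D c by omega)
  rw [not_or, not_le, not_le] at hk
  have hk' : (2 : ℝ) ^ k * ((2 ^ s - D - 1 : ℕ) : ℝ) < 2 ^ s := by exact_mod_cast hk.1
  -- Makes the rounding error 1 at most half of `2 ^ s (1 - μ)`.
  have h3 : 2 ≤ 2 ^ s * (1 - μ) := by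
    have h4 : 1 ≤ (s : ℝ) ^ c * (1 - μ) := (inv_le_iff_one_le_mul₀' hs').1 hc
    nlinarith
  have h5 : (2 : ℝ) ^ k * (2 ^ s * (1 - μ) / 2) < 2 ^ s :=
    (mul_le_mul_of_nonneg_left (by linarith) (by positivity)).trans_lt hk'
  have h6 : (2 : ℝ) ^ k * (1 - μ) / 2 < 1 := by
    refine lt_of_mul_lt_mul_left ?_ h2.le
    linarith
  push_cast
  rw [pow_succ]
  linarith

/-- For `1/4 ≤ μ ≤ 1` one has `log μ ≥ 1 - 1/μ ≥ -4 (1 - μ)`, so `(N + 1) log μ ≥ -4 (4 + 1) = -20`.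
This is why the number of branches must not exceed `1 / (1 - μ)` by more than a constant factor. -/
lemma exp_neg_le_pow {μ : ℝ} {N : ℕ} (hμ : 1 / 4 ≤ μ) (hN : (N : ℝ) * (1 - μ) ≤ 4) :
    Real.exp (-20) ≤ μ ^ (N + 1) := by
  have h0 : 0 < μ := by linarith
  rw [← Real.le_log_iff_exp_le (by positivity), Real.log_pow]
  have h1 : 1 - μ⁻¹ ≤ Real.log μ := Real.one_sub_inv_le_log_of_pos h0
  have h2 : -4 * (1 - μ) ≤ Real.log μ ∨ 1 ≤ μ := by
    rcases le_or_gt 1 μ with h | h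
    · exact .inr h
    · left
      have h3 : μ⁻¹ ≤ 4 := by
        rw [inv_le_comm₀ h0 (by norm_num)]
        linarith
      have h4 : μ⁻¹ * μ = 1 := inv_mul_cancel₀ h0.ne'
      nlinarith
  push_cast
  have hN0 : (0 : ℝ) ≤ N := N.cast_nonneg
  rcases h2 with h2 | h2
  · nlinarith
  · have := Real.log_nonneg h2
    nlinarith

lemma eventually_searchExp_spec {S : Set ℕ} {μ : ℕ → ℝ} (hμ : ∀ s, 0 < μ s) {c : ℕ}
    (hc : ∀ᶠ s : ℕ in Filter.atTop, s ∈ S → ((s : ℝ) ^ c)⁻¹ ≤ 1 - μ s) :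
    ∀ᶠ s : ℕ in Filter.atTop, s ∈ S → ∀ r, searchExp s ⌊2 ^ s * μ s⌋₊ c = r →
      0 < r ∧ ((2 ^ r : ℕ) : ℝ)⁻¹ ≤ 1 - μ s ∧ ((2 ^ r : ℕ) : ℝ) * (1 - μ s) ≤ 4 := by
  have hpow : ∀ᶠ s : ℕ in Filter.atTop, (s : ℝ) ^ c / 2 ^ s < 1 / 2 :=
    (tendsto_pow_const_div_const_pow_of_one_lt c (one_lt_two)).eventually_lt_const (by norm_num)
  filter_upwards [hc, hpow, Filter.eventually_gt_atTop 0] with s hs hs2 hs0 hsS r hr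
  refine searchExp_spec (hμ s) hs0 (hs hsS) ?_ hr
  rw [div_lt_iff₀ (by positivity)] at hs2
  linarith

end

end QForge

/-! ### The main theorem -/

theorem mainTheorem1 (S : Set ℕ) (hS : S.Infinite) (μ : ℕ → ℝ)
    (hμ : ∀ s, 0 < μ s ∧ μ s ≤ 1)
    (hlow : QForge.NonNegligibleOn S (fun s => μ s - 1 / 4))
    (hhigh : QForge.NonNegligibleOn S (fun s => 1 - μ s)) :
    (∀ F : QForge.ClassicalPrimitive,
      ∃ A : QForge.QPTAdversary (F.publicInput μ),
        QForge.NonNegligibleOn S (fun s =>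
          F.winProb (μ s) s (A.out s)
            - QForge.classicalOverlap (QForge.numQueries (A.out s).circuit) (μ s))) ∧
    (∀ F : QForge.QuantumPrimitive,
      QForge.NonNegligibleOn S (fun s => 1 - F.overlap (μ s) s) →
      ∃ A : QForge.QPTAdversary (F.publicInput μ),
        QForge.NonNegligibleOn S (fun s =>
          F.winProb (μ s) s (A.out s) - F.overlap (μ s) s)) := by
  obtain ⟨c, hc⟩ := hhigh
  obtain ⟨d, hd⟩ := hlow
  have hspec := QForge.eventually_searchExp_spec (fun s => (hμ s).1) hc
  refine ⟨fun F => ?_, fun F hF => ?_⟩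
  · obtain ⟨A, hA⟩ := F.exists_adversary (fun s => (hμ s).2) c
    -- The advantage is at least `exp (-20)`, so the exponent one serves as soon as `s ≥ exp 20`.
    refine ⟨A, 1, ?_⟩
    filter_upwards [hspec, hd, tendsto_natCast_atTop_atTop.eventually_ge_atTop (Real.exp 20)]
      with s hs hds hexp hsS
    obtain ⟨hr, hinv, hN⟩ := hs hsS _ rfl
    obtain ⟨hbits, -, hcirc⟩ := hA s
    have hlow : 1 / 4 ≤ μ s := by
      have h1 := hds hsS
      have h2 : (0 : ℝ) ≤ ((s : ℝ) ^ d)⁻¹ := by positivity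
      linarith
    rw [F.winProb_eq_one hr hinv hbits hcirc, hcirc, QForge.numQueries_classicalCircuit,
      QForge.classicalOverlap, sub_sub_cancel, pow_one]
    refine le_trans ?_ (QForge.exp_neg_le_pow hlow hN)
    rw [Real.exp_neg]
    exact inv_anti₀ (Real.exp_pos _) hexp
  · obtain ⟨A, hA⟩ := F.exists_adversary (fun s => (hμ s).2) c
    obtain ⟨d, hd⟩ := hF
    -- The adversary wins with certainty, so its advantage is the quantity bounded in `hF`, with the
    -- same exponent.
    refine ⟨A, d, ?_⟩
    filter_upwards [hspec, hd] with s hs hds hsS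
    obtain ⟨-, hinv, -⟩ := hs hsS _ rfl
    obtain ⟨-, hgates, hcirc⟩ := hA s
    rw [F.winProb_eq_one hinv hgates hcirc]
    exact hds hsS
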